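/- Throughout, $\log$ is the logarithm to base $2$, $\mathbb F$ is a finite field, $m\ge 1$ and $d,t\ge 0$ are integers. A polynomial is *degree-$d$* if it has total degree at most $d$. A function $f\colon\mathbb F^m\to\mathbb F^t$ is *parallel degree-$d$* if each of its $t$ components is a degree-$d$ polynomial. The parallel Reed–Muller code $\mathrm{RM}^{\mathbb F,m,d,t}\subseteq(\mathbb F^t)^{|\mathbb F|^m}$ is the set of truth tables of all parallel degree-$d$ functions. For words $x,y$ of equal length, $\Delta(x,y)$ is the fraction of positions in which they differ (over the alphabet $\mathbb F^t$, two entries differ as soon as one of their $t$ coordinates differs). A word is $\delta$-far from a code if $\Delta\ge\delta$ to every codeword, and $\delta$-close to it otherwise. **(1) Codeword testing.** There is an absolute constant $C$ such that the following holds whenever $\mathrm{char}(\mathbb F)=2$ and $|\mathbb F|\ge\max\{6md,\;2^{100}\,m\log|\mathbb F|\}$. Let $\Sigma=\mathbb F^{d+1}$ be the set of univariate degree-$d$ polynomials over $\mathbb F$. There is a verifier which is given access to a word $T\circ\pi$, where $T\in(\mathbb F^t)^{|\mathbb F|^m}$ is a table and $\pi\in(\Sigma^t)^{L}$ is an auxiliary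 proof of length $L\le|\mathbb F|^m\cdot(m\log|\mathbb F|)^{C}$, such that: * it tosses at most $m\log|\mathbb F|+C\,(\log\log|\mathbb F|+\log m)$ unbiased coins and makes $2$ queries to $T\circ\pi$, whose positions are determined by the coins; * (efficiency) it is computed by uniform algorithms in polynomial time: there are two fixed random access machine programs, the same for all $\mathbb F,m,d,t$, the first of which computes the two query positions from $m,d,t$, the operation tables of $\mathbb F$ (in an arbitrary enumeration of $\mathbb F$) and the coins, and the second of which computes the decision from the same data and the two answers, each with logarithmic cost at most $(|\mathbb F|+m+d+t)^{C}$; * (perfect completeness) if $T\in\mathrm{RM}^{\mathbb F,m,d,t}$, then there is a proof $\pi$ such that the verifier accepts $T\circ\pi$ for all outcomes of the coins; * (soundness) if $T$ is $\delta$-far from $\mathrm{RM}^{\mathbb F,m,d,t}$, then for every $\pi$ the verifier rejects $T\circ\pi$ with probability at least $2^{-40}\delta$. **(2) The augmented derandomized parallel low degree test.** Let $\mathbb F$ be a finite field of any characteristic $p$ with $|\mathbb F|\ge 6md$ and $|\mathbb F|\ge2^{100}\,m\log|\mathbb F|$, and let $\lambda\le\frac1{2^{100}\,m\log|\mathbb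 F|}$. Let $S\subseteq\mathbb F^m$ be a $\lambda$-biased set, i.e. $S$ is non-empty, $S=-S$, and $\bigl|\mathbb E_{y\sim S}[\chi(y)]\bigr|\le\lambda$ for every non-trivial homomorphism $\chi$ from the additive group $\mathbb F^m$ to the complex $p$-th roots of unity. Write $\ell_{x,y}=\{x+a y: a\in\mathbb F\}$ for $x,y\in\mathbb F^m$. Let $f\colon\mathbb F^m\to\mathbb F^t$, and let $g$ assign to every line $\ell$ a function $g(\ell)\colon\ell\to\mathbb F^t$ that is a univariate parallel degree-$d$ polynomial along $\ell$. The test performs one of the following two checks, each with probability $\frac12$: (i) choose independent uniform $x\in\mathbb F^m$ and $y\in S$, and accept iff $f(x)=g(\ell_{x,y})(x)$; (ii) choose uniform $z\in\mathbb F^m$, and accept iff $f(z)=g(\ell_{0,z})(z)$. If the test accepts with probability at least $1-\delta$, where $\delta>0$, then $f$ is $2^{40}\delta$-close to $\mathrm{RM}^{\mathbb F,m,d,t}$; if it accepts with probability $1$, then $f$ is parallel degree-$d$. -/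

import Mathlib

namespace ParallelLDT

/-! ### Finite probability, words and distance -/

/-- The probability that `P a` holds for a uniformly random element `a` of the finite set `A`. -/
noncomputable def prOn {α : Type*} (A : Finset α) (P : α → Prop) : ℝ :=
  open Classical in ((A.filter P).card : ℝ) / (A.card : ℝ)

/-- A table `T ∈ (F^t)^(|F|^m)`, indexed by the points of `F^m`. -/
abbrev Table (F : Type*) (m t : ℕ) : Type _ := (Fin m → F) → (Fin t → F)

/-- Relative Hamming distance of two tables; a disagreement in any of the `t` coordinates of an
entry counts as a disagreement in this entry. -/
noncomputable def relDist {F : Type*} [Fintype F] {m t : ℕ} (T T' : Table F m t) : ℝ :=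
  prOn (Finset.univ : Finset (Fin m → F)) (fun x => T x ≠ T' x)

/-- `T` is `δ`-far from the set `C`. -/
def IsFar {F : Type*} [Fintype F] {m t : ℕ} (δ : ℝ) (T : Table F m t)
    (C : Set (Table F m t)) : Prop :=
  ∀ T' ∈ C, δ ≤ relDist T T'

/-- `T` is `δ`-close to the set `C`, that is, not `δ`-far from it. -/
def IsClose {F : Type*} [Fintype F] {m t : ℕ} (δ : ℝ) (T : Table F m t)
    (C : Set (Table F m t)) : Prop :=
  ¬ IsFar δ T C

/-- The codewords of the `(F, m, d, t)`-parallel Reed-Muller code: the truth tables of the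
functions `F^m → F^t` all of whose `t` components are polynomials of total degree at most `d`. -/
def parallelRM (F : Type*) [Field F] (m d t : ℕ) : Set (Table F m t) :=
  {T | ∀ j : Fin t, ∃ p : MvPolynomial (Fin m) F,
    p.totalDegree ≤ d ∧ ∀ x : Fin m → F, T x j = MvPolynomial.eval x p}

/-! ### Lines, small-biased sets and the augmented derandomized test -/

/-- The line through `x` in direction `y` (the single point `x` if `y = 0`). -/
def line {F : Type*} [Field F] {m : ℕ} (x y : Fin m → F) : Set (Fin m → F) :=
  Set.range (fun a : F => x + a • y)

/-- The set of lines in `F^m`. -/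
def Line (F : Type*) [Field F] (m : ℕ) : Type _ :=
  {l : Set (Fin m → F) // ∃ x y : Fin m → F, l = line x y}

/-- The line through `x` in direction `y` as an element of the set of lines. -/
def lineThrough {F : Type*} [Field F] {m : ℕ} (x y : Fin m → F) : Line F m :=
  ⟨line x y, x, y, rfl⟩

/-- An oracle that assigns to every line a univariate parallel degree-`d` polynomial on this line,
given as a map on points; only its values on the line matter. Being of degree at most `d` along
the line does not depend on the parametrization of the line. -/
structure LineOracle (F : Type*) [Field F] (m d t : ℕ) where
  toFun : Line F m → (Fin m → F) → (Fin t → F)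
  isPoly : ∀ x y : Fin m → F, ∀ j : Fin t, ∃ p : Polynomial F,
    p.natDegree ≤ d ∧ ∀ a : F, toFun (lineThrough x y) (x + a • y) j = p.eval a

/-- `S` is a `lam`-biased set in `F^m`. (As `F^m` has exponent `p = char F`, the homomorphisms from
`F^m` to the `p`-th roots of unity are all the additive characters of `F^m`.) -/
structure IsBiasedSet {F : Type*} [Field F] {m : ℕ} (lam : ℝ) (S : Finset (Fin m → F)) : Prop where
  nonempty : S.Nonempty
  symm : ∀ y ∈ S, -y ∈ S
  bias : ∀ χ : AddChar (Fin m → F) ℂ, χ ≠ 1 → ‖(∑ y ∈ S, χ y) / (S.card : ℂ)‖ ≤ lam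

/-- Acceptance probability of the derandomized parallel low degree test: `x` is uniform in `F^m`,
`y` is uniform in `S`, and the test accepts iff `f` agrees at `x` with the polynomial of the line
through `x` in direction `y`. -/
noncomputable def ldTestAccept {F : Type*} [Field F] [Fintype F] {m d t : ℕ}
    (S : Finset (Fin m → F)) (f : Table F m t) (g : LineOracle F m d t) : ℝ :=
  prOn ((Finset.univ : Finset (Fin m → F)) ×ˢ S)
    (fun xy => f xy.1 = g.toFun (lineThrough xy.1 xy.2) xy.1)

/-- Acceptance probability of the augmented test: with probability `1/2` each, the test above is
performed, or `z` is uniform in `F^m` and one checks whether `f` agrees at `z` with the polynomial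
of the line through the origin in direction `z`. -/
noncomputable def augLDTestAccept {F : Type*} [Field F] [Fintype F] {m d t : ℕ}
    (S : Finset (Fin m → F)) (f : Table F m t) (g : LineOracle F m d t) : ℝ :=
  (1 / 2) * ldTestAccept S f g +
    (1 / 2) * prOn (Finset.univ : Finset (Fin m → F))
      (fun z => f z = g.toFun (lineThrough 0 z) z)

/-! ### Two-query verifiers -/

/-- An entry of a word `T ∘ π`: a vector of `F^t` or a vector of `Σ^t`, where `Σ = F^(d+1)` is the
set of univariate polynomials of degree at most `d`. -/
abbrev Entry (F : Type*) (d t : ℕ) : Type _ := (Fin t → F) ⊕ (Fin t → Fin (d + 1) → F)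

/-- A (non-adaptive) verifier that reads two positions of `T ∘ π`, where `T` is a table and `π` is a
proof of length `proofLen` over the alphabet `Σ^t`. The queried positions depend on the coins,
the verdict (`true`: accept) on the coins and the two answers. -/
structure Verifier (F : Type*) (m d t : ℕ) where
  coins : ℕ
  proofLen : ℕ
  query : (Fin coins → Bool) → Fin 2 → (Fin m → F) ⊕ Fin proofLen
  verdict : (Fin coins → Bool) → (Fin 2 → Entry F d t) → Bool

/-- Proofs for the verifier `V`. -/
abbrev Verifier.Proof {F : Type*} {m d t : ℕ} (V : Verifier F m d t) : Type _ :=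
  Fin V.proofLen → Fin t → Fin (d + 1) → F

/-- The entry of `T ∘ π` at a given position. -/
def Verifier.read {F : Type*} {m d t : ℕ} (V : Verifier F m d t) (T : Table F m t) (π : V.Proof) :
    (Fin m → F) ⊕ Fin V.proofLen → Entry F d t :=
  Sum.map T π

/-- The answers to the two queries made on `T ∘ π` with coins `ρ`. -/
def Verifier.answers {F : Type*} {m d t : ℕ} (V : Verifier F m d t) (T : Table F m t)
    (π : V.Proof) (ρ : Fin V.coins → Bool) : Fin 2 → Entry F d t :=
  fun i => V.read T π (V.query ρ i)

/-- The verifier accepts `T ∘ π` with coins `ρ`. -/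
def Verifier.Accepts {F : Type*} {m d t : ℕ} (V : Verifier F m d t) (T : Table F m t)
    (π : V.Proof) (ρ : Fin V.coins → Bool) : Prop :=
  V.verdict ρ (V.answers T π ρ) = true

/-- The rejection probability over unbiased independent coins. -/
noncomputable def Verifier.rejectProb {F : Type*} {m d t : ℕ} (V : Verifier F m d t)
    (T : Table F m t) (π : V.Proof) : ℝ :=
  prOn (Finset.univ : Finset (Fin V.coins → Bool)) (fun ρ => ¬ V.Accepts T π ρ)

/-! ### A random access machine with logarithmic cost

Programs work on a memory of cells indexed by natural numbers and holding natural numbers. Every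
operation is charged one plus the number of binary digits of its result (addresses and operands
are results of subexpressions, so they are charged as well). -/

/-- Binary arithmetic operations; subtraction is truncated, `x / 0 = 0`, `x % 0 = x`. -/
inductive Op where
  | add | sub | mul | div | mod

def Op.apply : Op → ℕ → ℕ → ℕ
  | .add, a, b => a + b
  | .sub, a, b => a - b
  | .mul, a, b => a * b
  | .div, a, b => a / b
  | .mod, a, b => a % b

/-- Expressions; `load a` is the content of the cell whose address is the value of `a`. -/
inductive Expr where
  | const (n : ℕ)
  | load (a : Expr)
  | op (o : Op) (a b : Expr)

def Expr.eval (M : ℕ → ℕ) : Expr → ℕ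
  | .const n => n
  | .load a => M (a.eval M)
  | .op o a b => o.apply (a.eval M) (b.eval M)

def Expr.cost (M : ℕ → ℕ) : Expr → ℕ
  | .const n => 1 + n.size
  | .load a => 1 + a.cost M + (M (a.eval M)).size
  | .op o a b => 1 + a.cost M + b.cost M + (o.apply (a.eval M) (b.eval M)).size

/-- Structured programs; `assign a b` stores the value of `b` in the cell whose address is the
value of `a`; conditions are true when nonzero. -/
inductive Prog where
  | skip
  | assign (a b : Expr)
  | seq (p q : Prog)
  | ite (c : Expr) (p q : Prog)
  | loop (c : Expr) (p : Prog)

/-- `p.Runs M M' k`: started on memory `M`, the program `p` halts with memory `M'` at cost `k`. -/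
inductive Prog.Runs : Prog → (ℕ → ℕ) → (ℕ → ℕ) → ℕ → Prop where
  | skip (M : ℕ → ℕ) : Prog.Runs .skip M M 1
  | assign (a b : Expr) (M : ℕ → ℕ) :
      Prog.Runs (.assign a b) M (Function.update M (a.eval M) (b.eval M))
        (1 + a.cost M + b.cost M)
  | seq {p q : Prog} {M₁ M₂ M₃ : ℕ → ℕ} {k l : ℕ} :
      Prog.Runs p M₁ M₂ k → Prog.Runs q M₂ M₃ l → Prog.Runs (.seq p q) M₁ M₃ (1 + k + l)
  | iteTrue {c : Expr} {p q : Prog} {M M' : ℕ → ℕ} {k : ℕ} :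
      c.eval M ≠ 0 → Prog.Runs p M M' k → Prog.Runs (.ite c p q) M M' (1 + c.cost M + k)
  | iteFalse {c : Expr} {p q : Prog} {M M' : ℕ → ℕ} {k : ℕ} :
      c.eval M = 0 → Prog.Runs q M M' k → Prog.Runs (.ite c p q) M M' (1 + c.cost M + k)
  | loopDone {c : Expr} {p : Prog} {M : ℕ → ℕ} :
      c.eval M = 0 → Prog.Runs (.loop c p) M M (1 + c.cost M)
  | loopStep {c : Expr} {p : Prog} {M₁ M₂ M₃ : ℕ → ℕ} {k l : ℕ} :
      c.eval M₁ ≠ 0 → Prog.Runs p M₁ M₂ k → Prog.Runs (.loop c p) M₂ M₃ l →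
      Prog.Runs (.loop c p) M₁ M₃ (1 + c.cost M₁ + k + l)

/-- The memory that holds the input `w` in its first cells and zeros elsewhere. -/
def memOf (w : List ℕ) : ℕ → ℕ := fun i => w.getD i 0

/-! ### Efficiency of a verifier

Field elements are represented by their numbers in an enumeration `e` of `F`, and the field itself
by its addition and multiplication tables. -/

/-- The operation table of `f`, row by row. -/
def opTable {F : Type*} {q : ℕ} (e : F ≃ Fin q) (f : F → F → F) : List ℕ :=
  (List.finRange q).flatMap fun a => (List.finRange q).map fun b =>
    ((e (f (e.symm a) (e.symm b)) : Fin q) : ℕ)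

/-- The input given to the verifier: the parameters, the field tables, the coins. -/
def inputWord {F : Type*} [Field F] {q : ℕ} (e : F ≃ Fin q) (m d t : ℕ) {r : ℕ}
    (ρ : Fin r → Bool) : List ℕ :=
  [q, m, d, t] ++ opTable e (fun a b => a + b) ++ opTable e (fun a b => a * b) ++
    List.ofFn (fun i => (ρ i).toNat)

/-- The numbers representing an entry of `T ∘ π`. -/
def entryWord {F : Type*} {q d t : ℕ} (e : F ≃ Fin q) : Entry F d t → List ℕ
  | .inl v => List.ofFn (fun j => (e (v j) : ℕ))
  | .inr v => (List.finRange t).flatMap fun j => List.ofFn (fun k => (e (v j k) : ℕ))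

/-- The position in the word `T ∘ π`: the entry of `T` at `x` has the number whose base `q` digits
are the numbers of the coordinates of `x`, and the `q ^ m` entries of `T` precede those of `π`. -/
def posCode {F : Type*} {q m L : ℕ} (e : F ≃ Fin q) : (Fin m → F) ⊕ Fin L → ℕ
  | .inl x => (finFunctionFinEquiv (fun i => e (x i)) : Fin (q ^ m))
  | .inr i => q ^ m + i

/-- The programs `Q` and `D` carry out the verifier `V` with cost at most `B` each: from the
parameters, the field and the coins, `Q` computes the two query positions (in cells `0` and `1`);
given moreover the answers, `D` computes the verdict (in cell `0`). -/
def Verifier.RunsWithin {F : Type*} [Field F] {q m d t : ℕ} (V : Verifier F m d t)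
    (e : F ≃ Fin q) (Q D : Prog) (B : ℕ) : Prop :=
  (∀ ρ : Fin V.coins → Bool, ∃ (M : ℕ → ℕ) (k : ℕ),
    Q.Runs (memOf (inputWord e m d t ρ)) M k ∧ k ≤ B ∧
      M 0 = posCode e (V.query ρ 0) ∧ M 1 = posCode e (V.query ρ 1)) ∧
  (∀ (ρ : Fin V.coins → Bool) (T : Table F m t) (π : V.Proof), ∃ (M : ℕ → ℕ) (k : ℕ),
    D.Runs (memOf (inputWord e m d t ρ ++ entryWord e (V.answers T π ρ 0) ++
        entryWord e (V.answers T π ρ 1))) M k ∧ k ≤ B ∧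
      M 0 = (V.verdict ρ (V.answers T π ρ)).toNat)

end ParallelLDT

open ParallelLDT

namespace ParallelLDT
open Polynomial

/-! ### Bivariate divisibility via resultants. -/

section Bivariate
variable {F : Type*} [Field F]

/-! Both statements rest on `exists_parallelRM_of_close`. It concerns a family of directions `y i`
satisfying `CharBound`: a nontrivial additive character is trivial on at most a `τ`-fraction of the
lines `F • y i`. If `f` is close on average to functions `G i` of degree at most `d` along `y i`,
and agrees on at least about half of the points with low degree functions on rays through the
origin, then `f` is close to the code.

The heart is a variational argument, `exists_dirDeg_of_close`. For a function `h`, let `closest d v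
h` be a best approximation of degree at most `d` along all lines in direction `v`. Choose `h`
minimising its distance to `f` plus heavily weighted, truncated distances to its own approximations
in the directions `y i`. If the untruncated distances were not all zero, replacing `h` by one of its
approximations would be cheaper, because on average these differ from one another far less than from
`h`. This contraction, `sum_sum_diffCount_closest_le`, has two ingredients. By the method of
Polishchuk and Spielman, if rows and columns of a plane are mostly consistent, an error-locating
polynomial can be divided out to give one bivariate polynomial, which forces two approximations to
agree at the centre of the plane (`plane_consistent`). By Fourier analysis, lines and planes through
most points are typical, and the exceptional fraction is at most a constant times `τ` times the
distance (`card_line_sum_ge_le`). The error locator is shared by all coordinates, so vector values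
cost nothing.

The minimiser thus has degree at most `d` along more than half of the directions. These span the
space, since a character trivial on a proper span would violate `CharBound`; hence the minimiser is
a polynomial of degree at most the dimension times `d`. If its degree exceeded `d`, its top
homogeneous component would show up as a leading coefficient on most rays, and functions of degree
at most `d` on the rays could not agree with it often enough (`card_ray_agree_le`).

For part (2), small bias gives `CharBound` with `τ = 1/|F| + λ`. For part (1), the directions are
`2^k` points of the moment curve, with `2^k` at least `2^50` times the dimension; by Vandermonde, as
many of them as the dimension always span, so few of the lines can be annihilated by a nontrivial
character. In characteristic two the numbers of lines and of points per line are powers of two, so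
coin sequences correspond bijectively to pairs of a line and a point on it. It remains to implement
this verifier on the machine, where cost is bounded by a static weight of the program times the
register size times a repetition count. -/

theorem coeff_coeff_swap (p : F[X][X]) (i j : ℕ) :
    ((Bivariate.swap p).coeff i).coeff j = (p.coeff j).coeff i := by
  induction p using Polynomial.induction_on' with
  | add p q hp hq => simp [hp, hq]
  | monomial n a =>
    induction a using Polynomial.induction_on' with
    | add p q hp hq => simp [hp, hq]
    | monomial m r =>
      rw [Bivariate.swap_monomial_monomial]
      simp only [coeff_monomial]
      split_ifs <;> simp_all [coeff_monomial]

theorem natDegree_coeff_le_natDegree_swap (p : F[X][X]) (j : ℕ) :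
    (p.coeff j).natDegree ≤ (Bivariate.swap p).natDegree := by
  rw [natDegree_le_iff_coeff_eq_zero]
  intro N hN
  rw [← coeff_coeff_swap, coeff_eq_zero_of_natDegree_lt hN, coeff_zero]

theorem natDegree_swap_le {p : F[X][X]} {D : ℕ} (h : ∀ j, (p.coeff j).natDegree ≤ D) :
    (Bivariate.swap p).natDegree ≤ D := by
  rw [natDegree_le_iff_coeff_eq_zero]
  intro N hN
  ext j
  rw [coeff_coeff_swap, coeff_eq_zero_of_natDegree_lt ((h j).trans_lt hN), coeff_zero]

/-- Each term of the Leibniz expansion takes `m` entries from columns of coefficients of `P` and `n`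
from columns of coefficients of `E`; degrees are in the variable that is not eliminated. -/
theorem natDegree_resultant_le (E P : F[X][X]) (m n ex px : ℕ)
    (hE : ∀ j, (E.coeff j).natDegree ≤ ex) (hP : ∀ j, (P.coeff j).natDegree ≤ px) :
    (resultant E P m n).natDegree ≤ m * px + n * ex := by
  rw [resultant, Matrix.det_apply]
  refine natDegree_sum_le_of_forall_le _ _ fun σ _ => ?_
  refine (natDegree_smul_le _ _).trans ?_
  refine (natDegree_prod_le _ _).trans ?_
  rw [Fin.sum_univ_add]
  refine add_le_add ?_ ?_
  · refine (Finset.sum_le_card_nsmul _ _ px fun i _ => ?_).trans (by simp)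
    simp only [sylvester, Matrix.of_apply, Fin.addCases_left]
    split_ifs
    · exact hP _
    · simp
  · refine (Finset.sum_le_card_nsmul _ _ ex fun i _ => ?_).trans (by simp)
    simp only [sylvester, Matrix.of_apply, Fin.addCases_right]
    split_ifs
    · exact hE _
    · simp

/-- A kernel vector of the Sylvester matrix is a relation `E * x₂ + P * x₁ = 0` with `x₁` of degree
below that of `E`. Relative primality would make `E` divide `x₁`, killing both. Only the degree of
`E` has to be exact. -/
theorem not_isRelPrime_of_resultant_eq_zero {R : Type*} [CommRing R] [IsDomain R]
    [UniqueFactorizationMonoid R] {E P : R[X]} (hE : E ≠ 0)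
    {n : ℕ} (hn : P.natDegree ≤ n) (h : resultant E P E.natDegree n = 0) : ¬ IsRelPrime E P := by
  intro hrel
  rw [resultant, ← Matrix.exists_mulVec_eq_zero_iff] at h
  obtain ⟨v, hv0, hv⟩ := h
  rw [← toMatrix_sylvesterMap' E P le_rfl hn] at hv
  set b := (((degreeLT.basis R E.natDegree).prod (degreeLT.basis R n)).reindex finSumFinEquiv)
  set x := b.repr.symm (Finsupp.equivFunOnFinite.symm v)
  have hx : v = b.repr x := by simp [x]
  rw [hx, LinearMap.toMatrix_mulVec_repr] at hv
  have hx0 : x ≠ 0 := by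
    rintro h0
    rw [h0] at hx
    exact hv0 (by simpa using hx)
  have hk : sylvesterMap E P le_rfl hn x = 0 := by
    apply (degreeLT.basis R (E.natDegree + n)).repr.injective
    ext i
    simpa using congrFun hv i
  have hk' : E * (x.2 : R[X]) + P * (x.1 : R[X]) = 0 := congrArg Subtype.val hk
  have hd : E ∣ P * (x.1 : R[X]) := ⟨-(x.2 : R[X]), by linear_combination hk'⟩
  have h1 : (x.1 : R[X]) = 0 := by
    refine eq_zero_of_dvd_of_degree_lt (hrel.dvd_of_dvd_mul_left hd) ?_
    rw [degree_eq_natDegree hE]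
    exact mem_degreeLT.1 x.1.2
  rw [h1, mul_zero, add_zero] at hk'
  have h2 : (x.2 : R[X]) = 0 := (mul_eq_zero.1 hk').resolve_left hE
  exact hx0 (Prod.ext (Subtype.ext h1) (Subtype.ext h2))

/-- Over the point `a`, the polynomial `P` is divisible by `E`, with a quotient of degree at
most `d`. -/
def DvdAt (d : ℕ) (E P : F[X][X]) (a : F) : Prop :=
  ∃ c : F[X], c.natDegree ≤ d ∧ P.map (evalRingHom a) = E.map (evalRingHom a) * c

/-- Modulo `X - a` the polynomial `P` is a multiple of `E`. Subtracting that multiple does not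
change the resultant, and the remaining factor `X - a` comes out once for each degree of `E`. -/
theorem pow_dvd_resultant_of_dvdAt {d : ℕ} {E P : F[X][X]} {a : F} {n : ℕ} (h : DvdAt d E P a)
    (hn : E.natDegree + d ≤ n) :
    (X - C a) ^ E.natDegree ∣ resultant E P E.natDegree n := by
  obtain ⟨c, hc, h⟩ := h
  have hdvd : C (X - C a) ∣ P - E * c.map C := by
    rw [C_dvd_iff_dvd_coeff]
    intro i
    rw [dvd_iff_isRoot, IsRoot, ← coe_evalRingHom, ← coeff_map, Polynomial.map_sub,
      Polynomial.map_mul, h, Polynomial.map_map]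
    have : (evalRingHom a).comp C = RingHom.id F := by ext; simp
    simp [this]
  obtain ⟨T, hT⟩ := hdvd
  have hP : P = C (X - C a) * T + E * c.map C := by rw [← hT]; ring
  rw [hP, resultant_add_mul_right _ _ _ _ _ _ le_rfl, resultant_C_mul_right]
  · exact dvd_mul_right _ _
  · exact (add_le_add natDegree_map_le le_rfl).trans (by omega)

/-- With degrees `e` of `E` in the eliminated variable and `e'` in the other, the resultant has
degree at most `e(e' + d) + (e + d)e'`, hence at most `e(2e' + 2d)` when `e' ≤ e`. It vanishes to
order `e` at more than `2e' + 2d` points, so it is zero. -/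
theorem not_isRelPrime_of_dvdAt {d : ℕ} {E P : F[X][X]} (hE : E ≠ 0)
    (hy : P.natDegree ≤ E.natDegree + d)
    (hx : (Bivariate.swap P).natDegree ≤ (Bivariate.swap E).natDegree + d)
    (hxy : (Bivariate.swap E).natDegree ≤ E.natDegree) (h0 : 0 < E.natDegree) {A : Finset F}
    (hA : 2 * (Bivariate.swap E).natDegree + 2 * d < A.card) (h : ∀ a ∈ A, DvdAt d E P a) :
    ¬ IsRelPrime E P := by
  refine not_isRelPrime_of_resultant_eq_zero hE hy ?_
  by_contra hne
  have hdvd : ∏ a ∈ A, (X - C a) ^ E.natDegree ∣ resultant E P E.natDegree (E.natDegree + d) := by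
    refine Finset.prod_dvd_of_coprime ?_ fun a ha => pow_dvd_resultant_of_dvdAt (h a ha) le_rfl
    intro a _ b _ hab
    exact (isCoprime_X_sub_C_of_isUnit_sub (sub_ne_zero.2 hab).isUnit).pow
  have h1 := natDegree_le_of_dvd hdvd hne
  rw [natDegree_prod_of_monic _ _ fun a _ => (monic_X_sub_C a).pow _] at h1
  simp only [natDegree_pow, natDegree_X_sub_C, Finset.sum_const, smul_eq_mul] at h1
  have h2 := natDegree_resultant_le E P E.natDegree (E.natDegree + d) _ _
    (natDegree_coeff_le_natDegree_swap E) fun j => (natDegree_coeff_le_natDegree_swap P j).trans hx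
  have h3 : (2 * (Bivariate.swap E).natDegree + 2 * d + 1) * E.natDegree ≤
    A.card * E.natDegree := Nat.mul_le_mul_right _ hA
  have h4 : d * (Bivariate.swap E).natDegree ≤ d * E.natDegree := Nat.mul_le_mul_left _ hxy
  nlinarith

theorem card_map_eval_eq_zero_le {D : F[X][X]} (hD : D ≠ 0) {A : Finset F}
    (hA : ∀ a ∈ A, D.map (evalRingHom a) = 0) : A.card ≤ (Bivariate.swap D).natDegree := by
  refine (card_le_degree_of_subset_roots (p := D.leadingCoeff) ?_).trans
    (natDegree_coeff_le_natDegree_swap D _)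
  intro a ha
  rw [mem_roots (leadingCoeff_ne_zero.2 hD), IsRoot, ← coe_evalRingHom, leadingCoeff,
    ← coeff_map, hA a ha, coeff_zero]

theorem DvdAt.of_mul_left {d : ℕ} {D E P : F[X][X]} {a : F} (h : DvdAt d (D * E) (D * P) a)
    (hD : D.map (evalRingHom a) ≠ 0) : DvdAt d E P a := by
  obtain ⟨c, hc, h⟩ := h
  refine ⟨c, hc, mul_left_cancel₀ hD ?_⟩
  rw [Polynomial.map_mul, Polynomial.map_mul] at h
  rw [h, mul_assoc]

theorem exists_subset_map_eval_ne_zero {D : F[X][X]} (hD : D ≠ 0) (A : Finset F) :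
    ∃ A' ⊆ A, A.card ≤ A'.card + (Bivariate.swap D).natDegree ∧
      ∀ a ∈ A', D.map (evalRingHom a) ≠ 0 := by
  classical
  refine ⟨A.filter fun a => D.map (evalRingHom a) ≠ 0, Finset.filter_subset _ _, ?_, by simp⟩
  rw [← Finset.card_filter_add_card_filter_not (s := A) fun a => D.map (evalRingHom a) ≠ 0]
  refine add_le_add le_rfl (card_map_eval_eq_zero_le hD ?_)
  simp

theorem isUnit_of_natDegree_eq_zero {D : F[X][X]} (hD : D ≠ 0) (h1 : D.natDegree = 0)
    (h2 : (Bivariate.swap D).natDegree = 0) : IsUnit D := by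
  obtain ⟨p, rfl⟩ := natDegree_eq_zero.1 h1
  have := natDegree_coeff_le_natDegree_swap (C p) 0
  rw [h2, coeff_C_zero] at this
  obtain ⟨r, rfl⟩ := natDegree_eq_zero.1 (Nat.le_zero.1 this)
  have hr : r ≠ 0 := by rintro rfl; simp at hD
  exact (hr.isUnit.map C).map C

/-- The bivariate divisibility lemma of Polishchuk and Spielman. -/
theorem dvd_of_dvdAt {d : ℕ} {E P : F[X][X]} (hE : E ≠ 0)
    (hy : P.natDegree ≤ E.natDegree + d)
    (hx : (Bivariate.swap P).natDegree ≤ (Bivariate.swap E).natDegree + d) {A B : Finset F}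
    (hA : 2 * (Bivariate.swap E).natDegree + 2 * d < A.card)
    (hB : 2 * E.natDegree + 2 * d < B.card)
    (hEA : ∀ a ∈ A, DvdAt d E P a)
    (hEB : ∀ b ∈ B, DvdAt d (Bivariate.swap E) (Bivariate.swap P) b) : E ∣ P := by
  induction hs : E.natDegree + (Bivariate.swap E).natDegree using Nat.strong_induction_on
    generalizing E P A B with
  | _ s ih =>
    have hsE : Bivariate.swap E ≠ 0 := by simpa using hE
    by_cases hP : P = 0
    · simp [hP]
    by_cases hrel : IsRelPrime E P
    · have hrel' : IsRelPrime (Bivariate.swap E) (Bivariate.swap P) := by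
        intro z hz1 hz2
        have h1 := map_dvd (Bivariate.swap (R := F)) hz1
        have h2 := map_dvd (Bivariate.swap (R := F)) hz2
        rw [Bivariate.swap_swap_apply] at h1 h2
        have := (hrel h1 h2).map (Bivariate.swap (R := F))
        rwa [Bivariate.swap_swap_apply] at this
      refine (isUnit_of_natDegree_eq_zero hE ?_ ?_).dvd
      · by_contra h0
        -- The resultant bound needs the larger degree in the eliminated variable; in the other case
        -- the variables are exchanged.
        rcases le_total (Bivariate.swap E).natDegree E.natDegree with hle | hle
        · exact not_isRelPrime_of_dvdAt hE hy hx hle (by omega) hA hEA hrel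
        · exact not_isRelPrime_of_dvdAt hsE hx (by simpa only [Bivariate.swap_swap_apply] using hy)
            (by simpa only [Bivariate.swap_swap_apply] using hle) (by omega)
            (by simpa only [Bivariate.swap_swap_apply] using hB) hEB hrel'
      · by_contra h0
        rcases le_total (Bivariate.swap E).natDegree E.natDegree with hle | hle
        · exact not_isRelPrime_of_dvdAt hE hy hx hle (by omega) hA hEA hrel
        · exact not_isRelPrime_of_dvdAt hsE hx (by simpa only [Bivariate.swap_swap_apply] using hy)
            (by simpa only [Bivariate.swap_swap_apply] using hle) (by omega)
            (by simpa only [Bivariate.swap_swap_apply] using hB) hEB hrel'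
    · simp only [IsRelPrime, not_forall] at hrel
      obtain ⟨D, ⟨E', rfl⟩, ⟨P', rfl⟩, hu⟩ := hrel
      obtain ⟨hD, hE'⟩ := mul_ne_zero_iff.1 hE
      have hP' := right_ne_zero_of_mul hP
      have hsD : Bivariate.swap D ≠ 0 := by simpa using hD
      have hsE' : Bivariate.swap E' ≠ 0 := by simpa using hE'
      have hsP' : Bivariate.swap P' ≠ 0 := by simpa using hP'
      have hpos : 0 < D.natDegree + (Bivariate.swap D).natDegree := by
        by_contra h0
        exact hu (isUnit_of_natDegree_eq_zero hD (by omega) (by omega))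
      rw [map_mul, map_mul, natDegree_mul hsD hsP', natDegree_mul hsD hsE'] at hx
      rw [map_mul, natDegree_mul hsD hsE'] at hA hs
      rw [map_mul, map_mul] at hEB
      rw [natDegree_mul hD hE'] at hy hB hs
      rw [natDegree_mul hD hP'] at hy
      -- Fibres where the cancelled factor vanishes are dropped. They are at most as many as its
      -- degree, while the required number of fibres falls by twice that degree.
      obtain ⟨A', hA'A, hA'c, hA'D⟩ := exists_subset_map_eval_ne_zero hD A
      obtain ⟨B', hB'B, hB'c, hB'D⟩ := exists_subset_map_eval_ne_zero hsD B
      rw [Bivariate.swap_swap_apply] at hB'c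
      refine mul_dvd_mul_left D (ih _ ?_ hE' ?_ ?_ (A := A') (B := B') ?_ ?_ ?_ ?_ rfl)
      · omega
      · omega
      · omega
      · omega
      · omega
      · exact fun a ha => (hEA a (hA'A ha)).of_mul_left (hA'D a ha)
      · exact fun b hb => (hEB b (hB'B hb)).of_mul_left (hB'D b hb)

end Bivariate
end ParallelLDT

namespace ParallelLDT
open Polynomial

/-! ### Low degree testing on a plane. -/

section Plane
variable {F : Type*} [Field F]

/-- `u` is given by a univariate polynomial of degree at most `d`. -/
def PolyDeg (d : ℕ) (u : F → F) : Prop :=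
  ∃ p : F[X], p.natDegree ≤ d ∧ ∀ a, u a = p.eval a

theorem PolyDeg.mul {d d' : ℕ} {u v : F → F} (hu : PolyDeg d u) (hv : PolyDeg d' v) :
    PolyDeg (d + d') fun a => u a * v a := by
  obtain ⟨p, hp, hu⟩ := hu
  obtain ⟨r, hr, hv⟩ := hv
  exact ⟨p * r, natDegree_mul_le.trans (add_le_add hp hr), fun a => by simp [hu, hv]⟩

theorem PolyDeg.eq_sum_lagrange {d : ℕ} {u : F → F} (hu : PolyDeg d u) [DecidableEq F]
    {N : Finset F} (hN : d < N.card) (a : F) :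
    u a = ∑ n ∈ N, u n * (Lagrange.basis N id n).eval a := by
  obtain ⟨p, hp, hu⟩ := hu
  have h := Lagrange.eq_interpolate_of_eval_eq (s := N) (v := id) (f := p) u
    (Function.injective_id.injOn)
    (((degree_le_of_natDegree_le hp).trans_lt (by exact_mod_cast hN)))
    (fun i _ => (hu i).symm)
  rw [hu, h, Lagrange.interpolate_apply, eval_finsetSum]
  simp

theorem PolyDeg.eq_of_card_lt {d : ℕ} {u v : F → F} (hu : PolyDeg d u) (hv : PolyDeg d v)
    {A : Finset F} (hA : d < A.card) (h : ∀ a ∈ A, u a = v a) : u = v := by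
  obtain ⟨p, hp, hu⟩ := hu
  obtain ⟨r, hr, hv⟩ := hv
  have : p = r := by
    refine eq_of_degree_sub_lt_of_eval_finset_eq A ?_ fun a ha => by rw [← hu, ← hv, h a ha]
    refine (degree_le_of_natDegree_le ?_).trans_lt (b := (d : WithBot ℕ)) (by exact_mod_cast hA)
    exact (natDegree_sub_le _ _).trans (max_le hp hr)
  ext a
  rw [hu, hv, this]

theorem map_evalRingHom_swap_eval (p : F[X][X]) (a b : F) :
    ((Bivariate.swap p).map (evalRingHom b)).eval a = (p.map (evalRingHom a)).eval b := by
  induction p using Polynomial.induction_on' with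
  | add p q hp hq => simp only [map_add, Polynomial.map_add, eval_add, hp, hq]
  | monomial n c =>
    induction c using Polynomial.induction_on' with
    | add p q hp hq => simp only [map_add, Polynomial.map_add, eval_add, hp, hq]
    | monomial m r =>
      rw [Bivariate.swap_monomial_monomial]
      simp only [map_monomial, eval_monomial, coe_evalRingHom]
      ring

theorem natDegree_sum_lift_le {ι : Type*} (s : Finset ι) (l c : ι → F[X]) {d : ℕ}
    (hc : ∀ i ∈ s, (c i).natDegree ≤ d) :
    (∑ i ∈ s, C (l i) * (c i).map C).natDegree ≤ d :=
  natDegree_sum_le_of_forall_le _ _ fun i hi =>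
    (natDegree_C_mul_le _ _).trans (natDegree_map_le.trans (hc i hi))

/-- Lagrange interpolation in the first variable through `d + 1` fibres, on each of which `u` is a
polynomial in the second variable. -/
theorem exists_bivariate_of_polyDeg [Fintype F] {d : ℕ} (hd : d < Fintype.card F) (u : F → F → F)
    (h1 : ∀ b, PolyDeg d fun a => u a b) (h2 : ∀ a, PolyDeg d (u a)) :
    ∃ P : F[X][X], P.natDegree ≤ d ∧ (Bivariate.swap P).natDegree ≤ d ∧
      ∀ a b, u a b = (P.map (evalRingHom a)).eval b := by
  classical
  obtain ⟨N, -, hN⟩ := Finset.exists_subset_card_eq (s := (Finset.univ : Finset F)) (n := d + 1)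
    (by simpa using hd)
  choose c hc hu using h2
  refine ⟨∑ n ∈ N, C (Lagrange.basis N id n) * (c n).map C,
    natDegree_sum_lift_le _ _ _ fun i _ => hc i, ?_, fun a b => ?_⟩
  · refine natDegree_swap_le fun j => ?_
    rw [finsetSum_coeff]
    refine natDegree_sum_le_of_forall_le _ _ fun n hn => ?_
    rw [coeff_C_mul, coeff_map]
    refine (natDegree_mul_C_le _ _).trans ?_
    rw [Lagrange.natDegree_basis Function.injective_id.injOn hn, hN, Nat.add_sub_cancel]
  · rw [(h1 b).eq_sum_lagrange (N := N) (by omega) a]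
    simp only [Polynomial.map_sum, eval_finsetSum, Polynomial.map_mul, Polynomial.map_map, map_C,
      eval_mul, eval_C, coe_evalRingHom]
    refine Finset.sum_congr rfl fun n _ => ?_
    have : (evalRingHom a).comp C = RingHom.id F := by ext; simp
    rw [this, Polynomial.map_id, hu, mul_comm]

/-- There are more free coefficients than linear conditions. This produces the error locator. -/
theorem exists_bivariate_vanishing (e : ℕ) (S : Finset (F × F)) (hS : S.card < (e + 1) * (e + 1)) :
    ∃ E : F[X][X], E ≠ 0 ∧ E.natDegree ≤ e ∧ (Bivariate.swap E).natDegree ≤ e ∧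
      ∀ s ∈ S, (E.map (evalRingHom s.1)).eval s.2 = 0 := by
  classical
  let φ : (Fin (e + 1) × Fin (e + 1) → F) →ₗ[F] (S → F) :=
    { toFun := fun c s => ∑ ij, c ij * (s.1.1 ^ (ij.1 : ℕ) * s.1.2 ^ (ij.2 : ℕ))
      map_add' := fun c c' => by ext s; simp [add_mul, Finset.sum_add_distrib]
      map_smul' := fun r c => by ext s; simp [Finset.mul_sum, mul_assoc] }
  have hker : LinearMap.ker φ ≠ ⊥ := LinearMap.ker_ne_bot_of_finrank_lt (by simpa using hS)
  obtain ⟨c, hc, hc0⟩ := (Submodule.ne_bot_iff _).1 hker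
  have hcoeff : ∀ i j : ℕ, ((∑ ij : Fin (e + 1) × Fin (e + 1),
      monomial (ij.2 : ℕ) (monomial (ij.1 : ℕ) (c ij))).coeff j).coeff i =
      if h : i < e + 1 ∧ j < e + 1 then c (⟨i, h.1⟩, ⟨j, h.2⟩) else 0 := by
    intro i j
    rw [finsetSum_coeff, finsetSum_coeff]
    split_ifs with h
    · rw [Finset.sum_eq_single (⟨i, h.1⟩, ⟨j, h.2⟩)]
      · simp
      · rintro ⟨i', j'⟩ _ hne
        simp only [coeff_monomial]
        by_cases hj : (j' : ℕ) = j
        · rw [if_pos hj, coeff_monomial, if_neg]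
          rintro rfl
          exact hne (by ext <;> simp [hj])
        · simp [hj]
      · simp
    · refine Finset.sum_eq_zero ?_
      rintro ⟨i', j'⟩ _
      simp only [coeff_monomial]
      by_cases hj : (j' : ℕ) = j
      · rw [if_pos hj, coeff_monomial, if_neg]
        rintro rfl
        exact h ⟨i'.2, hj ▸ j'.2⟩
      · simp [hj]
  refine ⟨∑ ij : Fin (e + 1) × Fin (e + 1), monomial (ij.2 : ℕ) (monomial (ij.1 : ℕ) (c ij)),
    ?_, ?_, ?_, ?_⟩
  · intro h0
    refine hc0 (funext fun ij => ?_)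
    have := hcoeff ij.1 ij.2
    rw [h0, coeff_zero, coeff_zero, dif_pos ⟨ij.1.2, ij.2.2⟩] at this
    exact this.symm
  · exact natDegree_sum_le_of_forall_le _ _ fun ij _ =>
      (natDegree_monomial_le _).trans (by omega)
  · refine natDegree_swap_le fun j => ?_
    rw [natDegree_le_iff_coeff_eq_zero]
    intro i hi
    rw [hcoeff, dif_neg (by omega)]
  · intro s hs
    have := congrFun (LinearMap.mem_ker.1 hc) ⟨s, hs⟩
    rw [← show φ c ⟨s, hs⟩ = 0 from this]
    simp only [Polynomial.map_sum, eval_finsetSum, map_monomial, eval_monomial, coe_evalRingHom,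
      φ, LinearMap.coe_mk, AddHom.coe_mk, mul_assoc]

theorem PolyDeg.map_eval {d : ℕ} {P : F[X][X]} (hP : P.natDegree ≤ d) (a : F) :
    PolyDeg d fun b => (P.map (evalRingHom a)).eval b :=
  ⟨_, natDegree_map_le.trans hP, fun _ => rfl⟩

theorem PolyDeg.map_eval' {d : ℕ} {P : F[X][X]} (hP : (Bivariate.swap P).natDegree ≤ d) (b : F) :
    PolyDeg d fun a => (P.map (evalRingHom a)).eval b :=
  ⟨_, natDegree_map_le.trans hP, fun a => (map_evalRingHom_swap_eval P a b).symm⟩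

/-- Every higher coefficient vanishes at all points of `F` and has too small a degree for that
unless it is zero. This sharpens an a priori bound on `P` to one in terms of the actual degree of
`E`, as `dvd_of_dvdAt` demands. -/
theorem natDegree_le_of_dvdAt [Fintype F] {d : ℕ} {E P : F[X][X]}
    (hP : (Bivariate.swap P).natDegree < Fintype.card F) (h : ∀ a, DvdAt d E P a) :
    P.natDegree ≤ E.natDegree + d := by
  rw [natDegree_le_iff_coeff_eq_zero]
  intro k hk
  refine eq_zero_of_natDegree_lt_card_of_eval_eq_zero' _ Finset.univ (fun a _ => ?_)
    ((natDegree_coeff_le_natDegree_swap P k).trans_lt hP)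
  obtain ⟨c, hc, hPc⟩ := h a
  rw [← coe_evalRingHom, ← coeff_map, hPc]
  refine coeff_eq_zero_of_natDegree_lt (natDegree_mul_le.trans_lt (lt_of_le_of_lt ?_ hk))
  exact add_le_add natDegree_map_le hc

theorem dvdAt_of_eval_eq [Fintype F] {d e : ℕ} {E P : F[X][X]} (hE : E.natDegree ≤ e)
    (hP : P.natDegree ≤ e + d) (hq : e + d < Fintype.card F) {u : F → F} (hu : PolyDeg d u) {a : F}
    (h : ∀ b, (P.map (evalRingHom a)).eval b = (E.map (evalRingHom a)).eval b * u b) :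
    DvdAt d E P a := by
  obtain ⟨c, hc, hu⟩ := hu
  refine ⟨c, hc, ?_⟩
  refine eq_of_degree_sub_lt_of_eval_finset_eq Finset.univ
    (lt_of_le_of_lt (b := ((e + d : ℕ) : WithBot ℕ)) (degree_le_of_natDegree_le ?_)
      (by exact_mod_cast hq)) fun b _ => by rw [h, hu, eval_mul]
  refine (natDegree_sub_le _ _).trans (max_le (natDegree_map_le.trans hP) ?_)
  exact natDegree_mul_le.trans (add_le_add (natDegree_map_le.trans hE) hc)

/-- Since `E` vanishes at all errors, `E * R` and `E * C` coincide everywhere, so the product has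
low degree along rows and columns and is a bivariate polynomial. It is divisible by `E` on every row
and column, hence globally. On a line where `E` is not identically zero, the quotient equals the
given polynomial at all but `e` points, which suffices. -/
theorem exists_bivariate_quotient [Fintype F] {d e : ℕ} {E : F[X][X]} (hE0 : E ≠ 0)
    (hE : E.natDegree ≤ e) (hE' : (Bivariate.swap E).natDegree ≤ e)
    (hq : 2 * e + 2 * d < Fintype.card F) {R C : F → F → F}
    (hR : ∀ b, PolyDeg d fun a => R a b) (hC : ∀ a, PolyDeg d (C a))
    (hRC : ∀ a b, R a b ≠ C a b → (E.map (evalRingHom a)).eval b = 0) :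
    ∃ Q : F → F → F, (∀ b, PolyDeg d fun a => Q a b) ∧ (∀ a, PolyDeg d (Q a)) ∧
      (∀ a, E.map (evalRingHom a) ≠ 0 → Q a = C a) ∧
      ∀ b, (Bivariate.swap E).map (evalRingHom b) ≠ 0 → ∀ a, Q a b = R a b := by
  have hER : ∀ a b, (E.map (evalRingHom a)).eval b * R a b =
      (E.map (evalRingHom a)).eval b * C a b := by
    intro a b
    by_cases h : R a b = C a b
    · rw [h]
    · rw [hRC a b h, zero_mul, zero_mul]
  obtain ⟨P, hP, hP', hPu⟩ := exists_bivariate_of_polyDeg (d := e + d) (by omega)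
    (fun a b => (E.map (evalRingHom a)).eval b * C a b)
    (fun b => by
      simp only [← hER]
      exact (PolyDeg.map_eval' hE' b).mul (hR b))
    (fun a => (PolyDeg.map_eval hE a).mul (hC a))
  have hA : ∀ a, DvdAt d E P a := fun a =>
    dvdAt_of_eval_eq hE hP (by omega) (hC a) fun b => (hPu a b).symm
  have hB : ∀ b, DvdAt d (Bivariate.swap E) (Bivariate.swap P) b := fun b =>
    dvdAt_of_eval_eq hE' hP' (by omega) (hR b) fun a => by
      rw [map_evalRingHom_swap_eval, map_evalRingHom_swap_eval, ← hPu, hER]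
  have hPE := natDegree_le_of_dvdAt (by omega) hA
  have hPE' := natDegree_le_of_dvdAt (by rw [Bivariate.swap_swap_apply]; omega) hB
  obtain ⟨Q, rfl⟩ := dvd_of_dvdAt hE0 hPE hPE' (A := Finset.univ) (B := Finset.univ)
    (by rw [Finset.card_univ]; omega) (by rw [Finset.card_univ]; omega)
    (fun a _ => hA a) (fun b _ => hB b)
  have hsE0 : Bivariate.swap E ≠ 0 := by simpa using hE0
  have hQ : Q.natDegree ≤ d ∧ (Bivariate.swap Q).natDegree ≤ d := by
    by_cases h0 : Q = 0
    · simp [h0]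
    have hs0 : Bivariate.swap Q ≠ 0 := by simpa using h0
    rw [natDegree_mul hE0 h0] at hPE
    rw [map_mul, natDegree_mul hsE0 hs0] at hPE'
    omega
  classical
  refine ⟨fun a b => (Q.map (evalRingHom a)).eval b, PolyDeg.map_eval' hQ.2,
    PolyDeg.map_eval hQ.1, ?_, ?_⟩
  · intro a ha
    refine (PolyDeg.map_eval hQ.1 a).eq_of_card_lt (hC a)
      (A := Finset.univ.filter fun b => (E.map (evalRingHom a)).eval b ≠ 0) ?_ ?_
    · have h1 := Finset.card_filter_add_card_filter_not (s := (Finset.univ : Finset F))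
        fun b => (E.map (evalRingHom a)).eval b ≠ 0
      have h2 : (Finset.univ.filter fun b => ¬ (E.map (evalRingHom a)).eval b ≠ 0).card ≤ e := by
        refine (card_le_degree_of_subset_roots (p := E.map (evalRingHom a)) ?_).trans
          (natDegree_map_le.trans hE)
        intro b hb
        rw [mem_roots ha]
        simpa using hb
      rw [Finset.card_univ] at h1
      omega
    · intro b hb
      have := hPu a b
      rw [Polynomial.map_mul, eval_mul] at this
      exact (mul_left_cancel₀ (by simpa using hb) this).symm
  · intro b hb
    refine congrFun ((PolyDeg.map_eval' hQ.2 b).eq_of_card_lt (hR b)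
      (A := Finset.univ.filter fun a => (E.map (evalRingHom a)).eval b ≠ 0) ?_ ?_)
    · have h1 := Finset.card_filter_add_card_filter_not (s := (Finset.univ : Finset F))
        fun a => (E.map (evalRingHom a)).eval b ≠ 0
      have h2 : (Finset.univ.filter fun a => ¬ (E.map (evalRingHom a)).eval b ≠ 0).card ≤ e := by
        refine (card_le_degree_of_subset_roots (p := (Bivariate.swap E).map (evalRingHom b)) ?_).trans
          (natDegree_map_le.trans hE')
        intro a ha
        rw [mem_roots hb, IsRoot, map_evalRingHom_swap_eval]
        simpa using ha
      rw [Finset.card_univ] at h1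
      omega
    · intro a ha
      have := hPu a b
      rw [Polynomial.map_mul, eval_mul, ← hER] at this
      exact (mul_left_cancel₀ (by simpa using ha) this).symm

/-- The Polishchuk-Spielman bivariate test for vector-valued functions. -/
theorem exists_bivariate_of_close [Fintype F] [DecidableEq F] {d t : ℕ}
    (hd : 6 * d ≤ Fintype.card F)
    {R C : F → F → Fin t → F} (hR : ∀ b j, PolyDeg d fun a => R a b j)
    (hC : ∀ a j, PolyDeg d fun b => C a b j)
    (h : 2 ^ 16 * (Finset.univ.filter fun s : F × F => R s.1 s.2 ≠ C s.1 s.2).card ≤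
      Fintype.card F ^ 2) :
    ∃ Q : F → F → Fin t → F, (∀ b j, PolyDeg d fun a => Q a b j) ∧
      (∀ a j, PolyDeg d fun b => Q a b j) ∧ ∃ A B : Finset F,
        256 * A.card ≤ Fintype.card F ∧ 256 * B.card ≤ Fintype.card F ∧
        (∀ a ∉ A, ∀ b, Q a b = C a b) ∧ ∀ b ∉ B, ∀ a, Q a b = R a b := by
  have hq : 0 < Fintype.card F := Fintype.card_pos
  -- This degree leaves more than `(q/256)^2` coefficients, enough for the at most `q^2/2^16`
  -- errors, while `E` vanishes identically on at most `q/256` rows and as many columns.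
  set e := Fintype.card F / 256 with he
  have he1 : 256 * e ≤ Fintype.card F := Nat.mul_div_le _ _
  have he2 : Fintype.card F < 256 * (e + 1) := by omega
  obtain ⟨E, hE0, hE, hE', hES⟩ := exists_bivariate_vanishing e
    (Finset.univ.filter fun s : F × F => R s.1 s.2 ≠ C s.1 s.2) (by nlinarith)
  have hE0' : Bivariate.swap E ≠ 0 := by simpa using hE0
  have key := fun j => exists_bivariate_quotient hE0 hE hE' (d := d) (by omega)
    (R := fun a b => R a b j) (C := fun a b => C a b j) (fun b => hR b j) (fun a => hC a j)
    (fun a b hab => hES (a, b) (by simpa using fun h => hab (congrFun h j)))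
  choose Q hQ1 hQ2 hQ3 hQ4 using key
  classical
  refine ⟨fun a b j => Q j a b, fun b j => hQ1 j b, fun a j => hQ2 j a,
    Finset.univ.filter fun a => E.map (evalRingHom a) = 0,
    Finset.univ.filter fun b => (Bivariate.swap E).map (evalRingHom b) = 0, ?_, ?_, ?_, ?_⟩
  · have := card_map_eval_eq_zero_le hE0
      (A := Finset.univ.filter fun a => E.map (evalRingHom a) = 0) (by simp)
    omega
  · have := card_map_eval_eq_zero_le hE0'
      (A := Finset.univ.filter fun b => (Bivariate.swap E).map (evalRingHom b) = 0) (by simp)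
    rw [Bivariate.swap_swap_apply] at this
    omega
  · intro a ha b
    ext j
    exact congrFun (hQ3 j a (by simpa using ha)) b
  · intro b hb a
    ext j
    exact hQ4 j b (by simpa using hb) a

theorem polyDeg_vec_eq_of_card_lt {d t : ℕ} {u v : F → Fin t → F}
    (hu : ∀ j, PolyDeg d fun a => u a j) (hv : ∀ j, PolyDeg d fun a => v a j)
    {A : Finset F} (hA : d < A.card) (h : ∀ a ∈ A, u a = v a) : u = v := by
  ext a j
  exact congrFun ((hu j).eq_of_card_lt (hv j) hA fun a ha => congrFun (h a ha) j) a

/-- On a line, a polynomial that is closest to `f` is determined by any other polynomial that is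
close to `f`. -/
theorem eq_of_optimal [Fintype F] [DecidableEq F] {d t : ℕ} (hd : 6 * d ≤ Fintype.card F)
    {f u v w : F → Fin t → F} (hu : ∀ j, PolyDeg d fun a => u a j)
    (hv : ∀ j, PolyDeg d fun a => v a j)
    (hopt : (Finset.univ.filter fun a => f a ≠ u a).card ≤
      (Finset.univ.filter fun a => f a ≠ v a).card)
    (hfw : 4 * (Finset.univ.filter fun a => f a ≠ w a).card < Fintype.card F) {A : Finset F}
    (hA : 256 * A.card ≤ Fintype.card F) (hvw : ∀ a ∉ A, v a = w a) : u = v := by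
  have hq : 0 < Fintype.card F := Fintype.card_pos
  -- Both `v` and, by optimality, `u` differ from `f` on less than a fraction `1/4 + 1/256`. Hence
  -- `u` and `v` agree on more than a third of the line, which exceeds `d`.
  have h1 : (Finset.univ.filter fun a => f a ≠ v a).card ≤
      (Finset.univ.filter fun a => f a ≠ w a).card + A.card := by
    refine (Finset.card_le_card fun a ha => ?_).trans (Finset.card_union_le _ _)
    by_cases haA : a ∈ A
    · exact Finset.mem_union_right _ haA
    · refine Finset.mem_union_left _ ?_
      simpa [hvw a haA] using ha
  refine polyDeg_vec_eq_of_card_lt hu hv (A := Finset.univ.filter fun a => u a = v a) ?_ (by simp)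
  have h2 := Finset.card_filter_add_card_filter_not (s := (Finset.univ : Finset F))
    fun a => u a = v a
  have h3 : (Finset.univ.filter fun a => ¬ u a = v a).card ≤
      (Finset.univ.filter fun a => f a ≠ u a).card +
      (Finset.univ.filter fun a => f a ≠ v a).card := by
    refine (Finset.card_le_card fun a ha => ?_).trans (Finset.card_union_le _ _)
    simp only [Finset.mem_filter, Finset.mem_univ, true_and, Finset.mem_union] at ha ⊢
    by_contra hcon
    push Not at hcon
    exact ha (hcon.1.symm.trans hcon.2)
  rw [Finset.card_univ] at h2
  omega

/-- The central lines may be exceptional for the bivariate polynomial `Q`, so its agreement with `R`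
and `C` there is not automatic. On the central row, however, `f` is close to the values of the
column polynomials, which are those of `Q` off a few columns; optimality of the row polynomial then
identifies it with `Q`. The central column is symmetric. -/
theorem plane_consistent [Fintype F] [DecidableEq F] {d t : ℕ} (hd : 6 * d ≤ Fintype.card F)
    {f R C : F → F → Fin t → F} (hR : ∀ b j, PolyDeg d fun a => R a b j)
    (hC : ∀ a j, PolyDeg d fun b => C a b j)
    (hfR : 2 ^ 17 * (Finset.univ.filter fun s : F × F => f s.1 s.2 ≠ R s.1 s.2).card ≤
      Fintype.card F ^ 2)
    (hfC : 2 ^ 17 * (Finset.univ.filter fun s : F × F => f s.1 s.2 ≠ C s.1 s.2).card ≤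
      Fintype.card F ^ 2)
    (hRopt : ∀ v : F → Fin t → F, (∀ j, PolyDeg d fun a => v a j) →
      (Finset.univ.filter fun a => f a 0 ≠ R a 0).card ≤
        (Finset.univ.filter fun a => f a 0 ≠ v a).card)
    (hCopt : ∀ v : F → Fin t → F, (∀ j, PolyDeg d fun a => v a j) →
      (Finset.univ.filter fun b => f 0 b ≠ C 0 b).card ≤
        (Finset.univ.filter fun b => f 0 b ≠ v b).card)
    (hrow : 4 * (Finset.univ.filter fun a => f a 0 ≠ C a 0).card < Fintype.card F)
    (hcol : 4 * (Finset.univ.filter fun b => f 0 b ≠ R 0 b).card < Fintype.card F) :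
    R 0 0 = C 0 0 := by
  have hRC : (Finset.univ.filter fun s : F × F => R s.1 s.2 ≠ C s.1 s.2).card ≤
      (Finset.univ.filter fun s : F × F => f s.1 s.2 ≠ R s.1 s.2).card +
      (Finset.univ.filter fun s : F × F => f s.1 s.2 ≠ C s.1 s.2).card := by
    refine (Finset.card_le_card fun s hs => ?_).trans (Finset.card_union_le _ _)
    simp only [Finset.mem_filter, Finset.mem_univ, true_and, Finset.mem_union] at hs ⊢
    by_contra hcon
    push Not at hcon
    exact hs (hcon.1.symm.trans hcon.2)
  obtain ⟨Q, hQ1, hQ2, A, B, hA, hB, hQA, hQB⟩ := exists_bivariate_of_close hd hR hC (by omega)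
  have h1 := eq_of_optimal hd (f := fun a => f a 0) (u := fun a => R a 0) (v := fun a => Q a 0)
    (w := fun a => C a 0) (hR 0) (hQ1 0) (hRopt _ (hQ1 0)) hrow hA fun a ha => hQA a ha 0
  have h2 := eq_of_optimal hd (f := fun b => f 0 b) (u := fun b => C 0 b) (v := fun b => Q 0 b)
    (w := fun b => R 0 b) (hC 0) (hQ2 0) (hCopt _ (hQ2 0)) hcol hB fun b hb => hQB b hb 0
  exact (congrFun h1 0).trans (congrFun h2 0).symm

end Plane
end ParallelLDT

namespace ParallelLDT

/-! ### Sampling by lines through Fourier analysis. -/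

section Fourier
open scoped ComplexConjugate
variable {G : Type*} [AddCommGroup G] [Fintype G]

/-- The Fourier coefficient of `g` at the character `χ`. -/
noncomputable def fourierCoeff (g : G → ℝ) (χ : AddChar G ℂ) : ℂ := ∑ x, (g x : ℂ) * χ x

theorem sum_norm_sq_fourierCoeff (g : G → ℝ) :
    ∑ χ, ‖fourierCoeff g χ‖ ^ 2 = Fintype.card G * ∑ x, g x ^ 2 := by
  classical
  have h : ∀ χ : AddChar G ℂ, ((‖fourierCoeff g χ‖ ^ 2 : ℝ) : ℂ) =
      ∑ x, ∑ y, (g x : ℂ) * g y * χ (x - y) := by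
    intro χ
    push_cast
    rw [← Complex.mul_conj', fourierCoeff, map_sum, Finset.sum_mul_sum]
    refine Finset.sum_congr rfl fun x _ => Finset.sum_congr rfl fun y _ => ?_
    rw [map_mul, Complex.conj_ofReal, ← AddChar.map_neg_eq_conj, sub_eq_add_neg,
      AddChar.map_add_eq_mul]
    ring
  apply Complex.ofReal_injective
  rw [Complex.ofReal_sum]
  simp only [h]
  rw [Finset.sum_comm]
  simp only [Finset.sum_comm (s := (Finset.univ : Finset (AddChar G ℂ))), ← Finset.mul_sum,
    AddChar.sum_apply_eq_ite, sub_eq_zero]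
  push_cast
  rw [Finset.mul_sum]
  refine Finset.sum_congr rfl fun x _ => ?_
  simp
  ring

end Fourier

section Sampling
variable {F : Type*} [Field F] {V : Type*} [AddCommGroup V] [Module F V]

/-- The character of `F` obtained by restricting a character of `V` to the line through `v`. -/
noncomputable def lineChar (χ : AddChar V ℂ) (v : V) : AddChar F ℂ :=
  χ.compAddMonoidHom (LinearMap.toSpanSingleton F V v).toAddMonoidHom

theorem lineChar_apply (χ : AddChar V ℂ) (v : V) (a : F) : lineChar χ v a = χ (a • v) := rfl

variable [Fintype F]

open Classical in
theorem sum_char_line (χ : AddChar V ℂ) (v : V) :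
    ∑ a : F, χ (a • v) = if ∀ a : F, χ (a • v) = 1 then (Fintype.card F : ℂ) else 0 := by
  have := AddChar.sum_eq_ite (lineChar (F := F) χ v)
  simp only [lineChar_apply] at this
  rw [this]
  refine if_congr ?_ rfl rfl
  rw [DFunLike.ext_iff]
  rfl

variable [Fintype V]

/-- Summation along lines is a convolution. The multiplier is a character sum over `F`, equal to
`|F|` or zero. -/
theorem fourierCoeff_line_sum (g : V → ℝ) (v : V) (χ : AddChar V ℂ) :
    fourierCoeff (fun x => ∑ a : F, g (x + a • v)) χ =
      fourierCoeff g χ * ∑ a : F, χ (a • v) := by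
  have h : ∀ a : F, ∑ x, (g (x + a • v) : ℂ) * χ x = fourierCoeff g χ * χ (-a • v) := by
    intro a
    rw [fourierCoeff, Finset.sum_mul]
    refine Fintype.sum_equiv (Equiv.addRight (a • v)) _ _ fun x => ?_
    rw [Equiv.coe_addRight, mul_assoc, ← AddChar.map_add_eq_mul, neg_smul, add_neg_cancel_right]
  have h2 : ∑ a : F, χ (-a • v) = ∑ a : F, χ (a • v) :=
    Fintype.sum_equiv (Equiv.neg F) _ _ fun a => rfl
  rw [← h2, Finset.mul_sum, ← Finset.sum_congr rfl fun a _ => h a, Finset.sum_comm, fourierCoeff]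
  refine Finset.sum_congr rfl fun x _ => ?_
  push_cast
  rw [Finset.sum_mul]

open Classical in
/-- Every nontrivial character of `V` is trivial on at most a `τ`-fraction of the lines spanned by
the members of the family `y`. -/
def CharBound (F : Type*) [Field F] {V : Type*} [AddCommGroup V] [Module F V] {ι : Type*}
    [Fintype ι] (τ : ℝ) (y : ι → V) : Prop :=
  ∀ χ : AddChar V ℂ, χ ≠ 1 →
    ((Finset.univ.filter fun i => ∀ a : F, χ (a • y i) = 1).card : ℝ) ≤ τ * Fintype.card ι

variable {ι : Type*} [Fintype ι] {τ : ℝ} {y : ι → V}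

/-- By Parseval, only characters trivial on `F • y i` survive the summation along `y i`. The trivial
character is absent because `g` has mean zero, and each other one survives for a `τ`-fraction of the
`i` at most. -/
theorem sum_line_sum_sq_le (hy : CharBound F τ y) {g : V → ℝ} (hg : ∑ x, g x = 0) :
    ∑ i, ∑ x, (∑ a : F, g (x + a • y i)) ^ 2 ≤
      Fintype.card F ^ 2 * (τ * Fintype.card ι) * ∑ x, g x ^ 2 := by
  classical
  have hV : (0 : ℝ) < Fintype.card V := by exact_mod_cast Fintype.card_pos
  have h1 : ∀ i, (Fintype.card V : ℝ) * ∑ x, (∑ a : F, g (x + a • y i)) ^ 2 =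
      ∑ χ, ‖fourierCoeff g χ‖ ^ 2 *
        if ∀ a : F, χ (a • y i) = 1 then (Fintype.card F : ℝ) ^ 2 else 0 := by
    intro i
    rw [← sum_norm_sq_fourierCoeff]
    refine Finset.sum_congr rfl fun χ _ => ?_
    rw [fourierCoeff_line_sum, sum_char_line, norm_mul, mul_pow]
    split_ifs <;> simp
  refine le_of_mul_le_mul_left ?_ hV
  calc (Fintype.card V : ℝ) * ∑ i, ∑ x, (∑ a : F, g (x + a • y i)) ^ 2
      = ∑ χ, ‖fourierCoeff g χ‖ ^ 2 * (Fintype.card F ^ 2 *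
        (Finset.univ.filter fun i => ∀ a : F, χ (a • y i) = 1).card) := by
        rw [Finset.mul_sum, Finset.sum_congr rfl fun i _ => h1 i, Finset.sum_comm]
        refine Finset.sum_congr rfl fun χ _ => ?_
        rw [← Finset.mul_sum, ← Finset.sum_filter, Finset.sum_const, nsmul_eq_mul]
        ring
    _ ≤ ∑ χ, ‖fourierCoeff g χ‖ ^ 2 * (Fintype.card F ^ 2 * (τ * Fintype.card ι)) := by
        refine Finset.sum_le_sum fun χ _ => ?_
        by_cases hχ : χ = 1
        · have : fourierCoeff g χ = 0 := by
            subst hχ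
            simp only [fourierCoeff, AddChar.one_apply, mul_one]
            exact_mod_cast hg
          simp [this]
        · refine mul_le_mul_of_nonneg_left (mul_le_mul_of_nonneg_left ?_ (by positivity))
            (by positivity)
          refine le_of_eq_of_le ?_ (hy χ hχ)
          congr!
    _ = Fintype.card V *
        (Fintype.card F ^ 2 * (τ * Fintype.card ι) * ∑ x, g x ^ 2) := by
        rw [← Finset.sum_mul, sum_norm_sq_fourierCoeff]
        ring

open Classical in
/-- Lines in the directions of `y` sample well. -/
theorem card_line_sum_ge_le (hy : CharBound F τ y) (hτ : 0 ≤ τ) {g : V → ℝ}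
    (hg0 : ∀ x, 0 ≤ g x) (hg1 : ∀ x, g x ≤ 1) {θ : ℝ} (hθ : 0 < θ)
    (hμ : 2 * ∑ x, g x ≤ θ * Fintype.card V) :
    (∑ i, (Finset.univ.filter fun x => θ * Fintype.card F ≤ ∑ a : F, g (x + a • y i)).card : ℝ) *
      θ ^ 2 ≤ 4 * (τ * Fintype.card ι) * ∑ x, g x := by
  have hV : (0 : ℝ) < Fintype.card V := by exact_mod_cast Fintype.card_pos
  have hF : (0 : ℝ) < Fintype.card F := by exact_mod_cast Fintype.card_pos
  set μ : ℝ := (∑ x, g x) / Fintype.card V with hμd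
  have hsum : ∑ x, g x = μ * Fintype.card V := by rw [hμd, div_mul_cancel₀ _ hV.ne']
  have hμθ : 2 * μ ≤ θ := by
    rw [hsum, ← mul_assoc] at hμ
    exact le_of_mul_le_mul_right hμ hV
  have h0 : ∑ x, (g x - μ) = 0 := by
    rw [Finset.sum_sub_distrib, hsum]
    simp [mul_comm]
  have h1 := sum_line_sum_sq_le hy h0
  -- As `g` has values in `[0, 1]`, its variance is at most its mean. A bound proportional to the
  -- mean is what later turns sampling into a contraction.
  have h2 : ∑ x, (g x - μ) ^ 2 ≤ ∑ x, g x := by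
    have h3 : ∑ x, (g x - μ) ^ 2 = ∑ x, g x ^ 2 - μ ^ 2 * Fintype.card V := by
      simp only [sub_sq, Finset.sum_add_distrib, Finset.sum_sub_distrib]
      rw [← Finset.sum_mul, ← Finset.mul_sum, hsum]
      simp
      ring
    have h4 : ∑ x, g x ^ 2 ≤ ∑ x, g x :=
      Finset.sum_le_sum fun x _ => by nlinarith [hg0 x, hg1 x]
    have : 0 ≤ μ ^ 2 * Fintype.card V := by positivity
    linarith
  -- Chebyshev: since the mean is at most `θ / 2`, each counted line deviates from it by at least `θ
  -- / 2` per point.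
  have h3 : ∀ i, ((Finset.univ.filter fun x => θ * Fintype.card F ≤
      ∑ a : F, g (x + a • y i)).card : ℝ) * (θ / 2 * Fintype.card F) ^ 2 ≤
      ∑ x, (∑ a : F, (g (x + a • y i) - μ)) ^ 2 := by
    intro i
    rw [← nsmul_eq_mul]
    refine (Finset.card_nsmul_le_sum _ _ _ fun x hx => ?_).trans
      (Finset.sum_le_sum_of_subset_of_nonneg (Finset.filter_subset _ _) fun _ _ _ => sq_nonneg _)
    rw [Finset.mem_filter] at hx
    refine pow_le_pow_left₀ (by positivity) ?_ 2
    rw [Finset.sum_sub_distrib]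
    simp only [Finset.sum_const, Finset.card_univ, nsmul_eq_mul]
    nlinarith [hx.2]
  have h4 := (Finset.sum_le_sum fun i (_ : i ∈ Finset.univ) => h3 i).trans h1
  rw [← Finset.sum_mul] at h4
  have h5 : (Fintype.card F : ℝ) ^ 2 * (τ * Fintype.card ι) * ∑ x, (g x - μ) ^ 2 ≤
      (Fintype.card F : ℝ) ^ 2 * (τ * Fintype.card ι) * ∑ x, g x :=
    mul_le_mul_of_nonneg_left h2 (by positivity)
  have h6 : (0 : ℝ) < (Fintype.card F : ℝ) ^ 2 := by positivity
  refine le_of_mul_le_mul_left ?_ h6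
  nlinarith [h4, h5]

end Sampling
end ParallelLDT

namespace ParallelLDT

/-! ### Best approximations along one direction. -/

section Diff
variable {F V : Type*} {t : ℕ} [Fintype V] [DecidableEq F]

/-- The number of points at which two functions differ. -/
def diffCount (f g : V → Fin t → F) : ℕ := (Finset.univ.filter fun x => f x ≠ g x).card

theorem diffCount_self (f : V → Fin t → F) : diffCount f f = 0 := by simp [diffCount]

theorem diffCount_eq_zero {f g : V → Fin t → F} (h : diffCount f g = 0) : f = g := by
  ext1 x
  simpa using Finset.filter_eq_empty_iff.1 (Finset.card_eq_zero.1 h) (Finset.mem_univ x)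

theorem diffCount_triangle (f g h : V → Fin t → F) :
    diffCount f h ≤ diffCount f g + diffCount g h := by
  classical
  refine (Finset.card_le_card fun x hx => ?_).trans (Finset.card_union_le _ _)
  simp only [Finset.mem_filter, Finset.mem_univ, true_and, Finset.mem_union] at hx ⊢
  by_contra hcon
  push Not at hcon
  exact hx (hcon.1.trans hcon.2)

/-- The indicator function of the set of points at which two functions differ. -/
noncomputable def diffInd (f g : V → Fin t → F) (x : V) : ℝ := if f x ≠ g x then 1 else 0

theorem sum_diffInd (f g : V → Fin t → F) : ∑ x, diffInd f g x = diffCount f g := by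
  simp only [diffInd, Finset.sum_boole, diffCount]

end Diff

section Improvement
variable {F : Type*} [Field F] {V : Type*} [AddCommGroup V] [Module F V] {t : ℕ}

/-- `u` has degree at most `d` along all lines in direction `v`. -/
def DirDeg (d : ℕ) (v : V) (u : V → Fin t → F) : Prop :=
  ∀ x j, PolyDeg d fun a : F => u (x + a • v) j

theorem PolyDeg.comp_add {d : ℕ} {u : F → F} (hu : PolyDeg d u) (c : F) :
    PolyDeg d fun a => u (c + a) := by
  obtain ⟨p, hp, hu⟩ := hu
  refine ⟨p.comp (Polynomial.C c + Polynomial.X), ?_, fun a => by simp [hu]⟩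
  refine Polynomial.natDegree_comp_le.trans ?_
  have : (Polynomial.C c + Polynomial.X : Polynomial F).natDegree ≤ 1 :=
    Polynomial.natDegree_C_add.trans_le Polynomial.natDegree_X_le
  exact (Nat.mul_le_mul hp this).trans (by simp)

-- Distinct lines in one direction are disjoint, so the values on a single line can be exchanged
-- freely.
open Classical in
theorem DirDeg.replace_line {d : ℕ} {v : V} (hv : v ≠ 0) {u : V → Fin t → F} (hu : DirDeg d v u)
    (x : V) {p : F → Fin t → F} (hp : ∀ j, PolyDeg d fun a => p a j) :
    ∃ u' : V → Fin t → F, DirDeg d v u' ∧ (∀ a : F, u' (x + a • v) = p a) ∧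
      ∀ z, (∀ a : F, z ≠ x + a • v) → u' z = u z := by
  have hinj : ∀ a b : F, x + a • v = x + b • v → a = b := fun a b hab =>
    smul_left_injective F hv (add_left_cancel hab)
  set u' : V → Fin t → F := fun z => if h : ∃ a : F, z = x + a • v then p h.choose else u z
  have h1 : ∀ a : F, u' (x + a • v) = p a := by
    intro a
    have h : ∃ b : F, x + a • v = x + b • v := ⟨a, rfl⟩
    simp only [u', dif_pos h]
    rw [← hinj _ _ h.choose_spec]
  have h2 : ∀ z, (∀ a : F, z ≠ x + a • v) → u' z = u z := by
    intro z hz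
    simp only [u', dif_neg (not_exists.2 hz)]
  refine ⟨u', fun z j => ?_, h1, h2⟩
  by_cases hz : ∃ c : F, z = x + c • v
  · obtain ⟨c, rfl⟩ := hz
    simp only [add_assoc, ← add_smul, h1]
    exact (hp j).comp_add c
  · have : ∀ a : F, u' (z + a • v) = u (z + a • v) := fun a => h2 _ fun b hb =>
      hz ⟨b - a, by rw [sub_smul, ← add_sub_assoc, ← hb, add_sub_cancel_right]⟩
    simp only [this]
    exact hu z j

variable [Fintype V] [DecidableEq F]

variable [Fintype F]

theorem exists_closest (d : ℕ) (v : V) (h : V → Fin t → F) :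
    ∃ G : V → Fin t → F, DirDeg d v G ∧ ∀ G', DirDeg d v G' → diffCount h G ≤ diffCount h G' := by
  classical
  obtain ⟨G, hG, hmin⟩ := Finset.exists_min_image
    (Finset.univ.filter fun G : V → Fin t → F => DirDeg d v G) (diffCount h)
    ⟨0, Finset.mem_filter.2 ⟨Finset.mem_univ _, fun _ _ => ⟨0, by simp⟩⟩⟩
  refine ⟨G, by simpa using hG, fun G' hG' => hmin G' (by simpa using hG')⟩

/-- A function that has degree at most `d` in direction `v` and is closest to `h`. -/
noncomputable def closest (d : ℕ) (v : V) (h : V → Fin t → F) : V → Fin t → F :=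
  (exists_closest d v h).choose

theorem dirDeg_closest (d : ℕ) (v : V) (h : V → Fin t → F) : DirDeg d v (closest d v h) :=
  (exists_closest d v h).choose_spec.1

theorem diffCount_closest_le {d : ℕ} {v : V} (h : V → Fin t → F) {G : V → Fin t → F}
    (hG : DirDeg d v G) : diffCount h (closest d v h) ≤ diffCount h G :=
  (exists_closest d v h).choose_spec.2 G hG

/-- A global optimum is optimal on each line, as otherwise one line could be replaced. This supplies
the optimality that `plane_consistent` needs. -/
theorem card_line_ne_closest_le (d : ℕ) (v : V) (h : V → Fin t → F) (x : V) {p : F → Fin t → F}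
    (hp : ∀ j, PolyDeg d fun a => p a j) :
    (Finset.univ.filter fun a : F => h (x + a • v) ≠ closest d v h (x + a • v)).card ≤
      (Finset.univ.filter fun a : F => h (x + a • v) ≠ p a).card := by
  classical
  by_cases hv : v = 0
  -- Along the zero direction every function is constant, so the best approximation is `h` itself.
  · have h0 : diffCount h (closest d v h) = 0 := by
      refine Nat.le_zero.1 ((diffCount_closest_le h (G := h) ?_).trans (diffCount_self h).le)
      intro x j
      exact ⟨Polynomial.C (h x j), by simp, fun a => by simp [hv]⟩
    rw [← diffCount_eq_zero h0]
    simp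
  obtain ⟨u', hu', hline, hoff⟩ := (dirDeg_closest d v h).replace_line hv x hp
  have hle := diffCount_closest_le h hu'
  set L : Finset V := Finset.univ.image fun a : F => x + a • v with hL
  have hinj : Function.Injective fun a : F => x + a • v := fun a b hab =>
    smul_left_injective F hv (add_left_cancel hab)
  have key : ∀ g : V → Fin t → F, diffCount h g =
      ((Finset.univ.filter fun z => h z ≠ g z) \ L).card +
      (Finset.univ.filter fun a : F => h (x + a • v) ≠ g (x + a • v)).card := by
    intro g
    rw [diffCount, ← Finset.card_sdiff_add_card_inter _ L]
    congr 1
    rw [← Finset.card_image_of_injective _ hinj]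
    congr 1
    ext z
    simp only [hL, Finset.mem_inter, Finset.mem_filter, Finset.mem_univ, true_and,
      Finset.mem_image]
    constructor
    · rintro ⟨h1, a, rfl⟩
      exact ⟨a, h1, rfl⟩
    · rintro ⟨a, h1, rfl⟩
      exact ⟨h1, a, rfl⟩
  have hsd : (Finset.univ.filter fun z => h z ≠ closest d v h z) \ L =
      (Finset.univ.filter fun z => h z ≠ u' z) \ L := by
    ext z
    simp only [Finset.mem_sdiff, Finset.mem_filter, Finset.mem_univ, true_and, hL,
      Finset.mem_image, not_exists]
    refine and_congr_left fun hz => ?_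
    rw [hoff z fun a => (hz a ·.symm)]
  rw [key, key u', hsd] at hle
  simp only [hline] at hle
  omega

end Improvement
end ParallelLDT

namespace ParallelLDT

/-! ### The contraction and the variational argument. -/

section Minimizer
variable {F : Type*} [Field F] [Fintype F] [DecidableEq F] {V : Type*} [AddCommGroup V] [Module F V]
  [Fintype V] {t : ℕ} {ι : Type*} [Fintype ι] {τ : ℝ} {y : ι → V} {d : ℕ}

/-- The density of `g` on the line through `x` in direction `v`. -/
noncomputable def lineAvg (F : Type*) [Field F] [Fintype F] {V : Type*} [AddCommGroup V]
    [Module F V] (g : V → ℝ) (v x : V) : ℝ :=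
  (∑ a : F, g (x + a • v)) / Fintype.card F

omit [DecidableEq F] in
theorem sum_lineAvg (g : V → ℝ) (v : V) : ∑ x, lineAvg F g v x = ∑ x, g x := by
  have hq : (Fintype.card F : ℝ) ≠ 0 := by exact_mod_cast Fintype.card_ne_zero
  simp only [lineAvg]
  rw [← Finset.sum_div, Finset.sum_comm, div_eq_iff hq]
  have : ∀ a : F, ∑ x, g (x + a • v) = ∑ x, g x := fun a =>
    Fintype.sum_equiv (Equiv.addRight (a • v)) _ _ fun x => rfl
  simp [this, mul_comm]

omit [Field F] [Fintype F] [AddCommGroup V] [Fintype V] in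
theorem diffInd_nonneg (f g : V → Fin t → F) (x : V) : 0 ≤ diffInd f g x := by
  unfold diffInd; split_ifs <;> norm_num

omit [Field F] [Fintype F] [AddCommGroup V] [Fintype V] in
theorem diffInd_le_one (f g : V → Fin t → F) (x : V) : diffInd f g x ≤ 1 := by
  unfold diffInd; split_ifs <;> norm_num

omit [Fintype V] in
theorem lineAvg_diffInd_nonneg (f g : V → Fin t → F) (v x : V) :
    0 ≤ lineAvg F (diffInd f g) v x :=
  div_nonneg (Finset.sum_nonneg fun _ _ => diffInd_nonneg _ _ _) (Nat.cast_nonneg _)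

omit [Fintype V] in
theorem lineAvg_diffInd_le_one (f g : V → Fin t → F) (v x : V) :
    lineAvg F (diffInd f g) v x ≤ 1 := by
  refine div_le_one_of_le₀ ?_ (Nat.cast_nonneg _)
  exact (Finset.sum_le_card_nsmul _ _ 1 fun _ _ => diffInd_le_one _ _ _).trans (by simp)

omit [Fintype V] in
theorem card_line_lt {f g : V → Fin t → F} {v x : V}
    (h : ∑ a : F, diffInd f g (x + a • v) < 1 / 4 * Fintype.card F) :
    4 * (Finset.univ.filter fun a : F => f (x + a • v) ≠ g (x + a • v)).card <
      Fintype.card F := by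
  simp only [diffInd, Finset.sum_boole] at h
  have : (4 : ℝ) * (Finset.univ.filter fun a : F => f (x + a • v) ≠ g (x + a • v)).card <
      Fintype.card F := by linarith
  exact_mod_cast this

omit [Fintype V] in
theorem card_plane_le {f g : V → Fin t → F} {v w x : V}
    (h : ∑ b : F, lineAvg F (diffInd f g) v (x + b • w) < 1 / 2 ^ 17 * Fintype.card F) :
    2 ^ 17 * (Finset.univ.filter fun s : F × F =>
      f (x + s.2 • w + s.1 • v) ≠ g (x + s.2 • w + s.1 • v)).card ≤ Fintype.card F ^ 2 := by
  have hq : (0 : ℝ) < Fintype.card F := by exact_mod_cast Fintype.card_pos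
  simp only [lineAvg] at h
  rw [← Finset.sum_div, div_lt_iff₀ hq] at h
  have h2 : ((Finset.univ.filter fun s : F × F =>
      f (x + s.2 • w + s.1 • v) ≠ g (x + s.2 • w + s.1 • v)).card : ℝ) =
      ∑ b : F, ∑ a : F, diffInd f g (x + b • w + a • v) := by
    rw [← Finset.sum_boole, Fintype.sum_prod_type_right]
    rfl
  rw [← h2] at h
  have : (2 : ℝ) ^ 17 * (Finset.univ.filter fun s : F × F =>
      f (x + s.2 • w + s.1 • v) ≠ g (x + s.2 • w + s.1 • v)).card ≤ Fintype.card F ^ 2 := by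
    nlinarith
  exact_mod_cast this

/-- The plane through `x` is parametrised by two scalars. The directions may be dependent: the
argument only uses the pulled-back functions on `F × F`. -/
theorem closest_eq_of_few (hd : 6 * d ≤ Fintype.card F) (h : V → Fin t → F) (v w x : V)
    (h1 : ∑ b : F, lineAvg F (diffInd h (closest d v h)) v (x + b • w) <
      1 / 2 ^ 17 * Fintype.card F)
    (h2 : ∑ a : F, lineAvg F (diffInd h (closest d w h)) w (x + a • v) <
      1 / 2 ^ 17 * Fintype.card F)
    (h3 : ∑ a : F, diffInd h (closest d w h) (x + a • v) < 1 / 4 * Fintype.card F)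
    (h4 : ∑ b : F, diffInd h (closest d v h) (x + b • w) < 1 / 4 * Fintype.card F) :
    closest d v h x = closest d w h x := by
  have hcomm : ∀ a b : F, x + a • v + b • w = x + b • w + a • v := fun a b =>
    add_right_comm _ _ _
  have := plane_consistent hd (f := fun a b => h (x + b • w + a • v))
    (R := fun a b => closest d v h (x + b • w + a • v))
    (C := fun a b => closest d w h (x + a • v + b • w))
    (fun b j => dirDeg_closest d v h _ j) (fun a j => dirDeg_closest d w h _ j)
    (card_plane_le h1) ?_ ?_ ?_ ?_ ?_
  · simpa using this
  · refine le_of_eq_of_le ?_ (card_plane_le h2)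
    congr 1
    refine Finset.card_equiv (Equiv.prodComm F F) fun s => ?_
    simp [hcomm]
  · intro p hp
    simpa using card_line_ne_closest_le d v h x hp
  · intro p hp
    simpa using card_line_ne_closest_le d w h x hp
  · simpa using card_line_lt h3
  · simpa using card_line_lt h4

/-- Where two approximations differ, some hypothesis of `closest_eq_of_few` fails: `P` counts
centres of planes with too many errors, and `R` centres of such lines. Both are sampling counts in
the varying direction `y j`. For `P` the sampled function is a line average, which makes a plane a
line of lines. -/
theorem sum_sum_diffCount_closest_le (hd : 6 * d ≤ Fintype.card F) (hy : CharBound F τ y)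
    (hτ : 0 ≤ τ) (h : V → Fin t → F) {A : Finset ι}
    (hA : ∀ i ∈ A, 2 ^ 20 * diffCount h (closest d (y i) h) ≤ Fintype.card V) :
    ∑ i ∈ A, ∑ j ∈ A, (diffCount (closest d (y i) h) (closest d (y j) h) : ℝ) ≤
      2 ^ 38 * (τ * Fintype.card ι) * ∑ i ∈ A, (diffCount h (closest d (y i) h) : ℝ) := by
  classical
  set β : ι → V → ℝ := fun i => diffInd h (closest d (y i) h) with hβ
  set P : ι → ι → ℝ := fun i j => ((Finset.univ.filter fun x => 1 / 2 ^ 17 * Fintype.card F ≤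
    ∑ b : F, lineAvg F (β i) (y i) (x + b • y j)).card : ℝ) with hP
  set R : ι → ι → ℝ := fun i j => ((Finset.univ.filter fun x => 1 / 4 * Fintype.card F ≤
    ∑ b : F, β i (x + b • y j)).card : ℝ) with hR
  have hsum : ∀ i, ∑ x, β i x = diffCount h (closest d (y i) h) := fun i => sum_diffInd _ _
  have hA' : ∀ i ∈ A, (2 : ℝ) ^ 20 * diffCount h (closest d (y i) h) ≤ Fintype.card V :=
    fun i hi => by exact_mod_cast hA i hi
  have hpair : ∀ i j, (diffCount (closest d (y i) h) (closest d (y j) h) : ℝ) ≤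
      (P i j + R i j) + (P j i + R j i) := by
    intro i j
    simp only [hP, hR]
    norm_cast
    rw [diffCount]
    refine (Finset.card_le_card fun x hx => ?_).trans <| (Finset.card_union_le _ _).trans <|
      add_le_add (Finset.card_union_le _ _) (Finset.card_union_le _ _)
    simp only [Finset.mem_filter, Finset.mem_univ, true_and, Finset.mem_union] at hx ⊢
    by_contra hcon
    push Not at hcon
    obtain ⟨⟨h1, h4⟩, h2, h3⟩ := hcon
    exact hx (closest_eq_of_few hd h (y i) (y j) x (by norm_num at h1 ⊢; exact h1)
      (by norm_num at h2 ⊢; exact h2)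
      (by simpa using h3) (by simpa using h4))
  -- The factor `2^36` is `4 / θ^2` for the plane threshold `θ = 1 / 2^17`; membership in `A`
  -- provides the density at most `θ / 2` that sampling requires.
  have hPsum : ∀ i ∈ A, ∑ j ∈ A, P i j ≤
      2 ^ 36 * (τ * Fintype.card ι) * diffCount h (closest d (y i) h) := by
    intro i hi
    have h1 := card_line_sum_ge_le hy hτ (g := lineAvg F (β i) (y i))
      (lineAvg_diffInd_nonneg _ _ _) (lineAvg_diffInd_le_one _ _ _) (θ := 1 / 2 ^ 17) (by norm_num)
      (by rw [sum_lineAvg, hsum]; linarith [hA' i hi])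
    rw [sum_lineAvg, hsum] at h1
    change (∑ j, P i j) * _ ≤ _ at h1
    have h2 : ∑ j ∈ A, P i j ≤ ∑ j, P i j :=
      Finset.sum_le_sum_of_subset_of_nonneg (Finset.subset_univ _) fun _ _ _ => Nat.cast_nonneg _
    linarith
  have hRsum : ∀ i ∈ A, ∑ j ∈ A, R i j ≤
      2 ^ 36 * (τ * Fintype.card ι) * diffCount h (closest d (y i) h) := by
    intro i hi
    have h1 := card_line_sum_ge_le hy hτ (g := β i)
      (diffInd_nonneg _ _) (diffInd_le_one _ _) (θ := 1 / 4) (by norm_num)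
      (by rw [hsum]; linarith [hA' i hi, (Nat.cast_nonneg (Fintype.card V) : (0:ℝ) ≤ _)])
    rw [hsum] at h1
    have h2 : ∑ j ∈ A, R i j ≤ ∑ j, R i j :=
      Finset.sum_le_sum_of_subset_of_nonneg (Finset.subset_univ _) fun _ _ _ => Nat.cast_nonneg _
    have h3 : 0 ≤ τ * Fintype.card ι * diffCount h (closest d (y i) h) := by positivity
    linarith
  calc ∑ i ∈ A, ∑ j ∈ A, (diffCount (closest d (y i) h) (closest d (y j) h) : ℝ)
      ≤ ∑ i ∈ A, ∑ j ∈ A, ((P i j + R i j) + (P j i + R j i)) :=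
        Finset.sum_le_sum fun i _ => Finset.sum_le_sum fun j _ => hpair i j
    _ = 2 * ∑ i ∈ A, (∑ j ∈ A, P i j + ∑ j ∈ A, R i j) := by
        simp only [Finset.sum_add_distrib]
        rw [Finset.sum_comm (f := fun i j => P j i), Finset.sum_comm (f := fun i j => R j i)]
        ring
    _ ≤ 2 * ∑ i ∈ A, (2 ^ 37 * (τ * Fintype.card ι) * diffCount h (closest d (y i) h)) := by
        refine mul_le_mul_of_nonneg_left (Finset.sum_le_sum fun i hi => ?_) zero_le_two
        linarith [hPsum i hi, hRsum i hi]
    _ = _ := by rw [← Finset.mul_sum]; ring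

/-- The cost of approximating `f` by `h`: the distance between the two and the truncated distances
of `h` from the functions that have low degree in the directions of `y`. -/
noncomputable def approxCost (d : ℕ) (y : ι → V) (f h : V → Fin t → F) : ℕ :=
  Fintype.card ι * diffCount f h +
    ∑ i, min (2 ^ 20 * diffCount h (closest d (y i) h)) (Fintype.card V)

theorem exists_min_approxCost (d : ℕ) (y : ι → V) (f : V → Fin t → F) :
    ∃ h, ∀ h', approxCost d y f h ≤ approxCost d y f h' := by
  classical
  obtain ⟨h, -, hh⟩ := Finset.exists_min_image Finset.univ (approxCost d y f)
    Finset.univ_nonempty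
  exact ⟨h, fun h' => hh h' (Finset.mem_univ _)⟩

/-- A function that is close to having low degree along the lines in the directions of `y` is close
to a function that has low degree along all lines in most of these directions. -/
theorem exists_dirDeg_of_close (hd : 6 * d ≤ Fintype.card F) (hy : CharBound F τ y) (hτ : 0 ≤ τ)
    (hτ' : τ ≤ 1 / 2 ^ 50) (f : V → Fin t → F)
    (hf : 2 ^ 21 * ∑ i, diffCount f (closest d (y i) f) < Fintype.card ι * Fintype.card V) :
    ∃ (h : V → Fin t → F) (A : Finset ι), Fintype.card ι < 2 * A.card ∧
      (∀ i ∈ A, DirDeg d (y i) h) ∧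
      Fintype.card ι * diffCount f h ≤ 2 ^ 20 * ∑ i, diffCount f (closest d (y i) f) := by
  classical
  obtain ⟨h, hmin⟩ := exists_min_approxCost d y f
  set ρ : ι → ℕ := fun i => diffCount h (closest d (y i) h) with hρ
  set A : Finset ι := Finset.univ.filter fun i => 2 ^ 20 * ρ i ≤ Fintype.card V with hA
  have hAmem : ∀ {i}, i ∈ A ↔ 2 ^ 20 * ρ i ≤ Fintype.card V := by simp [hA]
  have hcost : approxCost d y f h = Fintype.card ι * diffCount f h + 2 ^ 20 * ∑ i ∈ A, ρ i +
      Aᶜ.card * Fintype.card V := by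
    rw [approxCost, ← Finset.sum_add_sum_compl A, add_assoc, Finset.mul_sum]
    congr 2
    · exact Finset.sum_congr rfl fun i hi => min_eq_left (hAmem.1 hi)
    · rw [← smul_eq_mul, ← Finset.sum_const]
      refine Finset.sum_congr rfl fun i hi => min_eq_right ?_
      rw [Finset.mem_compl, hAmem] at hi
      exact (not_le.1 hi).le
  have hcostf : approxCost d y f f ≤ 2 ^ 20 * ∑ i, diffCount f (closest d (y i) f) := by
    rw [approxCost, diffCount_self, mul_zero, zero_add, Finset.mul_sum]
    exact Finset.sum_le_sum fun i _ => min_le_left _ _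
  have hV : 0 < Fintype.card V := Fintype.card_pos
  have hAcard : Fintype.card ι < 2 * A.card := by
    have h1 := (hcost.symm.le.trans (hmin f)).trans hcostf
    -- Each direction outside `A` costs the full truncation value, whereas by `hf` even the
    -- competitor `f` costs less than half of that per direction.
    have h2 : 2 * (Aᶜ.card * Fintype.card V) < Fintype.card ι * Fintype.card V := by
      omega
    have h3 : 2 * Aᶜ.card < Fintype.card ι := by
      rw [← mul_assoc] at h2
      exact lt_of_mul_lt_mul_right h2 (Nat.zero_le _)
    have := Finset.card_add_card_compl A
    omega
  refine ⟨h, A, hAcard, ?_, ?_⟩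
  -- The competitor is the approximation of `h` in direction `y j`. The distance to `f` grows by at
  -- most `ρ j`, and the other approximations of `h` remain admissible for the competitor, so its
  -- new distances are bounded by pairwise distances.
  · have hstep : ∀ j ∈ A, 2 ^ 20 * ∑ i ∈ A, ρ i ≤ Fintype.card ι * ρ j +
        2 ^ 20 * ∑ i ∈ A, diffCount (closest d (y j) h) (closest d (y i) h) := by
      intro j hj
      have h1 := hmin (closest d (y j) h)
      have h2 : approxCost d y f (closest d (y j) h) ≤
          Fintype.card ι * (diffCount f h + ρ j) +
          (2 ^ 20 * ∑ i ∈ A, diffCount (closest d (y j) h) (closest d (y i) h) +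
            Aᶜ.card * Fintype.card V) := by
        rw [approxCost, ← Finset.sum_add_sum_compl A]
        refine add_le_add (Nat.mul_le_mul_left _ (diffCount_triangle _ _ _)) (add_le_add ?_ ?_)
        · rw [Finset.mul_sum]
          exact Finset.sum_le_sum fun i _ => (min_le_left _ _).trans
            (Nat.mul_le_mul_left _ (diffCount_closest_le _ (dirDeg_closest _ _ _)))
        · rw [← smul_eq_mul, ← Finset.sum_const]
          exact Finset.sum_le_sum fun i _ => min_le_right _ _
      rw [hcost] at h1
      have h3 := h1.trans h2
      rw [mul_add] at h3
      omega
    have hsum := Finset.sum_le_sum hstep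
    rw [Finset.sum_const, smul_eq_mul, Finset.sum_add_distrib, ← Finset.mul_sum,
      ← Finset.mul_sum] at hsum
    have hpairs := sum_sum_diffCount_closest_le hd hy hτ h (A := A) fun i hi => hAmem.1 hi
    have hsumR : (A.card : ℝ) * (2 ^ 20 * ∑ i ∈ A, (ρ i : ℝ)) ≤
        Fintype.card ι * ∑ i ∈ A, (ρ i : ℝ) + 2 ^ 20 *
          ∑ i ∈ A, ∑ j ∈ A, (diffCount (closest d (y i) h) (closest d (y j) h) : ℝ) := by
      exact_mod_cast hsum
    have hAR : (Fintype.card ι : ℝ) ≤ 2 * A.card := by exact_mod_cast hAcard.le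
    have hs0 : (0 : ℝ) ≤ ∑ i ∈ A, (ρ i : ℝ) := Finset.sum_nonneg fun _ _ => Nat.cast_nonneg _
    have hn : (0 : ℝ) < Fintype.card ι := by
      have : 0 < Fintype.card ι := by
        rcases Nat.eq_zero_or_pos (Fintype.card ι) with h0 | h0
        · rw [h0, zero_mul] at hf
          omega
        · exact h0
      exact_mod_cast this
    -- Summing `hstep` over `A` gives `2^19 n s ≤ n s + 2^58 τ n s ≤ (1 + 2^8) n s`, which leaves
    -- only `s = 0`.
    have hzero : ∑ i ∈ A, (ρ i : ℝ) = 0 := by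
      set s := ∑ i ∈ A, (ρ i : ℝ)
      set n : ℝ := (Fintype.card ι : ℝ)
      have hpairs' : ∑ i ∈ A, ∑ j ∈ A,
          (diffCount (closest d (y i) h) (closest d (y j) h) : ℝ) ≤
          2 ^ 38 * (1 / 2 ^ 50 * n) * s := by
        refine hpairs.trans (mul_le_mul_of_nonneg_right ?_ hs0)
        exact mul_le_mul_of_nonneg_left (mul_le_mul_of_nonneg_right hτ' hn.le) (by norm_num)
      have h1 : n * s ≤ 2 * A.card * s := mul_le_mul_of_nonneg_right hAR hs0
      have h2 : n * s ≤ 0 := by linarith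
      exact le_antisymm (by nlinarith) hs0
    intro i hi
    have := (Finset.sum_eq_zero_iff_of_nonneg fun _ _ => Nat.cast_nonneg _).1 hzero i hi
    rw [diffCount_eq_zero (Nat.cast_eq_zero.1 this)]
    exact dirDeg_closest d (y i) h
  · have h1 := (hcost.symm.le.trans (hmin f)).trans hcostf
    omega

end Minimizer
end ParallelLDT

namespace ParallelLDT

/-! ### From low degree in many directions to bounded total degree. -/

section Span
variable {F : Type*} [Field F] [Fintype F] {V : Type*} [AddCommGroup V] [Module F V] [Fintype V]
  {ι : Type*} [Fintype ι] {τ : ℝ} {y : ι → V}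

-- Pull back a character of the quotient `V / W` that is nontrivial at the class of a point outside
-- `W`.
omit [Fintype F] in
theorem exists_char_eq_one_on {W : Submodule F V} (hW : W ≠ ⊤) :
    ∃ χ : AddChar V ℂ, χ ≠ 1 ∧ ∀ w ∈ W, χ w = 1 := by
  obtain ⟨v, hv⟩ : ∃ v, v ∉ W := by
    by_contra h
    push Not at h
    exact hW (eq_top_iff.2 fun v _ => h v)
  have hv0 : W.mkQ v ≠ 0 := by simpa using hv
  obtain ⟨ψ, hψ⟩ := AddChar.exists_apply_ne_zero.2 hv0
  refine ⟨ψ.compAddMonoidHom W.mkQ.toAddMonoidHom, fun h => hψ ?_, fun w hw => ?_⟩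
  · have := DFunLike.congr_fun h v
    simpa using this
  · have : W.mkQ w = 0 := by simpa using hw
    rw [AddChar.compAddMonoidHom_apply]
    exact (congrArg ψ this).trans ψ.map_zero_eq_one

omit [Fintype F] in
theorem span_eq_top_of_charBound (hy : CharBound F τ y) (hτ : τ ≤ 1 / 2) {A : Finset ι}
    (hA : Fintype.card ι < 2 * A.card) : Submodule.span F (y '' A) = ⊤ := by
  classical
  by_contra hW
  obtain ⟨χ, hχ, h1⟩ := exists_char_eq_one_on hW
  have h2 := hy χ hχ
  have h3 : A.card ≤ (Finset.univ.filter fun i => ∀ a : F, χ (a • y i) = 1).card := by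
    refine Finset.card_le_card fun i hi => ?_
    simp only [Finset.mem_filter, Finset.mem_univ, true_and]
    exact fun a => h1 _ (Submodule.smul_mem _ _ (Submodule.subset_span ⟨i, hi, rfl⟩))
  have h4 : (A.card : ℝ) ≤ τ * Fintype.card ι := by
    refine le_trans ?_ h2
    rw [Nat.cast_le]
    convert h3
  have h5 : (Fintype.card ι : ℝ) < 2 * A.card := by exact_mod_cast hA
  have h6 : τ * Fintype.card ι ≤ 1 / 2 * Fintype.card ι :=
    mul_le_mul_of_nonneg_right hτ (Nat.cast_nonneg _)
  linarith

end Span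

section TotalDegree
open MvPolynomial
variable {F : Type*} [Field F]

theorem totalDegree_aeval_X_le {σ : Type*} (p : Polynomial F) (i : σ) :
    (Polynomial.aeval (X i : MvPolynomial σ F) p).totalDegree ≤ p.natDegree := by
  rw [Polynomial.aeval_eq_sum_range]
  refine totalDegree_finsetSum_le fun k hk => ?_
  refine (totalDegree_smul_le _ _).trans ((totalDegree_pow _ _).trans ?_)
  rw [totalDegree_X, mul_one]
  exact Nat.lt_succ_iff.1 (Finset.mem_range.1 hk)

theorem eval_aeval_X {σ : Type*} (p : Polynomial F) (i : σ) (x : σ → F) :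
    eval x (Polynomial.aeval (X i : MvPolynomial σ F) p) = p.eval (x i) := by
  rw [Polynomial.aeval_eq_sum_range, Polynomial.eval_eq_sum_range]
  simp

theorem totalDegree_aeval_le {σ σ' : Type*} [Fintype σ] (p : MvPolynomial σ F)
    (g : σ → MvPolynomial σ' F) (hg : ∀ i, (g i).totalDegree ≤ 1) :
    (aeval g p).totalDegree ≤ p.totalDegree := by
  rw [aeval_def, eval₂_eq']
  refine totalDegree_finsetSum_le fun s hs => ?_
  refine (totalDegree_mul _ _).trans ?_
  rw [algebraMap_eq, totalDegree_C, zero_add]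
  refine (totalDegree_finsetProd _ _).trans (le_trans ?_ (le_totalDegree hs))
  rw [Finsupp.sum_fintype _ _ fun _ => rfl]
  refine Finset.sum_le_sum fun i _ => (totalDegree_pow _ _).trans ?_
  exact (Nat.mul_le_mul_left _ (hg i)).trans (mul_one _).le

/-- Induction on the dimension: interpolate in the first coordinate through `d + 1` hyperplanes, at
the price of `d` in the degree. The resulting factor `m` is removed later by the ray test. -/
theorem exists_mvPolynomial_of_polyDeg_single [Fintype F] {d m : ℕ} (hd : d < Fintype.card F)
    (h : (Fin m → F) → F)
    (hh : ∀ i x, PolyDeg d fun a : F => h (x + a • (Pi.single i 1 : Fin m → F))) :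
    ∃ p : MvPolynomial (Fin m) F, p.totalDegree ≤ m * d ∧ ∀ x, h x = eval x p := by
  classical
  induction m with
  | zero =>
    refine ⟨C (h 0), by simp, fun x => ?_⟩
    rw [eval_C, Subsingleton.elim x 0]
  | succ m ih =>
    obtain ⟨N, -, hN⟩ := Finset.exists_subset_card_eq (s := (Finset.univ : Finset F)) (n := d + 1)
      (by simpa using hd)
    have hcons : ∀ (n a : F) (i : Fin m) (w : Fin m → F),
        (Fin.cons n w : Fin (m + 1) → F) + a • (Pi.single i.succ 1 : Fin (m + 1) → F) =
          Fin.cons n (w + a • (Pi.single i 1 : Fin m → F)) := by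
      intro n a i w
      ext k
      refine Fin.cases ?_ (fun k => ?_) k
      · simp [(Fin.succ_ne_zero i).symm]
      · simp [Pi.single_apply]
    have hcons0 : ∀ (a : F) (w : Fin m → F),
        (Fin.cons 0 w : Fin (m + 1) → F) + a • (Pi.single 0 1 : Fin (m + 1) → F) =
          Fin.cons a w := by
      intro a w
      ext k
      refine Fin.cases ?_ (fun k => ?_) k
      · simp
      · simp
    have key : ∀ n : F, ∃ p : MvPolynomial (Fin m) F, p.totalDegree ≤ m * d ∧
        ∀ w, h (Fin.cons n w) = eval w p := fun n => ih _ fun i w => by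
      simpa only [hcons] using hh i.succ (Fin.cons n w)
    choose p hp hpe using key
    refine ⟨∑ n ∈ N, Polynomial.aeval (X 0 : MvPolynomial (Fin (m + 1)) F)
      (Lagrange.basis N id n) * rename Fin.succ (p n), ?_, fun x => ?_⟩
    · refine totalDegree_finsetSum_le fun n hn => (totalDegree_mul _ _).trans ?_
      refine (add_le_add (totalDegree_aeval_X_le _ _)
        ((totalDegree_rename_le _ _).trans (hp n))).trans ?_
      rw [Lagrange.natDegree_basis Function.injective_id.injOn hn, hN]
      simp only [Nat.add_sub_cancel]
      rw [Nat.succ_mul, add_comm]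
    · have h1 := hh 0 (Fin.cons 0 (Fin.tail x))
      simp only [hcons0] at h1
      have h2 := h1.eq_sum_lagrange (N := N) (by omega) (x 0)
      have hx : (Fin.cons (x 0) (Fin.tail x) : Fin (m + 1) → F) = x := Fin.cons_self_tail x
      rw [hx] at h2
      rw [h2, map_sum]
      refine Finset.sum_congr rfl fun n _ => ?_
      rw [map_mul, eval_rename, hpe, mul_comm]
      rw [eval_aeval_X]
      rfl

theorem exists_mvPolynomial_of_polyDeg_basis [Fintype F] {d m : ℕ} (hd : d < Fintype.card F)
    (b : Module.Basis (Fin m) F (Fin m → F)) (h : (Fin m → F) → F)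
    (hh : ∀ i x, PolyDeg d fun a : F => h (x + a • b i)) :
    ∃ p : MvPolynomial (Fin m) F, p.totalDegree ≤ m * d ∧ ∀ x, h x = eval x p := by
  classical
  obtain ⟨p, hp, hpe⟩ := exists_mvPolynomial_of_polyDeg_single hd (fun c => h (b.equivFun.symm c))
    fun i x => by
      have : ∀ a : F, b.equivFun.symm (x + a • (Pi.single i 1 : Fin m → F)) =
          b.equivFun.symm x + a • b i := fun a => by
        rw [map_add, map_smul]
        simp
      simp only [this]
      exact hh i _
  refine ⟨aeval (fun i => ∑ j, C (b.equivFun (Pi.single j 1) i) * X j) p,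
    (totalDegree_aeval_le _ _ fun i => ?_).trans hp, fun x => ?_⟩
  · refine totalDegree_finsetSum_le fun j _ => (totalDegree_mul _ _).trans ?_
    rw [totalDegree_C, totalDegree_X]
  · have h1 := hpe (b.equivFun x)
    rw [LinearEquiv.symm_apply_apply] at h1
    have h2 : ∀ i, b.equivFun x i = eval x (∑ j, C (b.equivFun (Pi.single j 1) i) * X j) := by
      intro i
      have hx : x = ∑ j, x j • (Pi.single j 1 : Fin m → F) := by
        ext k
        simp [Finset.sum_apply, Pi.single_apply]
      conv_lhs => rw [hx]
      rw [map_sum, Finset.sum_apply, map_sum]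
      refine Finset.sum_congr rfl fun j _ => ?_
      rw [map_smul, Pi.smul_apply, smul_eq_mul, map_mul, eval_C, eval_X, mul_comm]
    rw [h1, ← coe_aeval_eq_eval, RingHom.coe_coe, ← coe_aeval_eq_eval, RingHom.coe_coe,
      comp_aeval_apply, funext h2]
    rfl

theorem exists_mvPolynomial_of_polyDeg_span [Fintype F] {d m : ℕ} (hd : d < Fintype.card F)
    {S : Set (Fin m → F)} (hS : Submodule.span F S = ⊤) (h : (Fin m → F) → F)
    (hh : ∀ v ∈ S, ∀ x, PolyDeg d fun a : F => h (x + a • v)) :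
    ∃ p : MvPolynomial (Fin m) F, p.totalDegree ≤ m * d ∧ ∀ x, h x = eval x p := by
  obtain ⟨B, hBS, hBspan, hB⟩ := exists_linearIndependent F S
  let b := Module.Basis.mk hB (by rw [Subtype.range_coe, hBspan, hS])
  have : Fintype B := FiniteDimensional.fintypeBasisIndex b
  have hcard : Fintype.card B = m := by
    rw [← Module.finrank_eq_card_basis b, Module.finrank_fin_fun]
  refine exists_mvPolynomial_of_polyDeg_basis hd
    (b.reindex (Fintype.equivFinOfCardEq hcard)) h fun i => hh _ (hBS ?_)
  rw [Module.Basis.reindex_apply, Module.Basis.mk_apply]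
  exact Subtype.prop _

/-- The restriction of a polynomial to the line through the origin in direction `x`. -/
noncomputable def restrictRay {σ : Type*} (x : σ → F) (p : MvPolynomial σ F) : Polynomial F :=
  aeval (fun i => Polynomial.C (x i) * Polynomial.X) p

theorem eval_restrictRay {σ : Type*} (x : σ → F) (p : MvPolynomial σ F) (a : F) :
    (restrictRay x p).eval a = eval (a • x) p := by
  rw [restrictRay, ← Polynomial.coe_aeval_eq_eval, comp_aeval_apply, ← coe_aeval_eq_eval,
    RingHom.coe_coe]
  congr 2
  ext i
  rw [map_mul, Polynomial.aeval_C, Polynomial.aeval_X, Pi.smul_apply, smul_eq_mul, mul_comm]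
  rfl

theorem restrictRay_of_isHomogeneous {σ : Type*} [Fintype σ] (x : σ → F) {p : MvPolynomial σ F}
    {k : ℕ} (hp : p.IsHomogeneous k) :
    restrictRay x p = Polynomial.C (eval x p) * Polynomial.X ^ k := by
  rw [restrictRay, aeval_def, eval₂_eq', eval_eq', map_sum, Finset.sum_mul]
  refine Finset.sum_congr rfl fun s hs => ?_
  have : ∑ i, s i = k := by
    rw [← hp (mem_support_iff.1 hs), Finsupp.weight_apply,
      Finsupp.sum_fintype _ _ fun _ => by simp]
    simp
  simp only [mul_pow, Finset.prod_mul_distrib, Finset.prod_pow_eq_pow_sum, this, map_mul,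
    map_prod, map_pow]
  rw [mul_assoc]
  rfl

theorem restrictRay_eq_sum {σ : Type*} [Fintype σ] (x : σ → F) (p : MvPolynomial σ F) :
    restrictRay x p = ∑ k ∈ Finset.range (p.totalDegree + 1),
      Polynomial.C (eval x (homogeneousComponent k p)) * Polynomial.X ^ k := by
  conv_lhs => rw [← sum_homogeneousComponent p]
  rw [restrictRay, map_sum]
  exact Finset.sum_congr rfl fun k _ =>
    restrictRay_of_isHomogeneous x (homogeneousComponent_isHomogeneous k p)

/-- On a ray, the homogeneous components separate according to powers of the parameter, so excess
total degree is visible wherever the top component does not vanish. -/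
theorem coeff_restrictRay_totalDegree {σ : Type*} [Fintype σ] (x : σ → F) (p : MvPolynomial σ F) :
    (restrictRay x p).coeff p.totalDegree =
      eval x (homogeneousComponent p.totalDegree p) := by
  rw [restrictRay_eq_sum, Polynomial.finsetSum_coeff]
  simp [Polynomial.coeff_X_pow]

theorem natDegree_restrictRay_le {σ : Type*} [Fintype σ] (x : σ → F) (p : MvPolynomial σ F) :
    (restrictRay x p).natDegree ≤ p.totalDegree := by
  rw [restrictRay_eq_sum]
  refine Polynomial.natDegree_sum_le_of_forall_le _ _ fun k hk => ?_
  exact (Polynomial.natDegree_C_mul_X_pow_le _ _).trans (Nat.lt_succ_iff.1 (Finset.mem_range.1 hk))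

theorem homogeneousComponent_totalDegree_ne_zero {σ : Type*} {p : MvPolynomial σ F} (hp : p ≠ 0) :
    homogeneousComponent p.totalDegree p ≠ 0 := by
  obtain ⟨s, hs, hdeg⟩ := Finset.exists_mem_eq_sup p.support (support_nonempty.2 hp)
    fun s => s.sum fun _ e => e
  intro h0
  have h1 := congrArg (coeff s) h0
  rw [coeff_homogeneousComponent, if_pos, coeff_zero] at h1
  · exact mem_support_iff.1 hs h1
  · rw [totalDegree, hdeg]
    rfl

theorem card_zeros_mul_le [Fintype F] [DecidableEq F] {m : ℕ} {p : MvPolynomial (Fin m) F}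
    (hp : p ≠ 0) :
    (Finset.univ.filter fun x => eval x p = 0).card * Fintype.card F ≤
      p.totalDegree * Fintype.card F ^ m := by
  have h := schwartz_zippel_totalDegree hp (Finset.univ : Finset F)
  have hq : (0 : ℚ≥0) < Fintype.card F := by exact_mod_cast Fintype.card_pos
  rw [Fintype.piFinset_univ, Finset.card_univ, div_le_div_iff₀ (by positivity) hq] at h
  exact_mod_cast h

/-- A polynomial of degree more than `d` disagrees with functions of degree at most `d` on most
lines through the origin. -/
theorem card_ray_agree_le [Fintype F] [DecidableEq F] {m d : ℕ} {p : MvPolynomial (Fin (m + 1)) F}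
    (hdp : d < p.totalDegree) (hp : 6 * p.totalDegree ≤ Fintype.card F) {u : (Fin m → F) → F → F}
    (hu : ∀ w, PolyDeg d (u w)) :
    5 * (Finset.univ.filter fun s : F × (Fin m → F) =>
      eval (s.1 • (Fin.cons 1 s.2 : Fin (m + 1) → F)) p = u s.2 s.1).card ≤
      2 * Fintype.card F ^ (m + 1) := by
  set q := Fintype.card F with hq
  set D := p.totalDegree with hD
  have hp0 : p ≠ 0 := by
    rintro rfl
    simp [hD] at hdp
  set P := homogeneousComponent D p with hP
  have hP0 : P ≠ 0 := homogeneousComponent_totalDegree_ne_zero hp0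
  have hPh : P.IsHomogeneous D := homogeneousComponent_isHomogeneous _ _
  set B : Finset (Fin m → F) :=
    Finset.univ.filter fun w => eval (Fin.cons 1 w : Fin (m + 1) → F) P = 0 with hB
  -- The nonzero multiples of the points `(1, w)` with `w ∈ B` are distinct zeros of the homogeneous
  -- polynomial `P`, so Schwartz–Zippel bounds their number.
  have hBcard : B.card * (q - 1) * q ≤ D * q ^ (m + 1) := by
    have h1 := card_zeros_mul_le hP0
    rw [hPh.totalDegree hP0] at h1
    refine (Nat.mul_le_mul_right _ ?_).trans h1
    have h2 : (Finset.univ.filter fun a : F => a ≠ 0).card = q - 1 := by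
      rw [Finset.filter_ne', Finset.card_erase_of_mem (Finset.mem_univ _), Finset.card_univ]
    rw [← h2, ← Finset.card_product]
    refine Finset.card_le_card_of_injOn
      (fun s => s.2 • (Fin.cons 1 s.1 : Fin (m + 1) → F)) ?_ ?_
    · rintro ⟨w, a⟩ hs
      simp only [hB, Finset.coe_product, Set.mem_prod, Finset.mem_coe, Finset.mem_filter,
        Finset.mem_univ, true_and] at hs ⊢
      rw [← eval_restrictRay, restrictRay_of_isHomogeneous _ hPh, hs.1]
      simp
    · rintro ⟨w, a⟩ hs ⟨w', a'⟩ hs' heq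
      simp only [Finset.coe_product, Set.mem_prod, Finset.mem_coe, Finset.mem_filter,
        Finset.mem_univ, true_and] at hs hs'
      have h0 : a = a' := by simpa using congrFun heq 0
      subst h0
      refine Prod.ext (funext fun i => ?_) rfl
      have := congrFun heq i.succ
      simpa [hs.2] using this
  -- Off `B` the difference from `u w` has a nonzero coefficient at `D > d`, hence at most `D`
  -- roots.
  have hrow : ∀ w ∉ B, (Finset.univ.filter fun a : F =>
      eval (a • (Fin.cons 1 w : Fin (m + 1) → F)) p = u w a).card ≤ D := by
    intro w hw
    obtain ⟨r, hr, hur⟩ := hu w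
    set x : Fin (m + 1) → F := Fin.cons 1 w
    have hco : (restrictRay x p - r).coeff D ≠ 0 := by
      rw [Polynomial.coeff_sub, Polynomial.coeff_eq_zero_of_natDegree_lt (hr.trans_lt hdp),
        sub_zero, coeff_restrictRay_totalDegree]
      simpa [hB] using hw
    have hne : restrictRay x p - r ≠ 0 := by
      rintro h0
      simp [h0] at hco
    refine (Polynomial.card_le_degree_of_subset_roots (p := restrictRay x p - r) ?_).trans ?_
    · intro a ha
      rw [Polynomial.mem_roots hne, Polynomial.IsRoot, Polynomial.eval_sub, eval_restrictRay,
        ← hur]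
      simpa [sub_eq_zero] using ha
    · exact (Polynomial.natDegree_sub_le _ _).trans
        (max_le (natDegree_restrictRay_le _ _) (hr.trans hdp.le))
  have htotal : (Finset.univ.filter fun s : F × (Fin m → F) =>
      eval (s.1 • (Fin.cons 1 s.2 : Fin (m + 1) → F)) p = u s.2 s.1).card ≤
      B.card * q + q ^ m * D := by
    have h1 : (Finset.univ.filter fun s : F × (Fin m → F) =>
        eval (s.1 • (Fin.cons 1 s.2 : Fin (m + 1) → F)) p = u s.2 s.1).card =
        ∑ w : Fin m → F, (Finset.univ.filter fun a : F =>
          eval (a • (Fin.cons 1 w : Fin (m + 1) → F)) p = u w a).card := by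
      simp only [Finset.card_filter]
      rw [Fintype.sum_prod_type_right]
    rw [h1, ← Finset.sum_add_sum_compl B]
    refine add_le_add ?_ ?_
    · refine (Finset.sum_le_card_nsmul _ _ q fun w _ => ?_).trans (by simp)
      exact Finset.card_le_univ _
    · refine (Finset.sum_le_card_nsmul _ _ D fun w hw => hrow w (by simpa using hw)).trans ?_
      rw [smul_eq_mul]
      refine Nat.mul_le_mul_right _ ((Finset.card_le_univ _).trans (by simp [hq]))
  have hq6 : 6 ≤ q := by omega
  have hqm : 6 * (D * q ^ m) ≤ q ^ (m + 1) := by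
    rw [← mul_assoc, pow_succ, mul_comm]
    exact Nat.mul_le_mul_left _ hp
  -- The fraction `1/6` grows to `1/5` because of the factor `q / (q - 1) ≤ 6/5`. Together with
  -- `hqm`, the total is `1/5 + 1/6 < 2/5`.
  have hB2 : 5 * (B.card * q) ≤ q ^ (m + 1) := by
    have h1 : B.card * (q - 1) ≤ D * q ^ m := by
      refine Nat.le_of_mul_le_mul_right (hBcard.trans_eq ?_) (show 0 < q by omega)
      rw [pow_succ, mul_assoc]
    have h2 : 5 * q ≤ 6 * (q - 1) := by omega
    calc 5 * (B.card * q) = B.card * (5 * q) := by ring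
      _ ≤ B.card * (6 * (q - 1)) := Nat.mul_le_mul_left _ h2
      _ = 6 * (B.card * (q - 1)) := by ring
      _ ≤ 6 * (D * q ^ m) := Nat.mul_le_mul_left _ h1
      _ ≤ q ^ (m + 1) := hqm
  have : q ^ m * D = D * q ^ m := mul_comm _ _
  omega

end TotalDegree

/-! ### Soundness for an abstract family of directions. -/

section Core
variable {F : Type*} [Field F] [Fintype F] [DecidableEq F] {m d t : ℕ} {ι : Type*} [Fintype ι]
  {τ : ℝ} {y : ι → Fin (m + 1) → F}

-- The map `(a, w) ↦ a • (1, w)` is injective off `a = 0`, so counts over such pairs are counts of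
-- points up to the `|F|^m` pairs with `a = 0`.
omit [DecidableEq F] in
theorem card_ray_le (P : F × (Fin m → F) → Prop) (R : (Fin (m + 1) → F) → Prop)
    [DecidablePred P] [DecidablePred R]
    (hPR : ∀ s, P s → s.1 ≠ 0 → R (s.1 • (Fin.cons 1 s.2 : Fin (m + 1) → F))) :
    (Finset.univ.filter P).card ≤ Fintype.card F ^ m + (Finset.univ.filter R).card := by
  classical
  have h0 : (Finset.univ.filter fun s : F × (Fin m → F) => s.1 = 0).card ≤
      Fintype.card F ^ m := by
    refine le_of_le_of_eq (Finset.card_le_card_of_injOn (t := (Finset.univ : Finset (Fin m → F)))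
      Prod.snd (by simp) ?_) (by simp)
    rintro ⟨a, w⟩ hs ⟨a', w'⟩ hs' heq
    simp_all
  refine le_trans ?_ (add_le_add h0 (Finset.card_le_card_of_injOn
    (s := Finset.univ.filter fun s : F × (Fin m → F) => s.1 ≠ 0 ∧
      R (s.1 • (Fin.cons 1 s.2 : Fin (m + 1) → F)))
    (fun s => s.1 • (Fin.cons 1 s.2 : Fin (m + 1) → F)) ?_ ?_))
  · refine (Finset.card_le_card fun s hs => ?_).trans (Finset.card_union_le _ _)
    simp only [Finset.mem_filter, Finset.mem_univ, true_and, Finset.mem_union] at hs ⊢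
    have := hPR s hs
    tauto
  · rintro ⟨a, w⟩ hs
    simp only [Finset.coe_filter, Finset.mem_univ, true_and, Set.mem_ofPred_eq] at hs ⊢
    exact hs.2
  · rintro ⟨a, w⟩ hs ⟨a', w'⟩ hs' heq
    simp only [Finset.coe_filter, Finset.mem_univ, true_and, Set.mem_ofPred_eq] at hs hs'
    have h0 : a = a' := by simpa using congrFun heq 0
    subst h0
    refine Prod.ext rfl (funext fun i => ?_)
    have := congrFun heq i.succ
    simpa [hs.1] using this

/-- Soundness of the low degree test along the directions of `y`, together with a test on the lines
through the origin. -/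
theorem exists_parallelRM_of_close (hd : 6 * ((m + 1) * d) ≤ Fintype.card F)
    (hq : 2 ^ 10 ≤ Fintype.card F) (hy : CharBound F τ y) (hτ : 0 ≤ τ) (hτ' : τ ≤ 1 / 2 ^ 50)
    {f : (Fin (m + 1) → F) → Fin t → F} {G : ι → (Fin (m + 1) → F) → Fin t → F}
    (hG : ∀ i, DirDeg d (y i) (G i))
    (hfG : 2 ^ 30 * ∑ i, diffCount f (G i) < Fintype.card ι * Fintype.card F ^ (m + 1))
    {u : (Fin m → F) → F → Fin t → F} (hu : ∀ w j, PolyDeg d fun a => u w a j)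
    (hfu : 2 * (Finset.univ.filter fun s : F × (Fin m → F) =>
      f (s.1 • (Fin.cons 1 s.2 : Fin (m + 1) → F)) ≠ u s.2 s.1).card ≤
        Fintype.card F ^ (m + 1)) :
    ∃ T ∈ parallelRM F (m + 1) d t,
      Fintype.card ι * diffCount f T ≤ 2 ^ 20 * ∑ i, diffCount f (G i) := by
  classical
  have hclose : ∑ i, diffCount f (closest d (y i) f) ≤ ∑ i, diffCount f (G i) :=
    Finset.sum_le_sum fun i _ => diffCount_closest_le f (hG i)
  have hV : Fintype.card (Fin (m + 1) → F) = Fintype.card F ^ (m + 1) := by simp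
  have hdle : d ≤ (m + 1) * d := Nat.le_mul_of_pos_left _ (Nat.succ_pos m)
  obtain ⟨h, A, hA, hAd, hdist⟩ := exists_dirDeg_of_close (d := d) (by omega) hy hτ hτ' f
    (by rw [hV]; omega)
  have hspan := span_eq_top_of_charBound hy (hτ'.trans (by norm_num)) hA
  have hdist' := hdist.trans (Nat.mul_le_mul_left _ hclose)
  have hsmall : 2 ^ 10 * diffCount f h ≤ Fintype.card F ^ (m + 1) := by
    have h1 : Fintype.card ι * (2 ^ 10 * diffCount f h) <
        Fintype.card ι * Fintype.card F ^ (m + 1) := by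
      calc _ = 2 ^ 10 * (Fintype.card ι * diffCount f h) := by ring
        _ ≤ 2 ^ 10 * (2 ^ 20 * ∑ i, diffCount f (G i)) := Nat.mul_le_mul_left _ hdist'
        _ < _ := by omega
    exact (lt_of_mul_lt_mul_left h1 (Nat.zero_le _)).le
  refine ⟨h, fun j => ?_, hdist'⟩
  obtain ⟨p, hp, hpe⟩ := exists_mvPolynomial_of_polyDeg_span (d := d) (by omega) hspan
    (fun x => h x j) (by
      rintro _ ⟨i, hi, rfl⟩ x
      exact hAd i hi x j)
  refine ⟨p, ?_, hpe⟩
  by_contra hcon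
  have h1 := card_ray_agree_le (not_le.1 hcon) (by omega) fun w => hu w j
  have h2 : (Finset.univ.filter fun s : F × (Fin m → F) =>
      f (s.1 • (Fin.cons 1 s.2 : Fin (m + 1) → F)) ≠
        h (s.1 • (Fin.cons 1 s.2 : Fin (m + 1) → F))).card ≤
      Fintype.card F ^ m + diffCount f h := card_ray_le _ _ fun _ hs _ => hs
  -- At every pair the ray test fails, or `f` differs from `h`, or `p` agrees with `u`. If the
  -- degree were too large, these fractions would be at most `1/2`, `1/q + 1/2^10` and `2/5`, which
  -- do not cover everything.
  have h3 : Fintype.card F ^ (m + 1) ≤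
      ((Finset.univ.filter fun s : F × (Fin m → F) =>
        f (s.1 • (Fin.cons 1 s.2 : Fin (m + 1) → F)) ≠ u s.2 s.1).card +
      (Finset.univ.filter fun s : F × (Fin m → F) =>
        f (s.1 • (Fin.cons 1 s.2 : Fin (m + 1) → F)) ≠
          h (s.1 • (Fin.cons 1 s.2 : Fin (m + 1) → F))).card) +
      (Finset.univ.filter fun s : F × (Fin m → F) =>
        MvPolynomial.eval (s.1 • (Fin.cons 1 s.2 : Fin (m + 1) → F)) p = u s.2 s.1 j).card := by
    have h4 : Fintype.card F ^ (m + 1) = (Finset.univ : Finset (F × (Fin m → F))).card := by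
      rw [Finset.card_univ, Fintype.card_prod, Fintype.card_fun, Fintype.card_fin, pow_succ,
        mul_comm]
    rw [h4]
    refine (Finset.card_le_card fun s _ => ?_).trans ((Finset.card_union_le _ _).trans
      (add_le_add (Finset.card_union_le _ _) le_rfl))
    simp only [Finset.mem_filter, Finset.mem_univ, true_and, Finset.mem_union]
    by_contra hne
    push Not at hne
    obtain ⟨⟨h5, h6⟩, h7⟩ := hne
    apply h7
    rw [← hpe, ← h6, h5]
  have h5 : 2 ^ 10 * Fintype.card F ^ m ≤ Fintype.card F ^ (m + 1) := by
    rw [pow_succ, mul_comm]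
    exact Nat.mul_le_mul_left _ hq
  have h6 : 0 < Fintype.card F ^ (m + 1) := by positivity
  omega

end Core
end ParallelLDT

namespace ParallelLDT

/-! ### The augmented test along small-biased directions. -/

section Augmented

theorem prOn_le_one {α : Type*} (A : Finset α) (P : α → Prop) : prOn A P ≤ 1 := by
  classical
  refine div_le_one_of_le₀ ?_ (Nat.cast_nonneg _)
  exact_mod_cast Finset.card_filter_le _ _

theorem prOn_nonneg {α : Type*} (A : Finset α) (P : α → Prop) : 0 ≤ prOn A P := by
  unfold prOn; positivity

theorem card_filter_eq_prOn_mul {α : Type*} (A : Finset α) (P : α → Prop) [DecidablePred P] :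
    ((A.filter P).card : ℝ) = prOn A P * A.card := by
  rcases A.eq_empty_or_nonempty with rfl | hA
  · simp
  · have : (A.card : ℝ) ≠ 0 := by exact_mod_cast hA.card_pos.ne'
    rw [prOn, div_mul_cancel₀ _ this]
    congr!

theorem card_filter_not_eq_prOn_mul {α : Type*} (A : Finset α) (P : α → Prop) [DecidablePred P] :
    ((A.filter fun a => ¬ P a).card : ℝ) = (1 - prOn A P) * A.card := by
  have h : ((A.filter P).card : ℝ) + (A.filter fun a => ¬ P a).card = A.card := by
    exact_mod_cast Finset.card_filter_add_card_filter_not (s := A) P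
  rw [sub_mul, one_mul, ← card_filter_eq_prOn_mul, ← h]
  ring

variable {F : Type*} [Field F] [Fintype F] {m d t : ℕ}

omit [Field F] in
theorem relDist_mul_card [DecidableEq F] (f T : Table F m t) :
    relDist f T * Fintype.card F ^ m = diffCount f T := by
  have h := card_filter_eq_prOn_mul Finset.univ fun x => f x ≠ T x
  rw [relDist, diffCount, h]
  simp

omit [Fintype F] in
theorem zero_mem_parallelRM : (0 : Table F m t) ∈ parallelRM F m d t :=
  fun _ => ⟨0, by simp, fun _ => by simp⟩

theorem le_one_of_isFar {δ : ℝ} {f : Table F m t} (h : IsFar δ f (parallelRM F m d t)) : δ ≤ 1 :=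
  (h 0 zero_mem_parallelRM).trans (prOn_le_one _ _)

theorem two_pow_le_card {F : Type*} [Field F] [Fintype F] (hm : 0 < m)
    (hq : 2 ^ 100 * (m : ℝ) * Real.logb 2 (Fintype.card F) ≤ Fintype.card F) :
    (2 : ℝ) ^ 100 * m ≤ Fintype.card F ∧ 1 ≤ m * Real.logb 2 (Fintype.card F) := by
  have h2 : (2 : ℝ) ≤ Fintype.card F := by exact_mod_cast Fintype.one_lt_card
  have h1 : 1 ≤ Real.logb 2 (Fintype.card F) := by
    rw [Real.le_logb_iff_rpow_le (by norm_num) (by linarith)]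
    simpa using h2
  have hm' : (1 : ℝ) ≤ m := by exact_mod_cast hm
  refine ⟨(le_mul_of_one_le_right (by positivity) h1).trans hq, ?_⟩
  nlinarith

-- Summing `χ (a • y)` over `a` and over `S` counts the annihilated lines with weight `|F|`. The
-- term `a = 0` contributes `|S|`; for the other `a`, scaling gives another nontrivial character,
-- whose sum is controlled by the bias.
open Classical in
theorem charBound_of_isBiasedSet {lam : ℝ} {S : Finset (Fin m → F)} (hS : IsBiasedSet lam S)
    {τ : ℝ} (hτ : 1 / Fintype.card F + lam ≤ τ) : CharBound F τ (fun i : S => (i : Fin m → F)) := by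
  intro χ hχ
  have hq : (0 : ℝ) < Fintype.card F := by exact_mod_cast Fintype.card_pos
  have hSc : (0 : ℝ) < S.card := by exact_mod_cast hS.nonempty.card_pos
  have hlam : 0 ≤ lam := (norm_nonneg _).trans (hS.bias χ hχ)
  have hbias : ∀ a : F, ‖∑ y : S, χ (a • (y : Fin m → F))‖ ≤
      (if a = 0 then (S.card : ℝ) else 0) + lam * S.card := by
    intro a
    split_ifs with ha
    · subst ha
      simp
      positivity
    · have hne : χ.compAddMonoidHom (DistribSMul.toAddMonoidHom (Fin m → F) a) ≠ 1 := by
        intro h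
        refine hχ (DFunLike.ext _ _ fun x => ?_)
        have := DFunLike.congr_fun h (a⁻¹ • x)
        simpa [smul_smul, ha] using this
      have := hS.bias _ hne
      rw [norm_div, Complex.norm_natCast, div_le_iff₀ hSc] at this
      rw [zero_add]
      refine le_of_eq_of_le ?_ this
      rw [← Finset.sum_coe_sort S]
      rfl
  have hsum : ((Finset.univ.filter fun i : S => ∀ a : F, χ (a • (i : Fin m → F)) = 1).card : ℝ) *
      Fintype.card F ≤ S.card + Fintype.card F * (lam * S.card) := by
    calc _ = ‖∑ a : F, ∑ y : S, χ (a • (y : Fin m → F))‖ := by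
          rw [Finset.sum_comm]
          simp only [sum_char_line]
          rw [← Finset.sum_filter, Finset.sum_const, nsmul_eq_mul, norm_mul]
          simp
      _ ≤ ∑ a : F, ((if a = 0 then (S.card : ℝ) else 0) + lam * S.card) :=
          norm_sum_le_of_le _ fun a _ => hbias a
      _ = _ := by simp [Finset.sum_add_distrib]
  rw [Fintype.card_coe]
  beta_reduce
  refine le_trans ?_ (mul_le_mul_of_nonneg_right hτ hSc.le)
  refine le_of_eq_of_le ?_ (le_of_mul_le_mul_right (hsum.trans_eq ?_) hq)
  · congr!
  · field_simp

omit [Fintype F] in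
theorem lineThrough_add_smul (x v : Fin m → F) (a : F) :
    lineThrough (x + a • v) v = lineThrough x v := by
  refine Subtype.ext ?_
  ext z
  constructor
  · rintro ⟨b, rfl⟩
    exact ⟨a + b, by simp only [add_smul, add_assoc]⟩
  · rintro ⟨b, rfl⟩
    exact ⟨b - a, by simp only [sub_smul]; abel⟩

omit [Fintype F] in
theorem lineThrough_zero_smul (v : Fin m → F) {a : F} (ha : a ≠ 0) :
    lineThrough 0 (a • v) = lineThrough 0 v := by
  refine Subtype.ext ?_
  ext z
  constructor
  · rintro ⟨b, rfl⟩
    exact ⟨b * a, by simp only [mul_smul]⟩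
  · rintro ⟨b, rfl⟩
    exact ⟨b * a⁻¹, by simp only [smul_smul, inv_mul_cancel_right₀ ha]⟩

theorem isClose_of_augLDTestAccept (hm : 0 < m) (hd : 6 * (m : ℝ) * d ≤ Fintype.card F)
    (hq : 2 ^ 100 * (m : ℝ) * Real.logb 2 (Fintype.card F) ≤ Fintype.card F) {lam : ℝ}
    (hlam : lam ≤ 1 / (2 ^ 100 * (m : ℝ) * Real.logb 2 (Fintype.card F)))
    {S : Finset (Fin m → F)} (hS : IsBiasedSet lam S) {f : Table F m t} {g : LineOracle F m d t}
    {δ : ℝ} (hδ : 0 < δ) (hacc : 1 - δ ≤ augLDTestAccept S f g) :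
    IsClose (2 ^ 40 * δ) f (parallelRM F m d t) := by
  classical
  intro hfar
  -- The zero word is at distance at most one, so the negated conclusion itself forces `δ ≤ 1 /
  -- 2^40`, the smallness that the estimates below use.
  have hδ1 := le_one_of_isFar hfar
  obtain ⟨hq1, hlog⟩ := two_pow_le_card hm hq
  obtain ⟨m, rfl⟩ := Nat.exists_eq_add_one.2 hm
  set q := Fintype.card F with hqdef
  have hm1 : (1 : ℝ) ≤ (m + 1 : ℕ) := by exact_mod_cast hm
  have hq100 : (2 : ℝ) ^ 100 ≤ q := by linarith
  have hq0 : (0 : ℝ) < q := by linarith [show (0 : ℝ) < 2 ^ 100 by norm_num]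
  have hV0 : (0 : ℝ) < (q : ℝ) ^ (m + 1) := by positivity
  have hSc : (0 : ℝ) < S.card := by exact_mod_cast hS.nonempty.card_pos
  have hlam' : lam ≤ 1 / 2 ^ 100 := hlam.trans
    (one_div_le_one_div_of_le (by norm_num) (by rw [mul_assoc]; linarith))
  have hy : CharBound F (1 / 2 ^ 50) fun i : S => (i : Fin (m + 1) → F) := by
    refine charBound_of_isBiasedSet hS ?_
    have : 1 / (q : ℝ) ≤ 1 / 2 ^ 100 := one_div_le_one_div_of_le (by norm_num) hq100
    linarith
  set p₁ := ldTestAccept S f g with hp₁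
  set p₂ := prOn Finset.univ (fun z => f z = g.toFun (lineThrough 0 z) z) with hp₂
  have hp₁1 : p₁ ≤ 1 := prOn_le_one _ _
  have hp₂1 : p₂ ≤ 1 := prOn_le_one _ _
  have hsum : (1 - p₁) + (1 - p₂) ≤ 2 * δ := by
    have : 1 - δ ≤ 1 / 2 * p₁ + 1 / 2 * p₂ := hacc
    linarith
  set G : S → (Fin (m + 1) → F) → Fin t → F := fun i x => g.toFun (lineThrough x i) x with hG
  set u : (Fin m → F) → F → Fin t → F := fun w a =>
    g.toFun (lineThrough 0 (Fin.cons 1 w)) (a • (Fin.cons 1 w : Fin (m + 1) → F)) with hu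
  have hGsum : (∑ i, diffCount f (G i) : ℝ) = (1 - p₁) * (q ^ (m + 1) * S.card) := by
    have h1 := card_filter_not_eq_prOn_mul ((Finset.univ : Finset (Fin (m + 1) → F)) ×ˢ S)
      fun xy => f xy.1 = g.toFun (lineThrough xy.1 xy.2) xy.1
    rw [Finset.card_product] at h1
    simp only [Finset.card_univ, Fintype.card_fun, Fintype.card_fin] at h1
    push_cast at h1
    rw [hp₁, ldTestAccept, hqdef, ← h1]
    norm_cast
    rw [Finset.card_filter, Finset.sum_product_right, ← Finset.sum_coe_sort S]
    refine Finset.sum_congr rfl fun i _ => ?_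
    rw [diffCount, Finset.card_filter]
  have hcard2 : ((Finset.univ.filter fun s : F × (Fin m → F) =>
      f (s.1 • (Fin.cons 1 s.2 : Fin (m + 1) → F)) ≠ u s.2 s.1).card : ℝ) ≤
        q ^ m + (1 - p₂) * q ^ (m + 1) := by
    have h1 := card_filter_not_eq_prOn_mul (Finset.univ : Finset (Fin (m + 1) → F))
      fun z => f z = g.toFun (lineThrough 0 z) z
    rw [← hp₂] at h1
    simp only [Finset.card_univ, Fintype.card_fun, Fintype.card_fin] at h1
    push_cast at h1
    rw [← h1]
    have h2 := card_ray_le (fun s : F × (Fin m → F) =>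
      f (s.1 • (Fin.cons 1 s.2 : Fin (m + 1) → F)) ≠ u s.2 s.1)
      (fun z => ¬ f z = g.toFun (lineThrough 0 z) z) fun s hs h0 => by
        rwa [lineThrough_zero_smul _ h0]
    exact_mod_cast h2
  have hδ' : δ ≤ 1 / 2 ^ 40 := by linarith
  have hGR : (2 : ℝ) ^ 30 * ∑ i, (diffCount f (G i) : ℝ) < S.card * q ^ (m + 1) := by
    rw [hGsum]
    have h1 : (2 : ℝ) ^ 30 * (1 - p₁) < 1 := by linarith
    have h2 : (0 : ℝ) < q ^ (m + 1) * S.card := by positivity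
    nlinarith
  have huR : 2 * ((Finset.univ.filter fun s : F × (Fin m → F) =>
      f (s.1 • (Fin.cons 1 s.2 : Fin (m + 1) → F)) ≠ u s.2 s.1).card : ℝ) ≤ q ^ (m + 1) := by
    have h1 : (4 : ℝ) * q ^ m ≤ q ^ (m + 1) := by
      rw [pow_succ, mul_comm]
      exact mul_le_mul_of_nonneg_left (by linarith) (by positivity)
    have h2 : (1 - p₂) * q ^ (m + 1) ≤ 1 / 4 * (q : ℝ) ^ (m + 1) :=
      mul_le_mul_of_nonneg_right (by linarith) hV0.le
    linarith
  obtain ⟨T, hT, hfT⟩ := exists_parallelRM_of_close (d := d) (f := f) (G := G) (u := u)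
    (by rw [mul_assoc] at hd; exact_mod_cast hd)
    (by have : (2 : ℝ) ^ 10 ≤ q := le_trans (by norm_num) hq100
        exact_mod_cast this)
    hy (by norm_num) le_rfl
    (fun i x j => by
      simp only [hG, lineThrough_add_smul]
      exact g.isPoly x i j)
    (by rw [Fintype.card_coe]; exact_mod_cast hGR)
    (fun w j => by simpa [PolyDeg] using g.isPoly 0 (Fin.cons 1 w) j)
    (by exact_mod_cast huR)
  have hfT' : (S.card : ℝ) * diffCount f T ≤ 2 ^ 20 * ∑ i, (diffCount f (G i) : ℝ) := by
    rw [Fintype.card_coe] at hfT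
    exact_mod_cast hfT
  rw [hGsum, ← relDist_mul_card] at hfT'
  have h1 := hfar T hT
  have h2 : (0 : ℝ) < S.card * q ^ (m + 1) := by positivity
  have h3 : relDist f T ≤ 2 ^ 20 * (1 - p₁) := by
    refine le_of_mul_le_mul_right ?_ h2
    linarith
  linarith

/-- Distances are multiples of `1 / |F|^m`, so a distance below this threshold is zero. -/
theorem mem_parallelRM_of_isClose {f : Table F m t}
    (h : ∀ δ : ℝ, 0 < δ → IsClose δ f (parallelRM F m d t)) : f ∈ parallelRM F m d t := by
  classical
  have hV : (0 : ℝ) < (Fintype.card F : ℝ) ^ m := by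
    have : (0 : ℝ) < Fintype.card F := by exact_mod_cast Fintype.card_pos
    positivity
  have h1 := h (1 / (Fintype.card F : ℝ) ^ m) (by positivity)
  simp only [IsClose, IsFar, not_forall, not_le] at h1
  obtain ⟨T, hT, h2⟩ := h1
  rw [lt_div_iff₀ hV, relDist_mul_card] at h2
  have h3 : diffCount f T = 0 := Nat.lt_one_iff.1 (by exact_mod_cast h2)
  rwa [diffCount_eq_zero h3]

end Augmented
end ParallelLDT

namespace ParallelLDT

/-! ### Moment curve directions and the two-query verifier. -/

section PowerDirections
variable {F : Type*} [Field F] {m : ℕ} {ι : Type*} [Fintype ι]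

/-- The point `(1, c, c², …)` of the moment curve. -/
def momentCurve (F : Type*) [Field F] (m : ℕ) (c : F) : Fin m → F := fun i => c ^ (i : ℕ)

theorem span_momentCurve {v : Fin m → F} (hv : Function.Injective v) :
    Submodule.span F (Set.range fun i => momentCurve F m (v i)) = ⊤ := by
  have h := Matrix.det_vandermonde_ne_zero_iff.2 hv
  have hli : LinearIndependent F (Matrix.vandermonde v).row :=
    Matrix.linearIndependent_rows_of_det_ne_zero h
  have := hli.span_eq_top_of_card_eq_finrank' (by simp)
  exact this

/-- Any `m` points of the curve span the space, so a character trivial on `m` of the lines is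
trivial everywhere. This explicit family takes the place of a small-biased set. -/
theorem charBound_momentCurve [Fintype F] {c : ι → F} (hc : Function.Injective c) {τ : ℝ}
    (hτ : (m : ℝ) ≤ τ * Fintype.card ι) :
    CharBound F τ fun i => momentCurve F m (c i) := by
  classical
  intro χ hχ
  refine le_trans ?_ hτ
  rw [Nat.cast_le]
  by_contra hcon
  rw [not_le] at hcon
  obtain ⟨B, hB, hBm⟩ := Finset.exists_subset_card_eq hcon.le
  let v : Fin m → F := fun i => c (B.equivFinOfCardEq hBm |>.symm i)
  have hv : Function.Injective v := hc.comp (Subtype.val_injective.comp (Equiv.injective _))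
  refine hχ (DFunLike.ext _ _ fun x => ?_)
  have hx : x ∈ Submodule.span F (Set.range fun i => momentCurve F m (v i)) := by
    rw [span_momentCurve hv]
    trivial
  rw [Submodule.mem_span_range_iff_exists_fun] at hx
  obtain ⟨a, rfl⟩ := hx
  rw [AddChar.one_apply]
  refine Finset.sum_induction _ (fun y => χ y = 1)
    (fun y z hy hz => by rw [AddChar.map_add_eq_mul, hy, hz, one_mul])
    (AddChar.map_zero_eq_one χ) fun i _ => ?_
  have := hB (B.equivFinOfCardEq hBm |>.symm i).2
  simp only [Finset.mem_filter, Finset.mem_univ, true_and] at this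
  exact this _

end PowerDirections

section LineRestriction
variable {F : Type*} [Field F]

theorem polyDeg_eval_line {σ : Type*} [Fintype σ] {d : ℕ} {p : MvPolynomial σ F}
    (hp : p.totalDegree ≤ d) (b v : σ → F) :
    PolyDeg d fun a => MvPolynomial.eval (b + a • v) p := by
  refine ⟨MvPolynomial.aeval (fun i => Polynomial.C (b i) + Polynomial.C (v i) * Polynomial.X) p,
    ?_, fun a => ?_⟩
  · rw [MvPolynomial.aeval_def, MvPolynomial.eval₂_eq']
    refine Polynomial.natDegree_sum_le_of_forall_le _ _ fun s hs => ?_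
    refine (Polynomial.natDegree_C_mul_le _ _).trans ?_
    refine (Polynomial.natDegree_prod_le _ _).trans
      (le_trans ?_ ((MvPolynomial.le_totalDegree hs).trans hp))
    rw [Finsupp.sum_fintype _ _ fun _ => rfl]
    refine Finset.sum_le_sum fun i _ => Polynomial.natDegree_pow_le.trans ?_
    refine (Nat.mul_le_mul_left _ ?_).trans (mul_one _).le
    rw [add_comm]
    exact Polynomial.natDegree_linear_le
  · beta_reduce
    rw [← Polynomial.coe_aeval_eq_eval, MvPolynomial.comp_aeval_apply,
      ← MvPolynomial.coe_aeval_eq_eval, RingHom.coe_coe]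
    congr 2
    ext i
    rw [map_add, map_mul, Polynomial.aeval_C, Polynomial.aeval_C, Polynomial.aeval_X,
      Pi.add_apply, Pi.smul_apply, smul_eq_mul, mul_comm]
    rfl

/-- The value at `a` of the polynomial with coefficients `c`. -/
def coeffEval {n : ℕ} (c : Fin n → F) (a : F) : F := ∑ k, c k * a ^ (k : ℕ)

theorem PolyDeg.exists_coeffEval {d : ℕ} {u : F → F} (hu : PolyDeg d u) :
    ∃ c : Fin (d + 1) → F, ∀ a, u a = coeffEval c a := by
  obtain ⟨p, hp, hu⟩ := hu
  refine ⟨fun k => p.coeff k, fun a => ?_⟩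
  rw [hu, Polynomial.eval_eq_sum_range' (Nat.lt_succ_of_le hp), coeffEval, Finset.sum_range]

theorem polyDeg_coeffEval {d : ℕ} (c : Fin (d + 1) → F) : PolyDeg d (coeffEval c) := by
  refine ⟨∑ k, Polynomial.C (c k) * Polynomial.X ^ (k : ℕ), ?_, fun a => ?_⟩
  · exact Polynomial.natDegree_sum_le_of_forall_le _ _ fun k _ =>
      (Polynomial.natDegree_C_mul_X_pow_le _ _).trans (Nat.lt_succ_iff.1 k.2)
  · simp [coeffEval, Polynomial.eval_finsetSum]

end LineRestriction

section LinePoint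
variable {F : Type*} [Field F] {q m d t M r : ℕ}

/-- The number encoded by a sequence of coins, least significant digit first. -/
def coinEquiv (r : ℕ) : (Fin r → Bool) ≃ Fin (2 ^ r) :=
  (Equiv.arrowCongr (Equiv.refl _) finTwoEquiv.symm).trans finFunctionFinEquiv

/-- The lines used by the verifier: `(Sum.inl α, v)` stands for the line through `(0, v)` in the
direction given by `α` on the moment curve, `(Sum.inr β, v)` for the `β`-th copy of the line
through the origin in direction `(1, v)`. -/
abbrev LineIndex (F : Type*) (m M : ℕ) : Type _ := (Fin M ⊕ Fin M) × (Fin m → F)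

/-- The numbering of the lines. -/
def lineEquiv (e : F ≃ Fin q) : LineIndex F m M ≃ Fin ((M + M) * q ^ m) :=
  (Equiv.prodCongr finSumFinEquiv
    ((Equiv.arrowCongr (Equiv.refl _) e).trans finFunctionFinEquiv)).trans finProdFinEquiv

/-- A sequence of coins determines a line and a point of this line. -/
def seedEquiv (e : F ≃ Fin q) (hr : (M + M) * q ^ m * q = 2 ^ r) :
    (Fin r → Bool) ≃ LineIndex F m M × F :=
  ((coinEquiv r).trans (finCongr hr.symm)).trans <|
    finProdFinEquiv.symm.trans (Equiv.prodCongr (lineEquiv e).symm e.symm)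

/-- The point with parameter `a` of a line. -/
def linePoint (c : Fin M → F) : LineIndex F m M → F → Fin (m + 1) → F
  | (Sum.inl α, v), a => (Fin.cons 0 v : Fin (m + 1) → F) + a • momentCurve F (m + 1) (c α)
  | (Sum.inr _, v), a => a • (Fin.cons 1 v : Fin (m + 1) → F)

open Classical in
/-- The verifier that compares the table with the proof at a random point of a random line. -/
noncomputable abbrev linePointVerifier (e : F ≃ Fin q) (c : Fin M → F) (d t : ℕ)
    (hr : (M + M) * q ^ m * q = 2 ^ r) : Verifier F (m + 1) d t where
  coins := r
  proofLen := (M + M) * q ^ m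
  query ρ i := if i = 0 then
      Sum.inl (linePoint c (seedEquiv e hr ρ).1 (seedEquiv e hr ρ).2)
    else Sum.inr (lineEquiv e (seedEquiv e hr ρ).1)
  verdict ρ ans :=
    match ans 0, ans 1 with
    | Sum.inl x, Sum.inr p => decide (∀ j, x j = coeffEval (p j) (seedEquiv e hr ρ).2)
    | _, _ => false

variable {e : F ≃ Fin q} {c : Fin M → F} {hr : (M + M) * q ^ m * q = 2 ^ r}

open Classical in
theorem linePointVerifier_accepts_iff (T : Table F (m + 1) t)
    (π : Fin ((M + M) * q ^ m) → Fin t → Fin (d + 1) → F) (ρ : Fin r → Bool) :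
    (linePointVerifier e c d t hr).Accepts T π ρ ↔
      T (linePoint c (seedEquiv e hr ρ).1 (seedEquiv e hr ρ).2) =
        fun j => coeffEval (π (lineEquiv e (seedEquiv e hr ρ).1) j) (seedEquiv e hr ρ).2 := by
  rw [funext_iff]
  exact decide_eq_true_iff

theorem linePoint_eq_add_smul (c : Fin M → F) (l : LineIndex F m M) :
    ∃ b v : Fin (m + 1) → F, ∀ a, linePoint c l a = b + a • v := by
  obtain ⟨α | β, v⟩ := l
  · exact ⟨_, _, fun a => rfl⟩
  · exact ⟨0, Fin.cons 1 v, fun a => (zero_add _).symm⟩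

theorem linePointVerifier_complete {T : Table F (m + 1) t}
    (hT : T ∈ parallelRM F (m + 1) d t) :
    ∃ π : (linePointVerifier e c d t hr).Proof,
      ∀ ρ, (linePointVerifier e c d t hr).Accepts T π ρ := by
  have h : ∀ (l : LineIndex F m M) (j : Fin t), ∃ s : Fin (d + 1) → F,
      ∀ a, T (linePoint c l a) j = coeffEval s a := by
    intro l j
    obtain ⟨p, hp, hpe⟩ := hT j
    obtain ⟨b, v, hbv⟩ := linePoint_eq_add_smul c l
    refine PolyDeg.exists_coeffEval ?_
    simp only [hpe, hbv]
    exact polyDeg_eval_line hp b v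
  choose s hs using h
  refine ⟨fun i => s ((lineEquiv e).symm i), fun ρ => ?_⟩
  refine (linePointVerifier_accepts_iff _ _ _).2 ?_
  ext j
  rw [hs, Equiv.symm_apply_apply]

theorem linePointVerifier_rejectProb [Fintype F] [DecidableEq F] (T : Table F (m + 1) t)
    (π : Fin ((M + M) * q ^ m) → Fin t → Fin (d + 1) → F) :
    (linePointVerifier e c d t hr).rejectProb T π * 2 ^ r =
      (Finset.univ.filter fun s : LineIndex F m M × F => T (linePoint c s.1 s.2) ≠
        fun j => coeffEval (π (lineEquiv e s.1) j) s.2).card := by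
  classical
  have h := card_filter_eq_prOn_mul Finset.univ
    fun ρ => ¬ (linePointVerifier e c d t hr).Accepts T π ρ
  rw [Verifier.rejectProb]
  have h2 : ((Finset.univ : Finset (Fin (linePointVerifier e c d t hr).coins → Bool)).card : ℝ) =
      2 ^ r := by
    rw [Finset.card_univ, Fintype.card_fun, Fintype.card_bool, Fintype.card_fin]
    norm_cast
  rw [h2] at h
  rw [← h, Nat.cast_inj]
  refine Finset.card_equiv (seedEquiv e hr) fun ρ => ?_
  simp only [Finset.mem_filter, Finset.mem_univ, true_and]
  exact not_congr (linePointVerifier_accepts_iff T π ρ)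

/-- The coordinates on `F^(m+1)` given by the lines in a direction with first coordinate `1`. -/
def shearEquiv (v : Fin (m + 1) → F) (hv : v 0 = 1) : (Fin m → F) × F ≃ (Fin (m + 1) → F) where
  toFun s := (Fin.cons 0 s.1 : Fin (m + 1) → F) + s.2 • v
  invFun x := (fun i => x i.succ - x 0 * v i.succ, x 0)
  left_inv s := by ext <;> simp [hv]
  right_inv x := by
    ext i
    refine Fin.cases ?_ (fun i => ?_) i
    · simp [hv]
    · simp

theorem momentCurve_zero (m : ℕ) (c : F) : momentCurve F (m + 1) c 0 = 1 := by
  simp [momentCurve]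

/-- The oracle for the direction `α` that a proof provides. -/
def proofOracle (c : Fin M → F) (π : LineIndex F m M → Fin t → Fin (d + 1) → F) (α : Fin M)
    (x : Fin (m + 1) → F) : Fin t → F := fun j =>
  coeffEval (π (Sum.inl α,
    ((shearEquiv _ (momentCurve_zero m (c α))).symm x).1) j) (x 0)

/-- Moving along the direction leaves the base point in the hyperplane fixed; only the argument of
the polynomial is translated. -/
theorem dirDeg_proofOracle (c : Fin M → F) (π : LineIndex F m M → Fin t → Fin (d + 1) → F)
    (α : Fin M) : DirDeg d (momentCurve F (m + 1) (c α)) (proofOracle c π α) := by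
  intro x j
  have h1 : ∀ a : F, ((shearEquiv _ (momentCurve_zero m (c α))).symm
      (x + a • momentCurve F (m + 1) (c α))).1 =
      ((shearEquiv _ (momentCurve_zero m (c α))).symm x).1 := by
    intro a
    ext i
    simp only [shearEquiv, Equiv.coe_fn_symm_mk, Pi.add_apply, Pi.smul_apply, smul_eq_mul,
      momentCurve_zero]
    ring
  simp only [proofOracle, h1, Pi.add_apply, Pi.smul_apply, momentCurve_zero, smul_eq_mul, mul_one]
  exact (polyDeg_coeffEval _).comp_add (x 0)

theorem linePointVerifier_sound [Fintype F] (hc : Function.Injective c) (e : F ≃ Fin q)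
    (hd : 6 * ((m + 1) * d) ≤ Fintype.card F) (hq : 2 ^ 10 ≤ Fintype.card F)
    (hM : 2 ^ 50 * (m + 1) ≤ M) (hr : (M + M) * q ^ m * q = 2 ^ r) {T : Table F (m + 1) t} {δ : ℝ}
    (hT : IsFar δ T (parallelRM F (m + 1) d t)) (π : Fin ((M + M) * q ^ m) → Fin t → Fin (d + 1) → F) :
    (1 / 2 ^ 40) * δ ≤ (linePointVerifier e c d t hr).rejectProb T π := by
  classical
  by_contra hcon
  rw [not_le] at hcon
  have hqF : q = Fintype.card F := by rw [Fintype.card_congr e, Fintype.card_fin]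
  have hnn : 0 ≤ (linePointVerifier e c d t hr).rejectProb T π := prOn_nonneg _ _
  have hδ : 0 < δ := by linarith
  have hδ1 := le_one_of_isFar hT
  have hM0 : 0 < M := lt_of_lt_of_le (by positivity) hM
  have hMR : (0 : ℝ) < M := by exact_mod_cast hM0
  have hV0 : (0 : ℝ) < (Fintype.card F : ℝ) ^ (m + 1) := by
    have : (0 : ℝ) < Fintype.card F := by exact_mod_cast Fintype.card_pos
    positivity
  have h2r : (2 : ℝ) ^ r = 2 * M * Fintype.card F ^ (m + 1) := by
    have : ((M + M) * Fintype.card F ^ m * Fintype.card F : ℝ) = 2 ^ r := by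
      rw [← hqF]
      exact_mod_cast hr
    rw [← this]
    ring
  have hrej := linePointVerifier_rejectProb (e := e) (c := c) (hr := hr) T π
  set π' : LineIndex F m M → Fin t → Fin (d + 1) → F := fun l => π (lineEquiv e l) with hπ'
  set N : Fin M → ℕ := fun β => (Finset.univ.filter fun s : F × (Fin m → F) =>
      T (s.1 • (Fin.cons 1 s.2 : Fin (m + 1) → F)) ≠
        fun j => coeffEval (π' (Sum.inr β, s.2) j) s.1).card with hN
  -- In shear coordinates, the pairs of a base point and a parameter run once through the space for
  -- each direction. The other half consists of `M` independent copies of the ray test, which gives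
  -- both tests equal weight.
  have hsplit : (Finset.univ.filter fun s : LineIndex F m M × F => T (linePoint c s.1 s.2) ≠
        fun j => coeffEval (π (lineEquiv e s.1) j) s.2).card =
      ∑ α, diffCount T (proofOracle c π' α) + ∑ β, N β := by
    rw [Finset.card_filter, Fintype.sum_prod_type, Fintype.sum_prod_type, Fintype.sum_sum_type]
    congr 1
    · refine Finset.sum_congr rfl fun α _ => ?_
      rw [diffCount, Finset.card_filter, ← Fintype.sum_prod_type']
      refine Fintype.sum_equiv (shearEquiv _ (momentCurve_zero m (c α))) _ _ fun s => ?_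
      have h0 : (shearEquiv _ (momentCurve_zero m (c α)) s) 0 = s.2 := by
        simp [shearEquiv, momentCurve_zero]
      have h1 : proofOracle c π' α (shearEquiv _ (momentCurve_zero m (c α)) s) =
          fun j => coeffEval (π' (Sum.inl α, s.1) j) s.2 := by
        ext j
        simp only [proofOracle, Equiv.symm_apply_apply, h0]
      rw [h1]
      rfl
    · refine Finset.sum_congr rfl fun β _ => ?_
      simp only [hN]
      rw [Finset.card_filter, Fintype.sum_prod_type_right]
      rfl
  have hlt : ((∑ α, diffCount T (proofOracle c π' α) + ∑ β, N β : ℕ) : ℝ) <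
      1 / 2 ^ 40 * δ * (2 * M * Fintype.card F ^ (m + 1)) := by
    rw [← hsplit, ← hrej, h2r]
    exact mul_lt_mul_of_pos_right hcon (by positivity)
  push_cast at hlt
  have hN0 : (0 : ℝ) ≤ ∑ β, (N β : ℝ) := Finset.sum_nonneg fun _ _ => Nat.cast_nonneg _
  have hD0 : (0 : ℝ) ≤ ∑ α, (diffCount T (proofOracle c π' α) : ℝ) :=
    Finset.sum_nonneg fun _ _ => Nat.cast_nonneg _
  have hMV : (0 : ℝ) < M * Fintype.card F ^ (m + 1) := by positivity
  have hδMV : δ * (M * Fintype.card F ^ (m + 1)) ≤ M * Fintype.card F ^ (m + 1) := by nlinarith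
  -- The proof may treat the copies of a ray differently; by averaging, one copy fails on less than
  -- half of the pairs, and that copy supplies `u`.
  obtain ⟨β, -, hβ⟩ : ∃ β ∈ (Finset.univ : Finset (Fin M)),
      2 * (N β : ℝ) < Fintype.card F ^ (m + 1) := by
    refine Finset.exists_lt_of_sum_lt ?_
    rw [← Finset.mul_sum, Finset.sum_const, Finset.card_univ, Fintype.card_fin, nsmul_eq_mul]
    linarith
  have hsum : (2 : ℝ) ^ 30 * ∑ α, (diffCount T (proofOracle c π' α) : ℝ) <
      M * Fintype.card F ^ (m + 1) := by linarith
  obtain ⟨T', hT', hTT'⟩ := exists_parallelRM_of_close (τ := 1 / 2 ^ 50) hd hq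
    (charBound_momentCurve hc (by
      rw [Fintype.card_fin]
      have : (2 : ℝ) ^ 50 * (m + 1 : ℕ) ≤ M := by exact_mod_cast hM
      linarith)) (by norm_num) le_rfl (f := T) (G := proofOracle c π')
    (dirDeg_proofOracle c π') (by rw [Fintype.card_fin]; exact_mod_cast hsum)
    (u := fun w a j => coeffEval (π' (Sum.inr β, w) j) a)
    (fun w j => polyDeg_coeffEval _) (by exact_mod_cast hβ.le)
  rw [Fintype.card_fin] at hTT'
  have hTT'' : (M : ℝ) * diffCount T T' ≤
      2 ^ 20 * ∑ α, (diffCount T (proofOracle c π' α) : ℝ) := by exact_mod_cast hTT'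
  rw [← relDist_mul_card] at hTT''
  have h1 := mul_le_mul_of_nonneg_right (hT T' hT') hMV.le
  have h2 : 0 < δ * (M * Fintype.card F ^ (m + 1)) := by positivity
  linarith

end LinePoint
end ParallelLDT

namespace ParallelLDT

/-! ### Cost calculus and registers. -/

section CostBound

theorem size_opApply_le (o : Op) (a b : ℕ) : (o.apply a b).size ≤ a.size + b.size + 1 := by
  have ha : a < 2 ^ a.size := Nat.lt_size_self a
  have hb : b < 2 ^ b.size := Nat.lt_size_self b
  have hpa : 2 ^ a.size ≤ 2 ^ (a.size + b.size) := Nat.pow_le_pow_right two_pos (by omega)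
  have hpb : 2 ^ b.size ≤ 2 ^ (a.size + b.size) := Nat.pow_le_pow_right two_pos (by omega)
  rw [Nat.size_le, pow_succ]
  cases o
  · change a + b < _
    omega
  · change a - b < _
    omega
  · change a * b < _
    have := Nat.mul_lt_mul'' ha hb
    rw [← pow_add] at this
    omega
  · change a / b < _
    have := Nat.div_le_self a b
    omega
  · change a % b < _
    have := Nat.mod_le a b
    omega

/-- A bound for the number of digits of the value of an expression, relative to the number of
digits of the cells of the memory. -/
def Expr.growth : Expr → ℕ
  | .const n => n.size
  | .load _ => 1
  | .op _ a b => a.growth + b.growth + 1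

theorem Expr.size_eval_le {M : ℕ → ℕ} {b : ℕ} (hb : 1 ≤ b) (hM : ∀ i, M i < 2 ^ b) (x : Expr) :
    (x.eval M).size ≤ x.growth * b := by
  induction x with
  | const n => exact Nat.le_mul_of_pos_right _ hb
  | load a _ =>
    rw [growth, one_mul, Nat.size_le]
    exact hM _
  | op o x y hx hy =>
    refine (size_opApply_le _ _ _).trans ?_
    rw [growth, add_mul, add_mul]
    omega

/-- A bound for the cost of evaluating an expression, relative to the number of digits of the cells
of the memory. -/
def Expr.weight : Expr → ℕ
  | .const n => 1 + n.size
  | .load a => 2 + a.weight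
  | .op _ a b => 2 + a.weight + b.weight + a.growth + b.growth

theorem Expr.cost_le {M : ℕ → ℕ} {b : ℕ} (hb : 1 ≤ b) (hM : ∀ i, M i < 2 ^ b) (x : Expr) :
    x.cost M ≤ x.weight * b := by
  induction x with
  | const n => exact Nat.le_mul_of_pos_right _ hb
  | load a ha =>
    have : (M (a.eval M)).size ≤ b := Nat.size_le.2 (hM _)
    rw [weight, add_mul, cost]
    omega
  | op o x y hx hy =>
    have := size_opApply_le o (x.eval M) (y.eval M)
    have h1 := x.size_eval_le hb hM
    have h2 := y.size_eval_le hb hM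
    rw [weight, cost]
    simp only [add_mul]
    omega

/-- A bound for the cost of one pass through a program, relative to the number of digits of the
cells of the memory. -/
def Prog.weight : Prog → ℕ
  | .skip => 1
  | .assign a b => 1 + a.weight + b.weight
  | .seq p q => 1 + p.weight + q.weight
  | .ite c p q => 1 + c.weight + p.weight + q.weight
  | .loop c p => 1 + c.weight + p.weight

end CostBound

section Registers

instance : Add Expr := ⟨Expr.op .add⟩
instance : Sub Expr := ⟨Expr.op .sub⟩
instance : Mul Expr := ⟨Expr.op .mul⟩
instance : Div Expr := ⟨Expr.op .div⟩
instance : Mod Expr := ⟨Expr.op .mod⟩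

variable (M : ℕ → ℕ) (x y : Expr) (n : ℕ)

@[simp] theorem Expr.eval_add : (x + y).eval M = x.eval M + y.eval M := rfl
@[simp] theorem Expr.eval_sub : (x - y).eval M = x.eval M - y.eval M := rfl
@[simp] theorem Expr.eval_mul : (x * y).eval M = x.eval M * y.eval M := rfl
@[simp] theorem Expr.eval_div : (x / y).eval M = x.eval M / y.eval M := rfl
@[simp] theorem Expr.eval_mod : (x % y).eval M = x.eval M % y.eval M := rfl
@[simp] theorem Expr.eval_const : (Expr.const n).eval M = n := rfl
@[simp] theorem Expr.eval_load : (Expr.load x).eval M = M (x.eval M) := rfl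

/-- The address of the first cell that is used as a register. -/
def regBase (w : ℕ → ℕ) : ℕ := (w 0 + w 3) * ((w 0 + w 3) * (w 0 + w 3))

/-- The memory with the input `w` and the registers `s`. -/
def regMem (w s : ℕ → ℕ) : ℕ → ℕ := fun i => if i < regBase w then w i else s (i - regBase w)

/-- The address of the register `c`. -/
def regAddr (c : ℕ) : Expr :=
  (Expr.load (.const 0) + .load (.const 3)) * ((Expr.load (.const 0) + .load (.const 3)) *
    (Expr.load (.const 0) + .load (.const 3))) + .const c

/-- The content of the register `c`. -/
def reg (c : ℕ) : Expr := .load (regAddr c)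

/-- Store a value in the register `c`. -/
def setReg (c : ℕ) (x : Expr) : Prog := .assign (regAddr c) x

/-- Inputs that are compatible with registers of `b` bits. -/
structure IsInput (w : ℕ → ℕ) (b : ℕ) : Prop where
  pos : 1 ≤ b
  base : 3 < regBase w
  lt : ∀ i, w i < 2 ^ b

variable {w s : ℕ → ℕ} {b : ℕ}

theorem regMem_of_lt {i : ℕ} (hi : i < regBase w) : regMem w s i = w i := if_pos hi

theorem IsInput.regMem_lt (hw : IsInput w b) (hs : ∀ i, s i < 2 ^ b) (i : ℕ) :
    regMem w s i < 2 ^ b := by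
  unfold regMem
  split_ifs
  exacts [hw.lt i, hs _]

theorem IsInput.eval_regAddr (hw : IsInput w b) (c : ℕ) :
    (regAddr c).eval (regMem w s) = regBase w + c := by
  have h0 : regMem w s 0 = w 0 := regMem_of_lt (by have := hw.base; omega)
  have h3 : regMem w s 3 = w 3 := regMem_of_lt hw.base
  simp [regAddr, h0, h3, regBase]

theorem IsInput.eval_reg (hw : IsInput w b) (c : ℕ) : (reg c).eval (regMem w s) = s c := by
  rw [reg, Expr.eval_load, hw.eval_regAddr, regMem, if_neg (by omega), Nat.add_sub_cancel_left]

theorem regMem_update (c v : ℕ) :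
    Function.update (regMem w s) (regBase w + c) v = regMem w (Function.update s c v) := by
  ext i
  by_cases hi : i < regBase w
  · rw [Function.update_of_ne (by omega), regMem_of_lt hi, regMem_of_lt hi]
  · by_cases hc : i = regBase w + c
    · subst hc
      simp [regMem]
    · rw [Function.update_of_ne hc, regMem, regMem, if_neg hi, if_neg hi,
        Function.update_of_ne (by omega)]

end Registers

section Programs

/-- Started with the input `w` and registers `s` of `b` bits, the program halts with registers of
`b` bits that satisfy `Q`, and no part of it is executed more than `N` times. -/
def Reaches (w : ℕ → ℕ) (b N : ℕ) (p : Prog) (s : ℕ → ℕ) (Q : (ℕ → ℕ) → Prop) : Prop :=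
  (∀ i, s i < 2 ^ b) → ∃ (s' : ℕ → ℕ) (k : ℕ), (∀ i, s' i < 2 ^ b) ∧ Q s' ∧
    p.Runs (regMem w s) (regMem w s') k ∧ k ≤ p.weight * (b * N)

variable {w s : ℕ → ℕ} {b N : ℕ} {p p' : Prog} {Q : (ℕ → ℕ) → Prop}

theorem Reaches.mono_count {N' : ℕ} (h : Reaches w b N p s Q) (hN : N ≤ N') :
    Reaches w b N' p s Q := by
  intro hs
  obtain ⟨s', k, h1, h2, h3, h4⟩ := h hs
  exact ⟨s', k, h1, h2, h3, h4.trans (by gcongr)⟩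

theorem IsInput.cost_le (hw : IsInput w b) (hN : 0 < N) (hs : ∀ i, s i < 2 ^ b) (x : Expr) :
    x.cost (regMem w s) ≤ x.weight * (b * N) :=
  (x.cost_le hw.pos (hw.regMem_lt hs)).trans
    (Nat.mul_le_mul_left _ (Nat.le_mul_of_pos_right _ hN))

theorem Reaches.skip (hw : IsInput w b) (hN : 0 < N) (hQ : Q s) : Reaches w b N .skip s Q :=
  fun hs => ⟨s, 1, hs, hQ, .skip _, by
    have := Nat.mul_pos hw.pos hN
    rw [Prog.weight]
    omega⟩

theorem Reaches.setReg (hw : IsInput w b) (hN : 0 < N) (c : ℕ) (x : Expr)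
    (hx : x.eval (regMem w s) < 2 ^ b) (hQ : Q (Function.update s c (x.eval (regMem w s)))) :
    Reaches w b N (setReg c x) s Q := by
  intro hs
  refine ⟨_, 1 + (regAddr c).cost (regMem w s) + x.cost (regMem w s), fun i => ?_, hQ, ?_, ?_⟩
  · rw [Function.update_apply]
    split_ifs
    exacts [hx, hs i]
  · rw [← regMem_update, ← hw.eval_regAddr (s := s)]
    exact .assign _ _ _
  · have h1 := hw.cost_le hN hs (regAddr c)
    have h2 := hw.cost_le hN hs x
    have := Nat.mul_pos hw.pos hN
    rw [ParallelLDT.setReg, Prog.weight]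
    simp only [add_mul]
    omega

theorem Reaches.seq (hw : IsInput w b) (hN : 0 < N)
    (h : Reaches w b N p s fun s' => Reaches w b N p' s' Q) : Reaches w b N (.seq p p') s Q := by
  intro hs
  obtain ⟨s₁, k, hs₁, h₁, hr₁, hk⟩ := h hs
  obtain ⟨s₂, l, hs₂, h₂, hr₂, hl⟩ := h₁ hs₁
  refine ⟨s₂, _, hs₂, h₂, .seq hr₁ hr₂, ?_⟩
  have := Nat.mul_pos hw.pos hN
  rw [Prog.weight]
  simp only [add_mul]
  omega

theorem Reaches.ite (hw : IsInput w b) (hN : 0 < N) {c : Expr}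
    (h : c.eval (regMem w s) ≠ 0 → Reaches w b N p s Q)
    (h' : c.eval (regMem w s) = 0 → Reaches w b N p' s Q) : Reaches w b N (.ite c p p') s Q := by
  intro hs
  have := Nat.mul_pos hw.pos hN
  have hc := hw.cost_le hN hs c
  by_cases h0 : c.eval (regMem w s) = 0
  · obtain ⟨s₁, k, hs₁, h₁, hr₁, hk⟩ := h' h0 hs
    refine ⟨s₁, _, hs₁, h₁, .iteFalse h0 hr₁, ?_⟩
    rw [Prog.weight]
    simp only [add_mul]
    omega
  · obtain ⟨s₁, k, hs₁, h₁, hr₁, hk⟩ := h h0 hs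
    refine ⟨s₁, _, hs₁, h₁, .iteTrue h0 hr₁, ?_⟩
    rw [Prog.weight]
    simp only [add_mul]
    omega

/-- A loop with invariant `I i` after `i` passes. -/
theorem Reaches.loop (hw : IsInput w b) (hN : 0 < N) {c : Expr} {T N' : ℕ}
    (I : ℕ → (ℕ → ℕ) → Prop) (h0 : I 0 s) (hT : (T + 1) * N ≤ N')
    (hstep : ∀ i < T, ∀ s, I i s → c.eval (regMem w s) ≠ 0 ∧ Reaches w b N p s (I (i + 1)))
    (hend : ∀ s, I T s → c.eval (regMem w s) = 0 ∧ Q s) :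
    Reaches w b N' (.loop c p) s Q := by
  have hpos := Nat.mul_pos hw.pos hN
  -- With `j` passes left, the guard is evaluated `j + 1` times, the last time to leave the loop;
  -- hence the factor `T + 1`.
  have key : ∀ j i s, i + j = T → I i s → (∀ i, s i < 2 ^ b) → ∃ (s' : ℕ → ℕ) (k : ℕ),
      (∀ i, s' i < 2 ^ b) ∧ Q s' ∧ (Prog.loop c p).Runs (regMem w s) (regMem w s') k ∧
        k ≤ (j + 1) * ((1 + c.weight + p.weight) * (b * N)) := by
    intro j
    induction j with
    | zero =>
      intro i s hi hI hs
      obtain rfl : i = T := hi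
      obtain ⟨hc, hQ⟩ := hend s hI
      refine ⟨s, _, hs, hQ, .loopDone hc, ?_⟩
      have := hw.cost_le hN hs c
      simp only [add_mul]
      omega
    | succ j ih =>
      intro i s hi hI hs
      obtain ⟨hc, hb⟩ := hstep i (by omega) s hI
      obtain ⟨s₁, k, hs₁, h₁, hr₁, hk⟩ := hb hs
      obtain ⟨s₂, l, hs₂, h₂, hr₂, hl⟩ := ih (i + 1) s₁ (by omega) h₁ hs₁
      refine ⟨s₂, _, hs₂, h₂, .loopStep hc hr₁ hr₂, ?_⟩
      have := hw.cost_le hN hs c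
      rw [add_mul (j + 1), one_mul]
      refine le_trans ?_ (Nat.add_le_add_right hl _)
      simp only [add_mul]
      omega
  intro hs
  obtain ⟨s', k, h1, h2, h3, h4⟩ := key T 0 s (zero_add T) h0 hs
  refine ⟨s', k, h1, h2, h3, h4.trans ?_⟩
  calc (T + 1) * ((1 + c.weight + p.weight) * (b * N))
      = (1 + c.weight + p.weight) * (b * ((T + 1) * N)) := by ring
    _ ≤ _ := by rw [Prog.weight]; gcongr

end Programs
end ParallelLDT

namespace ParallelLDT

/-! ### Reading the parameters and the coins. -/

section Seed
variable {F : Type*} [Field F] {q m d t r b N : ℕ}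

/-- The content of the input cell `i`. -/
def inp (i : ℕ) : Expr := .load (.const i)

/-- Addition by table lookup. -/
def addExpr (x y : Expr) : Expr := .load (.const 4 + inp 0 * x + y)

/-- Multiplication by table lookup. -/
def mulExpr (x y : Expr) : Expr := .load (.const 4 + inp 0 * inp 0 + inp 0 * x + y)

/-- The coin number `x`. -/
def coinExpr (x : Expr) : Expr := .load (.const 4 + inp 0 * inp 0 + inp 0 * inp 0 + x)

/-- The first cells of `w` hold the parameters, the tables of the field and the coins. -/
structure IsSeedInput (e : F ≃ Fin q) (m d t : ℕ) (ρ : Fin r → Bool) (w : ℕ → ℕ) (b : ℕ) : Prop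
    extends IsInput w b where
  card : w 0 = q
  dim : w 1 = m
  deg : w 2 = d
  width : w 3 = t
  add : ∀ x y, w (4 + q * e x + e y) = e (x + y)
  mul : ∀ x y, w (4 + q * q + q * e x + e y) = e (x * y)
  coin : ∀ i : Fin r, w (4 + q * q + q * q + i) = (ρ i).toNat
  le_base : 4 + q * q + q * q + r + t + t * (d + 1) ≤ regBase w

variable {e : F ≃ Fin q} {ρ : Fin r → Bool} {w s : ℕ → ℕ}

theorem IsSeedInput.eval_inp (h : IsSeedInput e m d t ρ w b) {i : ℕ} (hi : i < 4) :
    (inp i).eval (regMem w s) = w i :=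
  regMem_of_lt (hi.trans_le h.base)

theorem mul_add_lt {q : ℕ} (x y : Fin q) : q * x + y < q * q := by
  have hx := x.2
  have := Nat.mul_le_mul_left q (Nat.succ_le_of_lt hx)
  rw [Nat.mul_succ] at this
  omega

theorem IsSeedInput.eval_addExpr (h : IsSeedInput e m d t ρ w b) {x y : Expr} {u v : F}
    (hx : x.eval (regMem w s) = e u) (hy : y.eval (regMem w s) = e v) :
    (addExpr x y).eval (regMem w s) = e (u + v) := by
  have h1 := mul_add_lt (e u) (e v)
  have h2 := h.le_base
  rw [← h.add, addExpr]
  simp only [Expr.eval_load, Expr.eval_add, Expr.eval_const, Expr.eval_mul, hx, hy,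
    h.eval_inp (show 0 < 4 by norm_num), h.card]
  exact regMem_of_lt (by omega)

theorem IsSeedInput.eval_mulExpr (h : IsSeedInput e m d t ρ w b) {x y : Expr} {u v : F}
    (hx : x.eval (regMem w s) = e u) (hy : y.eval (regMem w s) = e v) :
    (mulExpr x y).eval (regMem w s) = e (u * v) := by
  have h1 := mul_add_lt (e u) (e v)
  have h2 := h.le_base
  rw [← h.mul, mulExpr]
  simp only [Expr.eval_load, Expr.eval_add, Expr.eval_const, Expr.eval_mul, hx, hy,
    h.eval_inp (show 0 < 4 by norm_num), h.card]
  exact regMem_of_lt (by omega)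

theorem IsSeedInput.eval_coinExpr (h : IsSeedInput e m d t ρ w b) {x : Expr} {i : ℕ} (hi : i < r)
    (hx : x.eval (regMem w s) = i) :
    (coinExpr x).eval (regMem w s) = (ρ ⟨i, hi⟩).toNat := by
  have h2 := h.le_base
  rw [← h.coin, coinExpr]
  simp only [Expr.eval_load, Expr.eval_add, Expr.eval_const, Expr.eval_mul, hx,
    h.eval_inp (show 0 < 4 by norm_num), h.card]
  exact regMem_of_lt (by omega)

/-- The number encoded by the first `i` digits of `f`. -/
def digitSum {n q : ℕ} (f : Fin n → Fin q) (i : ℕ) : ℕ :=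
  ∑ j ∈ Finset.range i, if h : j < n then f ⟨j, h⟩ * q ^ j else 0

theorem digitSum_succ {n q : ℕ} (f : Fin n → Fin q) {i : ℕ} (hi : i < n) :
    digitSum f (i + 1) = digitSum f i + f ⟨i, hi⟩ * q ^ i := by
  rw [digitSum, Finset.sum_range_succ, dif_pos hi, digitSum]

theorem digitSum_lt {n q : ℕ} (f : Fin n → Fin q) {i : ℕ} (hi : i ≤ n) :
    digitSum f i < q ^ i := by
  induction i with
  | zero => simp [digitSum]
  | succ i ih =>
    have h := ih (by omega)
    have := Nat.mul_le_mul_right (q ^ i) (Nat.succ_le_of_lt (f ⟨i, hi⟩).2)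
    rw [Nat.succ_mul] at this
    rw [digitSum_succ f hi, pow_succ, mul_comm (q ^ i)]
    omega

theorem digitSum_eq {n q : ℕ} (f : Fin n → Fin q) :
    digitSum f n = (finFunctionFinEquiv f : Fin (q ^ n)) := by
  rw [digitSum, Finset.sum_range, finFunctionFinEquiv_apply]
  exact Finset.sum_congr rfl fun i _ => dif_pos i.2

/-- The number encoded by the first `i` coins. -/
def coinSum (ρ : Fin r → Bool) (i : ℕ) : ℕ := digitSum (fun j => finTwoEquiv.symm (ρ j)) i

theorem coinSum_eq (ρ : Fin r → Bool) : coinSum ρ r = (coinEquiv r ρ : Fin (2 ^ r)).val :=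
  digitSum_eq _

theorem coinSum_succ (ρ : Fin r → Bool) {i : ℕ} (hi : i < r) :
    coinSum ρ (i + 1) = coinSum ρ i + 2 ^ i * (ρ ⟨i, hi⟩).toNat := by
  rw [coinSum, digitSum_succ _ hi, mul_comm]
  congr 2
  cases ρ ⟨i, hi⟩ <;> rfl

/-- Compute the number `2^k` of lines through a point, in the register `0`. -/
def blockProg : Prog :=
  .seq (setReg 0 (.const 1)) (.loop (.const (2 ^ 50) * inp 1 - reg 0) (setReg 0 (reg 0 * .const 2)))

/-- Compute `q^m` in the register `1`. -/
def sizeProg : Prog :=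
  .seq (setReg 1 (.const 1)) <| .seq (setReg 3 (.const 0)) <|
    .loop (inp 1 - reg 3) (.seq (setReg 1 (reg 1 * inp 0)) (setReg 3 (reg 3 + .const 1)))

/-- Count the coins in the register `3`, and compute their number in the register `4`. -/
def coinProg : Prog :=
  .seq (setReg 2 (.const 1)) <| .seq (setReg 3 (.const 0)) <| .seq (setReg 4 (.const 0)) <|
    .loop (.const 2 * reg 0 * reg 1 - reg 2) <| .seq (setReg 4 (reg 4 + reg 2 * coinExpr (reg 3))) <|
      .seq (setReg 2 (reg 2 * .const 2)) (setReg 3 (reg 3 + .const 1))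

/-- Evaluate the parameters and the coins. -/
def seedProg : Prog := .seq blockProg (.seq sizeProg coinProg)

/-- The data of a run: there are `2 * 2^k * q^m = 2^r` outcomes of the coins. -/
structure IsSeedSize (q m r k b N : ℕ) : Prop where
  le_pow : 2 ^ 50 * m ≤ 2 ^ k
  lt_of_lt : ∀ i < k, 2 ^ i < 2 ^ 50 * m
  pow_eq : 2 * 2 ^ k * q ^ m = 2 ^ r
  r_lt : r < b
  k_lt : k < N
  m_lt : m < N
  r_lt_count : r < N
  card_pos : 0 < q

variable {k : ℕ} {Q : (ℕ → ℕ) → Prop}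

theorem IsSeedSize.pow_lt (hk : IsSeedSize q m r k b N) : 2 ^ r < 2 ^ b :=
  Nat.pow_lt_pow_right (by norm_num) hk.r_lt

/-- Truncated subtraction acts as a comparison: the guard is nonzero exactly while the register is
below `2^50 * m`, so doubling stops at the right power of two. -/
theorem reaches_blockProg (h : IsSeedInput e m d t ρ w b) (hk : IsSeedSize q m r k b N)
    (hQ : ∀ s, s 0 = 2 ^ k → Q s) : Reaches w b N blockProg s Q := by
  have hN : 0 < N := (Nat.zero_le _).trans_lt hk.k_lt
  have hb : 2 ^ k < 2 ^ b := by
    refine lt_of_le_of_lt ?_ hk.pow_lt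
    rw [← hk.pow_eq, mul_comm 2, mul_assoc]
    exact Nat.le_mul_of_pos_right _ (Nat.mul_pos two_pos (pow_pos hk.card_pos _))
  have hb1 : 1 < 2 ^ b := (Nat.one_le_two_pow (n := k)).trans_lt hb
  refine .seq h.1 hN (.setReg h.1 hN _ _ hb1 ?_)
  refine .loop (N := 1) (T := k) h.1 one_pos (fun i s => s 0 = 2 ^ i) (by simp)
    (by have := hk.k_lt; omega) (fun i hi s hs => ⟨?_, ?_⟩) fun s hs => ⟨?_, hQ s hs⟩
  · have := hk.lt_of_lt i hi
    simp only [Expr.eval_sub, Expr.eval_mul, h.1.eval_reg, Expr.eval_const,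
      h.eval_inp (show 1 < 4 by norm_num), h.dim, hs]
    omega
  · refine .setReg h.1 one_pos _ _ ?_ ?_
    · simp only [Expr.eval_mul, h.1.eval_reg, Expr.eval_const, hs]
      refine lt_of_le_of_lt ?_ hb
      rw [← pow_succ]
      exact Nat.pow_le_pow_right two_pos hi
    · simp only [Expr.eval_mul, h.1.eval_reg, Expr.eval_const, hs, Function.update_self, pow_succ]
  · have := hk.le_pow
    simp only [Expr.eval_sub, Expr.eval_mul, h.1.eval_reg, Expr.eval_const,
      h.eval_inp (show 1 < 4 by norm_num), h.dim, hs]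
    omega

theorem reaches_sizeProg (h : IsSeedInput e m d t ρ w b) (hk : IsSeedSize q m r k b N)
    (hQ : ∀ s', s' 0 = s 0 → s' 1 = q ^ m → Q s') : Reaches w b N sizeProg s Q := by
  have hN : 0 < N := (Nat.zero_le _).trans_lt hk.k_lt
  have hb : q ^ m < 2 ^ b := by
    refine lt_of_le_of_lt ?_ hk.pow_lt
    rw [← hk.pow_eq]
    exact Nat.le_mul_of_pos_left _ (by positivity)
  have hb1 : 1 < 2 ^ b := (Nat.one_le_pow _ _ hk.card_pos).trans_lt hb
  have hmb : m < 2 ^ b := h.dim ▸ h.lt 1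
  refine .seq h.1 hN (.setReg h.1 hN _ _ hb1 ?_)
  refine .seq h.1 hN (.setReg h.1 hN _ _ (by positivity) ?_)
  refine .loop (N := 1) (T := m) h.1 one_pos (fun i s' => s' 0 = s 0 ∧ s' 1 = q ^ i ∧ s' 3 = i)
    (by simp) (by have := hk.m_lt; omega) (fun i hi s' hs => ⟨?_, ?_⟩)
    fun s' hs => ⟨?_, hQ s' hs.1 hs.2.1⟩
  · simp only [Expr.eval_sub, h.1.eval_reg, h.eval_inp (show 1 < 4 by norm_num), h.dim, hs.2.2]
    omega
  · refine .seq h.1 one_pos (.setReg h.1 one_pos _ _ ?_ (.setReg h.1 one_pos _ _ ?_ ?_))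
    · simp only [Expr.eval_mul, h.1.eval_reg, h.eval_inp (show 0 < 4 by norm_num), h.card, hs.2.1,
        ← pow_succ]
      exact (Nat.pow_le_pow_right hk.card_pos hi).trans_lt hb
    · simp [h.1.eval_reg, hs.2.2]
      omega
    · simp [h.1.eval_reg, hs, h.eval_inp, h.card, pow_succ]
  · simp only [Expr.eval_sub, h.1.eval_reg, h.eval_inp (show 1 < 4 by norm_num), h.dim, hs.2.2]
    omega

/-- The number of coins is not among the parameters in the input. It is found by doubling until the
number of outcomes `2 * 2^k * q^m = 2^r` is reached. -/
theorem reaches_coinProg (h : IsSeedInput e m d t ρ w b) (hk : IsSeedSize q m r k b N)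
    (h0 : s 0 = 2 ^ k) (h1 : s 1 = q ^ m)
    (hQ : ∀ s', s' 0 = 2 ^ k → s' 1 = q ^ m → s' 3 = r → s' 4 = coinSum ρ r → Q s') :
    Reaches w b N coinProg s Q := by
  have hN : 0 < N := (Nat.zero_le _).trans_lt hk.k_lt
  have hb := hk.pow_lt
  have hrb : r < 2 ^ b := Nat.lt_two_pow_self.trans hb
  have hb1 : 1 < 2 ^ b := Nat.one_le_two_pow.trans_lt hb
  refine .seq h.1 hN (.setReg h.1 hN _ _ hb1 ?_)
  refine .seq h.1 hN (.setReg h.1 hN _ _ (by positivity) ?_)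
  refine .seq h.1 hN (.setReg h.1 hN _ _ (by positivity) ?_)
  refine .loop (N := 1) (T := r) h.1 one_pos (fun i s' => s' 0 = 2 ^ k ∧ s' 1 = q ^ m ∧
      s' 2 = 2 ^ i ∧ s' 3 = i ∧ s' 4 = coinSum ρ i)
    (by simp [h0, h1, coinSum, digitSum]) (by have := hk.r_lt_count; omega) (fun i hi s' hs => ⟨?_, ?_⟩)
    fun s' hs => ⟨?_, hQ s' hs.1 hs.2.1 hs.2.2.2.1 hs.2.2.2.2⟩
  · simp only [Expr.eval_sub, Expr.eval_mul, Expr.eval_const, h.1.eval_reg, hs, hk.pow_eq]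
    have := Nat.pow_lt_pow_right (a := 2) (by norm_num) hi
    omega
  · obtain ⟨hs0, hs1, hs2, hs3, hs4⟩ := hs
    have hv : (reg 4 + reg 2 * coinExpr (reg 3)).eval (regMem w s') = coinSum ρ (i + 1) := by
      rw [coinSum_succ ρ hi]
      simp only [Expr.eval_add, Expr.eval_mul, h.1.eval_reg, hs2, hs4,
        h.eval_coinExpr hi ((h.1.eval_reg 3).trans hs3)]
    have hp : 2 ^ (i + 1) < 2 ^ b := (Nat.pow_le_pow_right two_pos hi).trans_lt hb
    refine .seq h.1 one_pos (.setReg h.1 one_pos _ _ ?_ ?_)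
    · rw [hv]
      exact (digitSum_lt _ hi).trans hp
    · rw [hv]
      refine .seq h.1 one_pos (.setReg h.1 one_pos _ _ ?_ (.setReg h.1 one_pos _ _ ?_ ?_))
      · simpa [h.1.eval_reg, hs2, pow_succ] using hp
      · simp [h.1.eval_reg, hs3]
        omega
      · simp [h.1.eval_reg, hs0, hs1, hs2, hs3, pow_succ]
  · simp only [Expr.eval_sub, Expr.eval_mul, Expr.eval_const, h.1.eval_reg, hs, hk.pow_eq, tsub_self]

theorem reaches_seedProg (h : IsSeedInput e m d t ρ w b) (hk : IsSeedSize q m r k b N)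
    (hQ : ∀ s', s' 0 = 2 ^ k → s' 1 = q ^ m → s' 3 = r → s' 4 = coinSum ρ r → Q s') :
    Reaches w b N seedProg s Q := by
  have hN : 0 < N := (Nat.zero_le _).trans_lt hk.k_lt
  refine .seq h.1 hN (reaches_blockProg h hk fun s h0 => ?_)
  refine .seq h.1 hN (reaches_sizeProg h hk fun s' h0' h1 => ?_)
  exact reaches_coinProg h hk (h0'.trans h0) h1 hQ

end Seed
end ParallelLDT

namespace ParallelLDT

/-! ### Computing the query positions. -/

section Query
variable {F : Type*} [Field F] {q m d t r k b N : ℕ} {e : F ≃ Fin q} {ρ : Fin r → Bool}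
  {w s : ℕ → ℕ} {Q : (ℕ → ℕ) → Prop}

theorem finProdFinEquiv_div {m n : ℕ} (x : Fin m × Fin n) :
    (finProdFinEquiv x : Fin (m * n)).val / n = x.1 := by
  have h := congrArg (fun y => (y.1 : ℕ)) (finProdFinEquiv.symm_apply_apply x)
  exact h

theorem finProdFinEquiv_mod {m n : ℕ} (x : Fin m × Fin n) :
    (finProdFinEquiv x : Fin (m * n)).val % n = x.2 := by
  have h := congrArg (fun y => (y.2 : ℕ)) (finProdFinEquiv.symm_apply_apply x)
  exact h

theorem finFunctionFinEquiv_div_mod {m n : ℕ} (f : Fin n → Fin m) (i : Fin n) :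
    (finFunctionFinEquiv f : Fin (m ^ n)).val / m ^ (i : ℕ) % m = f i := by
  rw [← finFunctionFinEquiv_symm_apply_val, Equiv.symm_apply_apply]

-- This unfolds `seedEquiv` as a mixed radix expansion, so that remainder and quotient by `q` read
-- off the point and the line.
omit [Field F] in
theorem coinEquiv_eq {M : ℕ} (hr : (M + M) * q ^ m * q = 2 ^ r) (ρ : Fin r → Bool) :
    (coinEquiv r ρ).val =
      (finProdFinEquiv (lineEquiv e (seedEquiv e hr ρ).1, e (seedEquiv e hr ρ).2)).val := by
  have h : (finProdFinEquiv (lineEquiv e (seedEquiv e hr ρ).1, e (seedEquiv e hr ρ).2)) =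
      finCongr hr.symm (coinEquiv r ρ) := by
    rw [← Equiv.eq_symm_apply]
    exact Prod.ext ((lineEquiv e).apply_symm_apply _) (e.apply_symm_apply _)
  rw [h]
  rfl

omit [Field F] in
theorem coinSum_mod {M : ℕ} (hr : (M + M) * q ^ m * q = 2 ^ r) (ρ : Fin r → Bool) :
    coinSum ρ r % q = e (seedEquiv e hr ρ).2 := by
  rw [coinSum_eq, coinEquiv_eq (e := e) hr, finProdFinEquiv_mod]

omit [Field F] in
theorem coinSum_div {M : ℕ} (hr : (M + M) * q ^ m * q = 2 ^ r) (ρ : Fin r → Bool) :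
    coinSum ρ r / q = lineEquiv e (seedEquiv e hr ρ).1 := by
  rw [coinSum_eq, coinEquiv_eq (e := e) hr, finProdFinEquiv_div]

omit [Field F] in
theorem lineEquiv_div {M : ℕ} (l : LineIndex F m M) :
    (lineEquiv e l).val / q ^ m = (finSumFinEquiv l.1).val :=
  finProdFinEquiv_div _

omit [Field F] in
theorem lineEquiv_mod {M : ℕ} (l : LineIndex F m M) :
    (lineEquiv e l).val % q ^ m = (finFunctionFinEquiv fun i => e (l.2 i)).val :=
  finProdFinEquiv_mod _

/-- The parameters on the moment curve: the field elements with the first numbers. -/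
def curveParam {M : ℕ} (e : F ≃ Fin q) (hM : M ≤ q) (α : Fin M) : F := e.symm (Fin.castLE hM α)

omit [Field F] in
theorem curveParam_injective {M : ℕ} (hM : M ≤ q) : Function.Injective (curveParam e hM) :=
  e.symm.injective.comp (Fin.castLE_injective hM)

/-- In both families the base point has first coordinate `0` and the direction `1`. The program can
therefore copy the parameter as coordinate zero. -/
theorem linePoint_zero {M : ℕ} (c : Fin M → F) (l : LineIndex F m M) (a : F) :
    linePoint c l a 0 = a := by
  obtain ⟨α | β, v⟩ := l
  · simp [linePoint, momentCurve]
  · simp [linePoint]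

/-- Compute one coordinate of the query to the table, in the register `12`. -/
def coordProg : Prog :=
  .ite (reg 0 - reg 7)
    (.seq (setReg 12 (addExpr (reg 12) (mulExpr (reg 5) (reg 11))))
      (setReg 11 (mulExpr (reg 11) (reg 7))))
    (setReg 12 (mulExpr (reg 5) (reg 12)))

/-- Compute the query to the table, in the register `9`. -/
def pointProg : Prog :=
  .seq (setReg 5 (reg 4 % inp 0)) <| .seq (setReg 6 (reg 4 / inp 0)) <|
  .seq (setReg 7 (reg 6 / (reg 1 / inp 0))) <| .seq (setReg 8 (reg 6 % (reg 1 / inp 0))) <|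
  .seq (setReg 9 (reg 5)) <| .seq (setReg 10 (inp 0)) <|
  .seq (setReg 11 (reg 7)) <| .seq (setReg 3 (.const 1)) <|
  .loop (inp 1 - reg 3) <|
    .seq (setReg 12 (reg 8 % inp 0)) <| .seq (setReg 8 (reg 8 / inp 0)) <|
    .seq coordProg <| .seq (setReg 9 (reg 9 + reg 12 * reg 10)) <|
    .seq (setReg 10 (reg 10 * inp 0)) (setReg 3 (reg 3 + .const 1))

/-- The guard is nonzero exactly for moment curve lines. For these, the index of the direction is
also the code of its curve parameter, by the choice of `curveParam`, so register `7` serves both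
purposes. -/
theorem reaches_coordProg (h : IsSeedInput e (m + 1) d t ρ w b) (hN : 0 < N) (hM : 2 ^ k ≤ q)
    {l : LineIndex F m (2 ^ k)} {a : F} (i : Fin m) (h0 : s 0 = 2 ^ k) (h5 : s 5 = e a)
    (h7 : s 7 = (finSumFinEquiv l.1).val) (h12 : s 12 = e (l.2 i))
    (h11 : ∀ α, l.1 = .inl α → s 11 = e (curveParam e hM α ^ ((i : ℕ) + 1)))
    (hQ : ∀ s' : ℕ → ℕ, (∀ j < 11, s' j = s j) → s' 12 = e (linePoint (curveParam e hM) l a i.succ) →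
      (∀ α, l.1 = .inl α → s' 11 = e (curveParam e hM α ^ ((i : ℕ) + 1 + 1))) → Q s') :
    Reaches w b N coordProg s Q := by
  have hq : q < 2 ^ b := h.card ▸ h.lt 0
  have he : ∀ x, (e x : ℕ) < 2 ^ b := fun x => (e x).2.trans hq
  have hc : (reg 0 - reg 7).eval (regMem w s) = 2 ^ k - (finSumFinEquiv l.1).val := by
    simp only [Expr.eval_sub, h.1.eval_reg, h0, h7]
  obtain ⟨α | β, v⟩ := l
  · refine .ite h.1 hN (fun _ => ?_) fun h0 => ?_
    swap
    · exfalso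
      rw [hc, finSumFinEquiv_apply_left, Fin.val_castAdd] at h0
      omega
    have h7' : s 7 = e (curveParam e hM α) := by
      rw [h7, curveParam, Equiv.apply_symm_apply, finSumFinEquiv_apply_left, Fin.val_castAdd,
        Fin.val_castLE]
    have h11 := h11 α rfl
    have hv : (addExpr (reg 12) (mulExpr (reg 5) (reg 11))).eval (regMem w s) =
        e (linePoint (curveParam e hM) (.inl α, v) a i.succ) := by
      rw [h.eval_addExpr ((h.1.eval_reg 12).trans h12) (h.eval_mulExpr ((h.1.eval_reg 5).trans h5)
        ((h.1.eval_reg 11).trans h11))]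
      simp [linePoint, momentCurve]
    refine .seq h.1 hN (.setReg h.1 hN _ _ (hv ▸ he _) ?_)
    rw [hv]
    have hv' : (mulExpr (reg 11) (reg 7)).eval (regMem w (Function.update s 12
        (e (linePoint (curveParam e hM) (.inl α, v) a i.succ)))) =
        e (curveParam e hM α ^ ((i : ℕ) + 1 + 1)) := by
      rw [pow_succ]
      refine h.eval_mulExpr ((h.1.eval_reg 11).trans ?_) ((h.1.eval_reg 7).trans ?_)
      · simpa using h11
      · simpa using h7'
    refine .setReg h.1 hN _ _ (hv' ▸ he _) ?_
    rw [hv']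
    refine hQ _ (fun j hj => ?_) ?_ fun α' hα => ?_
    · rw [Function.update_of_ne (by omega), Function.update_of_ne (by omega)]
    · simp
    · obtain rfl := Sum.inl.inj hα
      simp
  · refine .ite h.1 hN (fun h0 => ?_) fun _ => ?_
    · exfalso
      rw [hc, finSumFinEquiv_apply_right, Fin.val_natAdd] at h0
      omega
    have hv : (mulExpr (reg 5) (reg 12)).eval (regMem w s) =
        e (linePoint (curveParam e hM) (.inr β, v) a i.succ) := by
      rw [h.eval_mulExpr ((h.1.eval_reg 5).trans h5) ((h.1.eval_reg 12).trans h12)]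
      simp [linePoint]
    refine .setReg h.1 hN _ _ (hv ▸ he _) ?_
    rw [hv]
    refine hQ _ (fun j hj => ?_) ?_ fun α' hα => by simp at hα
    · rw [Function.update_of_ne (by omega)]
    · simp

theorem reaches_pointProg (h : IsSeedInput e (m + 1) d t ρ w b)
    (hk : IsSeedSize q (m + 1) r k b N) (hM : 2 ^ k ≤ q)
    {l : LineIndex F m (2 ^ k)} {a : F} {n : ℕ} (hn : n < 2 ^ b) (ha : n % q = e a)
    (hl : n / q = lineEquiv e l) (h0 : s 0 = 2 ^ k) (h1 : s 1 = q ^ (m + 1)) (h4 : s 4 = n)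
    (hQ : ∀ s' : ℕ → ℕ, s' 1 = q ^ (m + 1) → s' 6 = lineEquiv e l →
      s' 9 = (finFunctionFinEquiv fun i => e (linePoint (curveParam e hM) l a i)).val → Q s') :
    Reaches w b N pointProg s Q := by
  have hN : 0 < N := (Nat.zero_le _).trans_lt hk.k_lt
  have hq : q < 2 ^ b := h.card ▸ h.lt 0
  have he : ∀ x, (e x : ℕ) < 2 ^ b := fun x => (e x).2.trans hq
  have hqm : ∀ i ≤ m + 1, q ^ i < 2 ^ b := by
    refine fun i hi => (Nat.pow_le_pow_right hk.card_pos hi).trans_lt (lt_of_le_of_lt ?_ hk.pow_lt)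
    rw [← hk.pow_eq]
    exact Nat.le_mul_of_pos_left _ (by positivity)
  have hb1 : 1 < 2 ^ b := lt_of_le_of_lt hk.card_pos hq
  have hmb : m + 1 < 2 ^ b := h.dim ▸ h.lt 1
  have hlb : (lineEquiv e l).val < 2 ^ b := by
    rw [← hl]
    exact (Nat.div_le_self _ _).trans_lt hn
  have hqd : q ^ (m + 1) / q = q ^ m := by rw [pow_succ, Nat.mul_div_cancel _ hk.card_pos]
  have hbl := lineEquiv_div (e := e) l
  have hvl := lineEquiv_mod (e := e) l
  have hblb : (finSumFinEquiv l.1).val < 2 ^ b := hbl ▸ (Nat.div_le_self _ _).trans_lt hlb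
  have hvlb : (finFunctionFinEquiv fun i => e (l.2 i)).val < 2 ^ b :=
    hvl ▸ (Nat.mod_le _ _).trans_lt hlb
  have hi0 : ∀ s, (inp 0).eval (regMem w s) = q := fun s =>
    (h.eval_inp (by norm_num)).trans h.card
  have hi1 : ∀ s, (inp 1).eval (regMem w s) = m + 1 := fun s =>
    (h.eval_inp (by norm_num)).trans h.dim
  set x := linePoint (curveParam e hM) l a with hx
  set V := (finFunctionFinEquiv fun i => e (l.2 i)).val with hV
  refine .seq h.1 hN (.setReg h.1 hN _ _ ?_ ?_)
  · simpa [h.1.eval_reg, hi0, h4, ha] using he _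
  refine .seq h.1 hN (.setReg h.1 hN _ _ ?_ ?_)
  · simpa [h.1.eval_reg, hi0, h4, hl] using hlb
  refine .seq h.1 hN (.setReg h.1 hN _ _ ?_ ?_)
  · simpa [h.1.eval_reg, hi0, h4, hl, h1, hqd, hbl] using hblb
  refine .seq h.1 hN (.setReg h.1 hN _ _ ?_ ?_)
  · simpa [h.1.eval_reg, hi0, h4, hl, h1, hqd, hvl] using hvlb
  refine .seq h.1 hN (.setReg h.1 hN _ _ ?_ ?_)
  · simpa [h.1.eval_reg, hi0, h4, ha] using he _
  refine .seq h.1 hN (.setReg h.1 hN _ _ ?_ ?_)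
  · simpa [hi0] using hq
  refine .seq h.1 hN (.setReg h.1 hN _ _ ?_ ?_)
  · simpa [h.1.eval_reg, hi0, h4, hl, h1, hqd, hbl] using hblb
  refine .seq h.1 hN (.setReg h.1 hN _ _ hb1 ?_)
  -- Coordinate zero is already stored, so `i` passes account for `i + 1` digits. The power in
  -- register `11` starts at exponent one, which avoids looking up the code of `1`; for rays this
  -- register is meaningless.
  refine .loop (N := 1) (T := m) h.1 one_pos (fun i s' => s' 0 = 2 ^ k ∧ s' 1 = q ^ (m + 1) ∧
      s' 3 = i + 1 ∧ s' 5 = e a ∧ s' 6 = lineEquiv e l ∧ s' 7 = (finSumFinEquiv l.1).val ∧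
      s' 8 = V / q ^ i ∧ s' 9 = digitSum (fun j => e (x j)) (i + 1) ∧ s' 10 = q ^ (i + 1) ∧
      ∀ α, l.1 = .inl α → s' 11 = e (curveParam e hM α ^ (i + 1)))
    ?_ (by have := hk.m_lt; omega) (fun i hi s' hs => ⟨?_, ?_⟩)
    fun s' hs => ⟨?_, hQ s' hs.2.1 hs.2.2.2.2.1 (hs.2.2.2.2.2.2.2.1.trans (digitSum_eq _))⟩
  · refine ⟨?_, ?_, ?_, ?_, ?_, ?_, ?_, ?_, ?_, fun α hα => ?_⟩
    · simp [h0]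
    · simp [h1]
    · simp
    · simp [h.1.eval_reg, hi0, h4, ha]
    · simp [h.1.eval_reg, hi0, h4, hl]
    · simp [h.1.eval_reg, hi0, h4, hl, h1, hqd, hbl]
    · simp [h.1.eval_reg, hi0, h4, hl, h1, hqd, hvl]
    · rw [digitSum_succ _ (by omega)]
      simp [h.1.eval_reg, hi0, h4, ha, digitSum, hx, linePoint_zero]
    · simp [hi0]
    · simp [h.1.eval_reg, hi0, h4, hl, h1, hqd, hbl, hα, curveParam]
  · simp only [Expr.eval_sub, h.1.eval_reg, hi1, hs.2.2.1]
    omega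
  · obtain ⟨h0, h1, h3, h5, h6, h7, h8, h9, h10, h11⟩ := hs
    have hdig : V / q ^ i % q = e (l.2 ⟨i, hi⟩) := finFunctionFinEquiv_div_mod _ ⟨i, hi⟩
    have hV8 : V / q ^ i / q < 2 ^ b :=
      (Nat.div_le_self _ _).trans_lt ((Nat.div_le_self _ _).trans_lt hvlb)
    refine .seq h.1 one_pos (.setReg h.1 one_pos _ _ ?_ ?_)
    · simpa [h.1.eval_reg, hi0, h8, hdig] using he _
    refine .seq h.1 one_pos (.setReg h.1 one_pos _ _ ?_ ?_)
    · simpa [h.1.eval_reg, hi0, h8] using hV8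
    refine .seq h.1 one_pos (reaches_coordProg h one_pos hM (l := l) (a := a) ⟨i, hi⟩ ?_ ?_ ?_ ?_ ?_
      fun s₁ hs₁ h12 h11 => ?_)
    · simpa using h0
    · simpa using h5
    · simpa using h7
    · simpa [h.1.eval_reg, hi0, h8] using hdig
    · simpa using h11
    have hr0 := hs₁ 0 (by norm_num)
    have hr1 := hs₁ 1 (by norm_num)
    have hr3 := hs₁ 3 (by norm_num)
    have hr5 := hs₁ 5 (by norm_num)
    have hr6 := hs₁ 6 (by norm_num)
    have hr7 := hs₁ 7 (by norm_num)
    have hr8 := hs₁ 8 (by norm_num)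
    have hr9 := hs₁ 9 (by norm_num)
    have hr10 := hs₁ 10 (by norm_num)
    simp [h.1.eval_reg, hi0, h0, h1, h3, h5, h6, h7, h8, h9, h10] at hr0 hr1 hr3 hr5 hr6 hr7 hr8 hr9 hr10
    have hX := digitSum_succ (fun j => e (x j)) (show i + 1 < m + 1 by omega)
    have hXb : digitSum (fun j => e (x j)) (i + 1 + 1) < 2 ^ b :=
      (digitSum_lt _ (by omega)).trans (hqm _ (by omega))
    have hv9 : (reg 9 + reg 12 * reg 10).eval (regMem w s₁) =
        digitSum (fun j => e (x j)) (i + 1 + 1) := by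
      simp only [Expr.eval_add, Expr.eval_mul, h.1.eval_reg, hr9, hr10, h12, hX]
      rfl
    refine .seq h.1 one_pos (.setReg h.1 one_pos _ _ (hv9 ▸ hXb) ?_)
    rw [hv9]
    refine .seq h.1 one_pos (.setReg h.1 one_pos _ _ ?_ (.setReg h.1 one_pos _ _ ?_ ?_))
    · simpa [h.1.eval_reg, hi0, hr10, pow_succ] using hqm (i + 1 + 1) (by omega)
    · simp [h.1.eval_reg, hr3]
      omega
    · refine ⟨?_, ?_, ?_, ?_, ?_, ?_, ?_, ?_, ?_, fun α hα => ?_⟩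
      · simp [hr0]
      · simp [hr1]
      · simp [h.1.eval_reg, hr3]
      · simp [hr5]
      · simp [hr6]
      · simp [hr7]
      · simp [hr8, pow_succ, Nat.div_div_eq_div_mul]
      · simp
      · simp [h.1.eval_reg, hi0, hr10, pow_succ]
      · simp [h11 α hα]
  · simp only [Expr.eval_sub, h.1.eval_reg, hi1, hs.2.2.1, tsub_self]

end Query
end ParallelLDT

namespace ParallelLDT

/-! ### Computing the verdict. -/

section Verdict
variable {F : Type*} [Field F] {q m d t r k b N : ℕ} {e : F ≃ Fin q} {ρ : Fin r → Bool}
  {w s : ℕ → ℕ} {Q : (ℕ → ℕ) → Prop}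

/-- The value after `i` steps of the evaluation of the polynomial with coefficients `p` at `a`. -/
def hornerSum (p : Fin (d + 1) → F) (a : F) (i : ℕ) : F :=
  ∑ j ∈ Finset.range (i + 1), (if h : d - i + j < d + 1 then p ⟨d - i + j, h⟩ else 0) * a ^ j

theorem hornerSum_zero (p : Fin (d + 1) → F) (a : F) :
    hornerSum p a 0 = p (Fin.last d) := by
  simp [hornerSum, Fin.last]

theorem hornerSum_succ (p : Fin (d + 1) → F) (a : F) {i : ℕ} (hi : i < d) :
    hornerSum p a (i + 1) = hornerSum p a i * a + p ⟨d - (i + 1), by omega⟩ := by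
  rw [hornerSum, Finset.sum_range_succ', hornerSum, Finset.sum_mul]
  congr 1
  · refine Finset.sum_congr rfl fun j _ => ?_
    have : d - (i + 1) + (j + 1) = d - i + j := by omega
    rw [pow_succ, mul_assoc]
    simp only [this]
  · rw [dif_pos (by omega), pow_zero, mul_one]
    rfl

theorem hornerSum_last (p : Fin (d + 1) → F) (a : F) : hornerSum p a d = coeffEval p a := by
  rw [hornerSum, Finset.sum_range, coeffEval]
  refine Finset.sum_congr rfl fun i _ => ?_
  have hi := i.2
  rw [dif_pos (by omega)]
  congr 2
  ext
  simp

/-- Evaluate the polynomial whose coefficients start at the address in the register `9`, at the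
element in the register `5`; the result is in the register `11`. -/
def hornerProg : Prog :=
  .seq (setReg 10 (inp 2)) <| .seq (setReg 11 (.load (reg 9 + reg 10))) <|
  .loop (reg 10) <| .seq (setReg 10 (reg 10 - .const 1)) <|
    setReg 11 (addExpr (mulExpr (reg 11) (reg 5)) (.load (reg 9 + reg 10)))

/-- Compare the answers, with the result in the register `7`. -/
def compareProg : Prog :=
  .seq (setReg 5 (reg 4 % inp 0)) <|
  .seq (setReg 6 (.const 4 + inp 0 * inp 0 + inp 0 * inp 0 + reg 3)) <|
  .seq (setReg 7 (.const 1)) <| .seq (setReg 8 (.const 0)) <|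
  .loop (inp 3 - reg 8) <|
    .seq (setReg 9 (reg 6 + inp 3 + reg 8 * (inp 2 + .const 1))) <|
    .seq hornerProg <| .seq (setReg 12 (.load (reg 6 + reg 8))) <|
    .seq (.ite (reg 11 - reg 12 + (reg 12 - reg 11)) (setReg 7 (.const 0)) .skip) <|
    setReg 8 (reg 8 + .const 1)

/-- Horner's scheme starts with the leading coefficient rather than with zero, whose code is
unknown. The descending index is also the loop guard. -/
theorem reaches_hornerProg (h : IsSeedInput e m d t ρ w b) (hd : d < N) {p : Fin (d + 1) → F}
    {a : F} {u : ℕ} (hp : ∀ i : Fin (d + 1), w (u + i) = e (p i)) (hu : u + (d + 1) ≤ regBase w)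
    (h5 : s 5 = e a) (h9 : s 9 = u)
    (hQ : ∀ s' : ℕ → ℕ, (∀ j < 10, s' j = s j) → s' 11 = e (coeffEval p a) → Q s') :
    Reaches w b N hornerProg s Q := by
  have hN : 0 < N := (Nat.zero_le _).trans_lt hd
  have hq : q < 2 ^ b := h.card ▸ h.lt 0
  have he : ∀ x, (e x : ℕ) < 2 ^ b := fun x => (e x).2.trans hq
  have hdb : d < 2 ^ b := h.deg ▸ h.lt 2
  have hi2 : ∀ s, (inp 2).eval (regMem w s) = d := fun s =>
    (h.eval_inp (by norm_num)).trans h.deg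
  have hw : ∀ s' : ℕ → ℕ, ∀ i (hi : i < d + 1), s' 9 = u → s' 10 = i →
      (Expr.load (reg 9 + reg 10)).eval (regMem w s') = e (p ⟨i, hi⟩) := by
    intro s' i hi h9 h10
    rw [← hp]
    simp only [Expr.eval_load, Expr.eval_add, h.1.eval_reg, h9, h10]
    exact regMem_of_lt (by omega)
  refine .seq h.1 hN (.setReg h.1 hN _ _ (by rwa [hi2]) ?_)
  rw [hi2]
  have h11 := hw (Function.update s 10 d) d (by omega) (by simp [h9]) (by simp)
  refine .seq h.1 hN (.setReg h.1 hN _ _ (h11 ▸ he _) ?_)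
  rw [h11]
  refine .loop (N := 1) (T := d) h.1 one_pos (fun i s' => (∀ j < 10, s' j = s j) ∧
      s' 10 = d - i ∧ s' 11 = e (hornerSum p a i))
    ⟨fun j hj => ?_, ?_, ?_⟩ (by omega) (fun i hi s' hs => ⟨?_, ?_⟩)
    fun s' hs => ⟨?_, hQ s' hs.1 (by rw [hs.2.2, hornerSum_last])⟩
  · rw [Function.update_of_ne (by omega), Function.update_of_ne (by omega)]
  · simp
  · rw [hornerSum_zero]
    simp [Fin.last]
  · simp only [h.1.eval_reg, hs.2.1]
    omega
  · obtain ⟨hs, h10, h11⟩ := hs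
    have h10v : (reg 10 - Expr.const 1).eval (regMem w s') = d - (i + 1) := by
      simp only [Expr.eval_sub, h.1.eval_reg, h10, Expr.eval_const]
      omega
    refine .seq h.1 one_pos (.setReg h.1 one_pos _ _ ?_ ?_)
    · rw [h10v]
      omega
    rw [h10v]
    have hv : (addExpr (mulExpr (reg 11) (reg 5)) (.load (reg 9 + reg 10))).eval
        (regMem w (Function.update s' 10 (d - (i + 1)))) = e (hornerSum p a (i + 1)) := by
      rw [hornerSum_succ p a hi]
      refine h.eval_addExpr (h.eval_mulExpr ((h.1.eval_reg _).trans ?_)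
        ((h.1.eval_reg _).trans ?_)) (hw _ _ _ ?_ ?_)
      · simpa using h11
      · simpa [hs] using h5
      · simpa [hs] using h9
      · simp
    refine .setReg h.1 one_pos _ _ (hv ▸ he _) ?_
    rw [hv]
    refine ⟨fun j hj => ?_, ?_, ?_⟩
    · rw [Function.update_of_ne (by omega), Function.update_of_ne (by omega), hs j hj]
    · simp
    · simp
  · simp only [h.1.eval_reg, hs.2.1, tsub_self]

theorem reaches_compareProg (h : IsSeedInput e m d t ρ w b) (hd : d < N) (ht : t < N)
    (hbase : regBase w < 2 ^ b) {n : ℕ} {a : F} (ha : n % q = e a) {x : Fin t → F}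
    {p : Fin t → Fin (d + 1) → F}
    (hx : ∀ j : Fin t, w (4 + q * q + q * q + r + j) = e (x j))
    (hp : ∀ (j : Fin t) (i : Fin (d + 1)),
      w (4 + q * q + q * q + r + t + j * (d + 1) + i) = e (p j i))
    (h3 : s 3 = r) (h4 : s 4 = n)
    (hQ : ∀ s' : ℕ → ℕ, s' 7 = 1 ∧ (∀ j, x j = coeffEval (p j) a) ∨
      s' 7 = 0 ∧ ¬ (∀ j, x j = coeffEval (p j) a) → Q s') :
    Reaches w b (N * N) compareProg s Q := by
  have hN : 0 < N := (Nat.zero_le _).trans_lt hd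
  have hNN : 0 < N * N := Nat.mul_pos hN hN
  have hq : q < 2 ^ b := h.card ▸ h.lt 0
  have hq0 : 0 < q := (Nat.zero_le _).trans_lt (e 0).2
  have he : ∀ x, (e x : ℕ) < 2 ^ b := fun x => (e x).2.trans hq
  have hb1 : 1 < 2 ^ b := lt_of_le_of_lt hq0 hq
  have htb : t < 2 ^ b := h.width ▸ h.lt 3
  have hi0 : ∀ s, (inp 0).eval (regMem w s) = q := fun s =>
    (h.eval_inp (by norm_num)).trans h.card
  have hi2 : ∀ s, (inp 2).eval (regMem w s) = d := fun s =>
    (h.eval_inp (by norm_num)).trans h.deg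
  have hi3 : ∀ s, (inp 3).eval (regMem w s) = t := fun s =>
    (h.eval_inp (by norm_num)).trans h.width
  have hle := h.le_base
  set E := 4 + q * q + q * q + r with hE
  refine .seq h.1 hNN (.setReg h.1 hNN _ _ ?_ ?_)
  · simpa [h.1.eval_reg, hi0, h4, ha] using he _
  refine .seq h.1 hNN (.setReg h.1 hNN _ _ ?_ ?_)
  · simp only [Expr.eval_add, Expr.eval_mul, Expr.eval_const, hi0, h.1.eval_reg,
      Function.update_of_ne (show 3 ≠ 5 by norm_num), h3]
    omega
  refine .seq h.1 hNN (.setReg h.1 hNN _ _ hb1 ?_)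
  refine .seq h.1 hNN (.setReg h.1 hNN _ _ (by positivity) ?_)
  refine .loop (N := N) (T := t) h.1 hN (fun i s' => s' 5 = e a ∧ s' 6 = E ∧ s' 8 = i ∧
      (s' 7 = 1 ∧ (∀ j : Fin t, j < i → x j = coeffEval (p j) a) ∨
        s' 7 = 0 ∧ ¬ (∀ j : Fin t, j < i → x j = coeffEval (p j) a)))
    ?_ (Nat.mul_le_mul_right _ ht) (fun i hi s' hs => ⟨?_, ?_⟩) fun s' hs => ⟨?_, hQ s' ?_⟩
  · refine ⟨?_, ?_, ?_, .inl ⟨?_, fun j hj => absurd hj (Nat.not_lt_zero _)⟩⟩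
    · simp [h.1.eval_reg, hi0, h4, ha]
    · simp [h.1.eval_reg, hi0, h3, hE]
    · simp
    · simp
  · simp only [Expr.eval_sub, hi3, h.1.eval_reg, hs.2.2.1]
    omega
  · obtain ⟨h5, h6, h8, h7⟩ := hs
    have hrow : E + t + i * (d + 1) + (d + 1) ≤ regBase w := by
      have := Nat.mul_le_mul_right (d + 1) (Nat.succ_le_of_lt hi)
      rw [Nat.succ_mul] at this
      omega
    have hv9 : (reg 6 + inp 3 + reg 8 * (inp 2 + .const 1)).eval (regMem w s') =
        E + t + i * (d + 1) := by
      simp only [Expr.eval_add, Expr.eval_mul, h.1.eval_reg, hi2, hi3, h6, h8, Expr.eval_const]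
    refine .seq h.1 hN (.setReg h.1 hN _ _ ?_ ?_)
    · rw [hv9]
      omega
    rw [hv9]
    refine .seq h.1 hN (reaches_hornerProg h hd (hp ⟨i, hi⟩) hrow (by simpa using h5) (by simp)
      fun s₁ hs₁ h11 => ?_)
    have hr5 := hs₁ 5 (by norm_num)
    have hr6 := hs₁ 6 (by norm_num)
    have hr7 := hs₁ 7 (by norm_num)
    have hr8 := hs₁ 8 (by norm_num)
    simp only [ne_eq, Nat.reduceEqDiff, not_false_eq_true, Function.update_of_ne, h5, h6, h8]
      at hr5 hr6 hr7 hr8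
    have hv12 : (Expr.load (reg 6 + reg 8)).eval (regMem w s₁) = e (x ⟨i, hi⟩) := by
      rw [← hx]
      simp only [Expr.eval_load, Expr.eval_add, h.1.eval_reg, hr6, hr8]
      exact regMem_of_lt (by omega)
    refine .seq h.1 hN (.setReg h.1 hN _ _ (hv12 ▸ he _) ?_)
    rw [hv12]
    have hlast : ∀ (s₂ : ℕ → ℕ) (v : ℕ), (∀ j < 11, j ≠ 7 → s₂ j = s₁ j) → s₂ 7 = v →
        (v = 1 ∧ (∀ j : Fin t, j < i + 1 → x j = coeffEval (p j) a) ∨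
          v = 0 ∧ ¬ (∀ j : Fin t, j < i + 1 → x j = coeffEval (p j) a)) →
        Reaches w b N (setReg 8 (reg 8 + .const 1)) s₂ fun s' => s' 5 = e a ∧ s' 6 = E ∧
          s' 8 = i + 1 ∧ (s' 7 = 1 ∧ (∀ j : Fin t, j < i + 1 → x j = coeffEval (p j) a) ∨
            s' 7 = 0 ∧ ¬ (∀ j : Fin t, j < i + 1 → x j = coeffEval (p j) a)) := by
      intro s₂ v hs₂ hv hval
      refine .setReg h.1 hN _ _ ?_ ⟨?_, ?_, ?_, ?_⟩
      · simp only [Expr.eval_add, h.1.eval_reg, Expr.eval_const, hs₂ 8 (by norm_num) (by norm_num),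
          hr8]
        omega
      · simp [hs₂ 5 (by norm_num) (by norm_num), hr5]
      · simp [hs₂ 6 (by norm_num) (by norm_num), hr6]
      · simp [h.1.eval_reg, hs₂ 8 (by norm_num) (by norm_num), hr8]
      · simpa [hv] using hval
    have hsucc : (∀ j : Fin t, j < i + 1 → x j = coeffEval (p j) a) ↔
        (∀ j : Fin t, j < i → x j = coeffEval (p j) a) ∧
          x ⟨i, hi⟩ = coeffEval (p ⟨i, hi⟩) a := by
      refine ⟨fun H => ⟨fun j hj => H j (by omega), H ⟨i, hi⟩ (by simp)⟩, fun H j hj => ?_⟩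
      rcases Nat.lt_succ_iff_lt_or_eq.1 hj with hj | hj
      · exact H.1 j hj
      · obtain rfl : j = ⟨i, hi⟩ := Fin.ext hj
        exact H.2
    -- A sum of both truncated differences vanishes only for equal codes, and codes are injective.
    have hc : (reg 11 - reg 12 + (reg 12 - reg 11)).eval
        (regMem w (Function.update s₁ 12 (e (x ⟨i, hi⟩)))) = 0 ↔
        x ⟨i, hi⟩ = coeffEval (p ⟨i, hi⟩) a := by
      simp only [Expr.eval_add, Expr.eval_sub, h.1.eval_reg, Function.update_self, h11,
        Function.update_of_ne (show 11 ≠ 12 by norm_num)]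
      rw [← e.apply_eq_iff_eq, Fin.ext_iff]
      omega
    refine .seq h.1 hN (.ite h.1 hN (fun h0 => ?_) fun h0 => ?_)
    · refine .setReg h.1 hN _ _ (by positivity) ?_
      refine hlast _ 0 (fun j hj hj7 => ?_) (by simp) (.inr ⟨rfl, ?_⟩)
      · rw [Function.update_of_ne hj7, Function.update_of_ne (by omega)]
      · rw [hsucc]
        exact fun H => h0 (hc.2 H.2)
    · refine .skip h.1 hN (hlast _ (s' 7) (fun j hj hj7 => ?_) (by simp [hr7]) ?_)
      · rw [Function.update_of_ne (by omega)]
      · rw [hsucc, and_iff_left (hc.1 h0)]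
        exact h7
  · simp only [Expr.eval_sub, hi3, h.1.eval_reg, hs.2.2.1, tsub_self]
  · have := hs.2.2.2
    simpa only [Fin.is_lt, forall_const] using this

end Verdict
end ParallelLDT

namespace ParallelLDT

/-! ### Input words and the complete programs. -/

section Words

theorem memOf_append_left {l l' : List ℕ} {i : ℕ} (hi : i < l.length) :
    memOf (l ++ l') i = memOf l i :=
  List.getD_append _ _ _ _ hi

theorem memOf_append_right {l l' : List ℕ} {n : ℕ} (hn : l.length = n) (i : ℕ) :
    memOf (l ++ l') (n + i) = memOf l' i := by
  subst hn
  rw [memOf, List.getD_append_right _ _ _ _ (Nat.le_add_right _ _), Nat.add_sub_cancel_left, memOf]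

theorem memOf_lt {l : List ℕ} {B : ℕ} (hB : 0 < B) (hl : ∀ x ∈ l, x < B) (i : ℕ) :
    memOf l i < B := by
  rw [memOf]
  by_cases hi : i < l.length
  · rw [List.getD_eq_getElem _ _ hi]
    exact hl _ (List.getElem_mem hi)
  · rwa [List.getD_eq_default _ _ (not_lt.1 hi)]

theorem memOf_ofFn {n : ℕ} (f : Fin n → ℕ) (i : Fin n) : memOf (List.ofFn f) i = f i := by
  rw [memOf, List.getD_eq_getElem _ _ (by simp)]
  simp

/-- The entries of a matrix, row by row. -/
def rowWord {n l : ℕ} (g : Fin n → Fin l → ℕ) : List ℕ :=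
  (List.finRange n).flatMap fun i => List.ofFn (g i)

theorem rowWord_succ {n l : ℕ} (g : Fin (n + 1) → Fin l → ℕ) :
    rowWord g = List.ofFn (g 0) ++ rowWord fun i => g i.succ := by
  rw [rowWord, List.finRange_succ, List.flatMap_cons, List.flatMap_map]
  rfl

theorem length_rowWord {n l : ℕ} (g : Fin n → Fin l → ℕ) : (rowWord g).length = n * l := by
  induction n with
  | zero => simp [rowWord]
  | succ n ih => rw [rowWord_succ, List.length_append, ih, List.length_ofFn]; ring

theorem memOf_rowWord {n l : ℕ} (g : Fin n → Fin l → ℕ) (i : Fin n) (j : Fin l) :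
    memOf (rowWord g) (l * i + j) = g i j := by
  induction n with
  | zero => exact i.elim0
  | succ n ih =>
    rw [rowWord_succ]
    refine Fin.cases ?_ (fun i => ?_) i
    · rw [Fin.val_zero, mul_zero, zero_add, memOf_append_left (by simp), memOf_ofFn]
    · rw [Fin.val_succ, Nat.mul_succ, add_comm _ l, add_assoc,
        memOf_append_right (List.length_ofFn), ih]

theorem lt_of_mem_rowWord {n l B : ℕ} {g : Fin n → Fin l → ℕ} (hg : ∀ i j, g i j < B) :
    ∀ x ∈ rowWord g, x < B := by
  intro x hx
  obtain ⟨i, -, hi⟩ := List.mem_flatMap.1 hx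
  obtain ⟨j, rfl⟩ := (List.mem_ofFn' _ _).1 hi
  exact hg i j

variable {F : Type*} [Field F] {q m d t r b N : ℕ}

omit [Field F] in
theorem opTable_eq (e : F ≃ Fin q) (f : F → F → F) :
    opTable e f = rowWord fun i j => (e (f (e.symm i) (e.symm j)) : ℕ) := by
  rw [opTable, rowWord]
  simp only [List.ofFn_eq_map]

omit [Field F] in
theorem memOf_opTable (e : F ≃ Fin q) (f : F → F → F) (x y : F) :
    memOf (opTable e f) (q * e x + e y) = e (f x y) := by
  rw [opTable_eq, memOf_rowWord, e.symm_apply_apply, e.symm_apply_apply]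

theorem length_inputWord (e : F ≃ Fin q) (m d t : ℕ) (ρ : Fin r → Bool) :
    (inputWord e m d t ρ).length = 4 + q * q + q * q + r := by
  simp [inputWord, opTable_eq, length_rowWord]
  ring

theorem isSeedInput_memOf (e : F ≃ Fin q) (m d t : ℕ) (ρ : Fin r → Bool) (v : List ℕ)
    (hb : 1 ≤ b) (hq : 2 ≤ q) (hqb : q ≤ 2 ^ b) (hb' : ∀ x ∈ [q, m, d, t], x < 2 ^ b)
    (hv : ∀ x ∈ v, x < q)
    (hle : 4 + q * q + q * q + r + t + t * (d + 1) ≤ (q + t) * ((q + t) * (q + t))) :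
    IsSeedInput e m d t ρ (memOf (inputWord e m d t ρ ++ v)) b := by
  have hl4 : [q, m, d, t].length = 4 := rfl
  have hlA : (opTable e fun a b => a + b).length = q * q := by rw [opTable_eq, length_rowWord]
  have hlM : (opTable e fun a b => a * b).length = q * q := by rw [opTable_eq, length_rowWord]
  have hb0 : regBase (memOf (inputWord e m d t ρ ++ v)) = (q + t) * ((q + t) * (q + t)) := rfl
  have hw : inputWord e m d t ρ ++ v = [q, m, d, t] ++ ((opTable e fun a b => a + b) ++
      ((opTable e fun a b => a * b) ++ (List.ofFn (fun i => (ρ i).toNat) ++ v))) := by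
    simp only [inputWord, List.append_assoc]
  have htab : ∀ f : F → F → F, ∀ x ∈ opTable e f, x < q := fun f => by
    rw [opTable_eq]
    exact lt_of_mem_rowWord fun i j => (e _).2
  refine ⟨⟨hb, ?_, memOf_lt (by positivity) fun x hx => ?_⟩, rfl, rfl, rfl, rfl, fun x y => ?_,
    fun x y => ?_, fun i => ?_, ?_⟩
  · rw [hb0]
    omega
  · rw [hw] at hx
    simp only [List.mem_append] at hx
    rcases hx with hx | hx | hx | hx | hx
    · exact hb' x hx
    · exact (htab _ x hx).trans_le hqb
    · exact (htab _ x hx).trans_le hqb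
    · obtain ⟨i, rfl⟩ := (List.mem_ofFn' _ _).1 hx
      exact (Bool.toNat_le _).trans_lt (hq.trans hqb)
    · exact (hv x hx).trans_le hqb
  · have := mul_add_lt (e x) (e y)
    rw [hw, add_assoc, memOf_append_right hl4, memOf_append_left (by omega), memOf_opTable]
  · have := mul_add_lt (e x) (e y)
    rw [hw, add_assoc, add_assoc, memOf_append_right hl4, memOf_append_right hlA,
      memOf_append_left (by omega), memOf_opTable]
  · rw [hw, add_assoc, add_assoc, memOf_append_right hl4, memOf_append_right hlA,
      memOf_append_right hlM, memOf_append_left (by simp), memOf_ofFn]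
  · rw [hb0]
    exact hle

end Words

section Programs
variable {F : Type*} [Field F] {q m d t r k b N : ℕ}

/-- The program that computes the two queries. -/
def queryProg : Prog :=
  .seq (.seq seedProg pointProg)
    (.seq (.assign (.const 1) (reg 1 + reg 6)) (.assign (.const 0) (reg 9)))

/-- The program that computes the verdict. -/
def verdictProg : Prog := .seq (.seq seedProg compareProg) (.assign (.const 0) (reg 7))

/-- The registers at the start. -/
def initReg (w : ℕ → ℕ) : ℕ → ℕ := fun i => w (regBase w + i)

theorem regMem_initReg (w : ℕ → ℕ) : regMem w (initReg w) = w := by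
  ext i
  rw [regMem]
  split_ifs with h
  · rfl
  · rw [initReg, Nat.add_sub_cancel' (not_lt.1 h)]

theorem queryProg_runs {e : F ≃ Fin q} {ρ : Fin r → Bool} {w : ℕ → ℕ}
    (h : IsSeedInput e (m + 1) d t ρ w b) (hk : IsSeedSize q (m + 1) r k b N) (hM : 2 ^ k ≤ q)
    (hq : 2 ≤ q) (hr : (2 ^ k + 2 ^ k) * q ^ m * q = 2 ^ r) :
    ∃ (M : ℕ → ℕ) (c : ℕ), queryProg.Runs w M c ∧ c ≤ queryProg.weight * (b * N) ∧
      M 0 = posCode e ((linePointVerifier e (curveParam e hM) d t hr).query ρ 0) ∧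
      M 1 = posCode e ((linePointVerifier e (curveParam e hM) d t hr).query ρ 1) := by
  have hN : 0 < N := (Nat.zero_le _).trans_lt hk.k_lt
  have key : Reaches w b N (.seq seedProg pointProg) (initReg w) fun s' =>
      s' 1 = q ^ (m + 1) ∧ s' 6 = (lineEquiv e (seedEquiv e hr ρ).1).val ∧
      s' 9 = (finFunctionFinEquiv fun i => e (linePoint (curveParam e hM)
        (seedEquiv e hr ρ).1 (seedEquiv e hr ρ).2 i)).val := by
    refine .seq h.1 hN (reaches_seedProg h hk fun s h0 h1 _ h4 => ?_)
    refine reaches_pointProg h hk hM ((digitSum_lt _ le_rfl).trans hk.pow_lt) (coinSum_mod hr ρ)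
      (coinSum_div hr ρ) h0 h1 h4 fun s' h1 h6 h9 => ⟨h1, h6, h9⟩
  obtain ⟨s, c, hs, ⟨h1, h6, h9⟩, hrun, hc⟩ := key fun i => h.lt _
  set l := (seedEquiv e hr ρ).1
  rw [regMem_initReg] at hrun
  -- Each summand is at most half of `2^r`, the second one strictly less than half, since `2 ≤ q`.
  have hv : q ^ (m + 1) + (lineEquiv e l).val < 2 ^ b := by
    refine lt_of_lt_of_le ?_ hk.pow_lt.le
    have hl := (lineEquiv e l).2
    have h2 : 1 ≤ 2 ^ k := Nat.one_le_two_pow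
    have h3 := Nat.mul_le_mul_right (q ^ (m + 1)) h2
    have h4 := Nat.mul_le_mul_left ((2 ^ k + 2 ^ k) * q ^ m) hq
    have h5 := hk.pow_eq
    rw [one_mul] at h3
    rw [mul_assoc] at h5
    omega
  have hev : (reg 1 + reg 6).eval (regMem w s) = q ^ (m + 1) + (lineEquiv e l).val := by
    rw [Expr.eval_add, h.1.eval_reg, h.1.eval_reg, h1, h6]
  -- Register addresses depend on cells `0` and `3` only, so they survive writing cell `1`. Cell `0`
  -- has to be written last.
  set w' := Function.update w 1 (q ^ (m + 1) + (lineEquiv e l).val) with hw'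
  have hbase : regBase w' = regBase w := by simp [regBase, hw']
  have hupd : Function.update (regMem w s) 1 (q ^ (m + 1) + (lineEquiv e l).val) =
      regMem w' s := by
    ext i
    have hi : w' i = if i = 1 then q ^ (m + 1) + (lineEquiv e l).val else w i :=
      Function.update_apply _ _ _ _
    simp only [Function.update_apply, regMem, hbase, hi]
    have := h.base
    split_ifs <;> first | rfl | omega
  have hi : IsInput w' b := ⟨h.pos, hbase ▸ h.base, fun i => by
    rw [hw', Function.update_apply]
    split_ifs
    exacts [hv, h.lt i]⟩
  have hrun1 := Prog.Runs.assign (.const 1) (reg 1 + reg 6) (regMem w s)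
  rw [hev, Expr.eval_const, hupd] at hrun1
  have hrun2 := Prog.Runs.assign (.const 0) (reg 9) (regMem w' s)
  rw [hi.eval_reg, Expr.eval_const, h9] at hrun2
  refine ⟨_, _, .seq hrun (.seq hrun1 hrun2), ?_, ?_, ?_⟩
  · have c1 := h.1.cost_le hN hs (.const 1)
    have c2 := h.1.cost_le hN hs (reg 1 + reg 6)
    have c3 := hi.cost_le hN hs (.const 0)
    have c4 := hi.cost_le hN hs (reg 9)
    have := Nat.mul_pos h.pos hN
    rw [queryProg, Prog.weight, Prog.weight, Prog.weight, Prog.weight]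
    simp only [add_mul] at hc ⊢
    rw [Prog.weight] at hc
    simp only [add_mul] at hc
    rw [Prog.weight]
    simp only [add_mul]
    omega
  · rw [Function.update_self]
    rfl
  · rw [Function.update_of_ne (by norm_num), regMem_of_lt (by rw [hbase]; have := h.base; omega),
      hw', Function.update_self]
    rfl

theorem verdictProg_runs {e : F ≃ Fin q} {ρ : Fin r → Bool} {w : ℕ → ℕ}
    (h : IsSeedInput e (m + 1) d t ρ w b) (hk : IsSeedSize q (m + 1) r k b N)
    (hr : (2 ^ k + 2 ^ k) * q ^ m * q = 2 ^ r) (hd : d < N) (ht : t < N)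
    (hbase : regBase w < 2 ^ b) {x : Fin t → F} {p : Fin t → Fin (d + 1) → F}
    (hx : ∀ j : Fin t, w (4 + q * q + q * q + r + j) = e (x j))
    (hp : ∀ (j : Fin t) (i : Fin (d + 1)),
      w (4 + q * q + q * q + r + t + j * (d + 1) + i) = e (p j i)) :
    ∃ (M : ℕ → ℕ) (c : ℕ), verdictProg.Runs w M c ∧ c ≤ verdictProg.weight * (b * (N * N)) ∧
      (M 0 = 1 ∧ (∀ j, x j = coeffEval (p j) (seedEquiv e hr ρ).2) ∨
        M 0 = 0 ∧ ¬ (∀ j, x j = coeffEval (p j) (seedEquiv e hr ρ).2)) := by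
  have hN : 0 < N := (Nat.zero_le _).trans_lt hk.k_lt
  have hNN : 0 < N * N := Nat.mul_pos hN hN
  have key : Reaches w b (N * N) (.seq seedProg compareProg) (initReg w) fun s' =>
      s' 7 = 1 ∧ (∀ j, x j = coeffEval (p j) (seedEquiv e hr ρ).2) ∨
        s' 7 = 0 ∧ ¬ (∀ j, x j = coeffEval (p j) (seedEquiv e hr ρ).2) := by
    refine .seq h.1 hNN (.mono_count (reaches_seedProg h hk fun s _ _ h3 h4 => ?_)
      (Nat.le_mul_of_pos_right _ hN))
    exact reaches_compareProg h hd ht hbase (coinSum_mod hr ρ) hx hp h3 h4 fun s' h7 => h7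
  obtain ⟨s, c, hs, h7, hrun, hc⟩ := key fun i => h.lt _
  rw [regMem_initReg] at hrun
  have hrun1 := Prog.Runs.assign (.const 0) (reg 7) (regMem w s)
  rw [h.1.eval_reg, Expr.eval_const] at hrun1
  refine ⟨_, _, .seq hrun hrun1, ?_, ?_⟩
  · have c1 := h.1.cost_le hNN hs (.const 0)
    have c2 := h.1.cost_le hNN hs (reg 7)
    have := Nat.mul_pos h.pos hNN
    rw [verdictProg, Prog.weight, Prog.weight]
    rw [Prog.weight] at hc ⊢
    simp only [add_mul] at hc ⊢
    omega
  · rw [Function.update_self]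
    exact h7

theorem linePointVerifier_runsWithin (e : F ≃ Fin q) (hk : IsSeedSize q (m + 1) r k b N)
    (hM : 2 ^ k ≤ q) (hr : (2 ^ k + 2 ^ k) * q ^ m * q = 2 ^ r) (hq : 2 ≤ q) (hqb : q < 2 ^ b)
    (hmb : m + 1 < 2 ^ b) (hdN : d < N) (htN : t < N) (hdb : d < 2 ^ b) (htb : t < 2 ^ b)
    (hle : 4 + q * q + q * q + r + t + t * (d + 1) ≤ (q + t) * ((q + t) * (q + t)))
    (hlt : (q + t) * ((q + t) * (q + t)) < 2 ^ b) :
    (linePointVerifier e (curveParam e hM) d t hr).RunsWithin e queryProg verdictProg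
      ((queryProg.weight + verdictProg.weight) * (b * (N * N))) := by
  have hN : 0 < N := (Nat.zero_le _).trans_lt hk.k_lt
  have hb : 1 ≤ b := (Nat.zero_le _).trans_lt hk.r_lt
  have hb' : ∀ x ∈ [q, m + 1, d, t], x < 2 ^ b := by simp [hqb, hmb, hdb, htb]
  refine ⟨fun ρ => ?_, fun ρ T π => ?_⟩
  · have h := isSeedInput_memOf e (m + 1) d t ρ [] hb hq hqb.le hb' (by simp) hle
    rw [List.append_nil] at h
    obtain ⟨M, c, h1, h2, h3⟩ := queryProg_runs h hk hM hq hr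
    refine ⟨M, c, h1, h2.trans (Nat.mul_le_mul (Nat.le_add_right _ _) ?_), h3⟩
    exact Nat.mul_le_mul_left _ (Nat.le_mul_of_pos_right _ hN)
  · set x := T (linePoint (curveParam e hM) (seedEquiv e hr ρ).1 (seedEquiv e hr ρ).2) with hx
    set p := π (lineEquiv e (seedEquiv e hr ρ).1) with hp
    have h0 : entryWord e ((linePointVerifier e (curveParam e hM) d t hr).answers T π ρ 0) =
      List.ofFn fun j => (e (x j) : ℕ) := rfl
    have h1 : entryWord e ((linePointVerifier e (curveParam e hM) d t hr).answers T π ρ 1) =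
      rowWord fun j i => (e (p j i) : ℕ) := rfl
    rw [h0, h1, List.append_assoc]
    have h := isSeedInput_memOf e (m + 1) d t ρ
      (List.ofFn (fun j => (e (x j) : ℕ)) ++ rowWord fun j i => (e (p j i) : ℕ))
      hb hq hqb.le hb' (fun y hy => ?_) hle
    swap
    · rcases List.mem_append.1 hy with hy | hy
      · obtain ⟨i, rfl⟩ := (List.mem_ofFn' _ _).1 hy
        exact (e _).2
      · exact lt_of_mem_rowWord (fun i j => (e _).2) y hy
    have hl := length_inputWord e (m + 1) d t ρ
    have hwx : ∀ j : Fin t, memOf (inputWord e (m + 1) d t ρ ++ (List.ofFn (fun j => (e (x j) : ℕ)) ++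
        rowWord fun j i => (e (p j i) : ℕ))) (4 + q * q + q * q + r + j) = e (x j) := fun j => by
      rw [memOf_append_right hl, memOf_append_left (by simp), memOf_ofFn]
    have hwp : ∀ (j : Fin t) (i : Fin (d + 1)),
        memOf (inputWord e (m + 1) d t ρ ++ (List.ofFn (fun j => (e (x j) : ℕ)) ++
          rowWord fun j i => (e (p j i) : ℕ)))
          (4 + q * q + q * q + r + t + j * (d + 1) + i) = e (p j i) := fun j i => by
      rw [add_assoc, add_assoc (4 + q * q + q * q + r), memOf_append_right hl,
        memOf_append_right (List.length_ofFn), mul_comm, memOf_rowWord]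
    obtain ⟨M, c, h2, h3, h4⟩ := verdictProg_runs h hk hr hdN htN (by exact hlt) hwx hwp
    refine ⟨M, c, h2, h3.trans (Nat.mul_le_mul_right _ (Nat.le_add_left _ _)), ?_⟩
    classical
    have hv : (linePointVerifier e (curveParam e hM) d t hr).verdict ρ
        ((linePointVerifier e (curveParam e hM) d t hr).answers T π ρ) = true ↔
        ∀ j, x j = coeffEval (p j) (seedEquiv e hr ρ).2 :=
      (linePointVerifier_accepts_iff T π ρ).trans funext_iff
    rcases h4 with ⟨h4, h5⟩ | ⟨h4, h5⟩
    · rw [hv.2 h5, h4]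
      rfl
    · rw [Bool.eq_false_iff.2 fun h => h5 (hv.1 h), h4]
      rfl

end Programs
end ParallelLDT

namespace ParallelLDT

/-! ### Choice of parameters and the main theorem. -/

section Parameters

/-- Rounding `2^50 * m` up to a power of two loses less than a factor of two, and `q = 2^s` makes
the number of outcomes a power of two. -/
theorem exists_isSeedSize {q m s d t : ℕ} (hm : 0 < m) (hs : 0 < s) (hq : q = 2 ^ s)
    (h : 2 ^ 100 * m * s ≤ q) :
    ∃ k, IsSeedSize q m (s * m + k + 1) k (q + m + d + t) (q + m + d + t) ∧
      2 ^ k < 2 ^ 51 * m ∧ s * m + k + 1 < q := by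
  refine ⟨Nat.clog 2 (2 ^ 50 * m), ?_⟩
  set k := Nat.clog 2 (2 ^ 50 * m) with hk
  have h1 : 2 ^ 50 * m ≤ 2 ^ k := Nat.le_pow_clog (by norm_num) _
  have hlt : ∀ i < k, 2 ^ i < 2 ^ 50 * m := fun i hi => Nat.pow_lt_of_lt_clog hi
  have h2 : 2 ^ k < 2 ^ 51 * m := by
    have hk0 : k ≠ 0 := by
      intro h0
      rw [h0] at h1
      omega
    obtain ⟨i, hi⟩ := Nat.exists_eq_succ_of_ne_zero hk0
    have := hlt i (by omega)
    rw [hi, pow_succ]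
    omega
  have hkk : k < 2 ^ k := Nat.lt_two_pow_self
  have hms : m ≤ m * s := Nat.le_mul_of_pos_right _ hs
  have hlt' : s * m + k + 1 < q := by
    rw [mul_comm s]
    rw [mul_assoc] at h
    omega
  refine ⟨⟨h1, hlt, ?_, by omega, by omega, ?_, by omega, by omega⟩, h2, hlt'⟩
  · rw [hq, ← pow_mul, pow_add, pow_add]
    ring
  · omega

theorem mul_mul_lt_two_pow {j : ℕ} (hj : 10 ≤ j) : j * (j * j) < 2 ^ j := by
  induction j, hj using Nat.le_induction with
  | base => norm_num
  | succ j hj ih => rw [pow_succ]; nlinarith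

/-- The input with both answers has at most `4 (q + t)^2` cells and `4 ≤ q + t`, so registers
starting at `(q + t)^3` lie beyond it. -/
theorem input_length_le {q d t r : ℕ} (hq : 4 ≤ q) (hd : d ≤ q) (hr : r ≤ q) :
    4 + q * q + q * q + r + t + t * (d + 1) ≤ (q + t) * ((q + t) * (q + t)) := by
  have h1 : 4 + q * q + q * q + r + t + t * (d + 1) ≤ 4 * ((q + t) * (q + t)) := by
    have := Nat.mul_le_mul_left t hd
    nlinarith
  exact h1.trans (Nat.mul_le_mul_right _ (by omega))

end Parameters

theorem exists_codewordTest : ∃ (c : ℕ) (Q D : Prog),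
    ∀ (F : Type*) [Field F] [Fintype F] [CharP F 2] (e : F ≃ Fin (Fintype.card F))
      (m d t : ℕ), 0 < m →
      6 * (m : ℝ) * d ≤ Fintype.card F →
      2 ^ 100 * (m : ℝ) * Real.logb 2 (Fintype.card F) ≤ Fintype.card F →
      ∃ V : Verifier F m d t,
        V.RunsWithin e Q D ((Fintype.card F + m + d + t) ^ c) ∧
        (V.coins : ℝ) ≤ m * Real.logb 2 (Fintype.card F) +
          c * (Real.logb 2 (Real.logb 2 (Fintype.card F)) + Real.logb 2 m) ∧
        (V.proofLen : ℝ) ≤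
          (Fintype.card F : ℝ) ^ m * (m * Real.logb 2 (Fintype.card F)) ^ c ∧
        (∀ T ∈ parallelRM F m d t, ∃ π : V.Proof, ∀ ρ, V.Accepts T π ρ) ∧
        (∀ (T : Table F m t) (δ : ℝ), IsFar δ T (parallelRM F m d t) →
          ∀ π : V.Proof, (1 / 2 ^ 40) * δ ≤ V.rejectProb T π) := by
  -- With `W` the sum of the weights, `W * n^3 ≤ n^(W + 3)` bounds the cost. The summand `12`
  -- absorbs the coin overhead `k + 1 ≤ 52 + log m`, because `log log |F| ≥ 6`.
  refine ⟨queryProg.weight + verdictProg.weight + 12, queryProg, verdictProg, ?_⟩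
  intro F _ _ _ e m d t hm hd hq
  set W := queryProg.weight + verdictProg.weight
  obtain ⟨m, rfl⟩ : ∃ m', m = m' + 1 := ⟨m - 1, by omega⟩
  obtain ⟨⟨s, hs⟩, -, hcard⟩ := FiniteField.card F 2
  rw [PNat.mk_coe] at hcard
  have hlog : Real.logb 2 (Fintype.card F) = s := by
    rw [hcard]
    push_cast
    rw [Real.logb_pow, Real.logb_self_eq_one (by norm_num), mul_one]
  rw [hlog] at hq ⊢
  generalize hqdef : Fintype.card F = q at *
  have hq' : 2 ^ 100 * (m + 1) * s ≤ q := by exact_mod_cast hq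
  have hd' : 6 * ((m + 1) * d) ≤ q := by
    rw [← mul_assoc]
    exact_mod_cast hd
  have hms : (m + 1) ≤ (m + 1) * s := Nat.le_mul_of_pos_right _ hs
  have hq100 : 2 ^ 100 ≤ q := by
    rw [mul_assoc] at hq'
    omega
  have hs100 : 100 ≤ s := by
    rw [hcard] at hq100
    exact (Nat.pow_le_pow_iff_right (by norm_num)).1 hq100
  obtain ⟨k, hsize, hk51, hrq⟩ :=
    exists_isSeedSize (m := m + 1) (d := d) (t := t) hm hs hcard hq'
  set n := q + (m + 1) + d + t with hn
  have hM2 : 2 ^ k + 2 ^ k ≤ q := by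
    rw [mul_assoc] at hq'
    omega
  have hM : 2 ^ k ≤ q := by omega
  have hr : (2 ^ k + 2 ^ k) * q ^ m * q = 2 ^ (s * (m + 1) + k + 1) := by
    rw [← hsize.pow_eq]
    ring
  have hnn : n < 2 ^ n := Nat.lt_two_pow_self
  have hdq : d ≤ q := le_trans (le_trans (Nat.le_mul_of_pos_left d m.succ_pos)
    (Nat.le_mul_of_pos_left _ (by norm_num))) hd'
  have hcube : (q + t) * ((q + t) * (q + t)) < 2 ^ n := by
    have h1 : q + t ≤ n := by omega
    exact (Nat.mul_le_mul h1 (Nat.mul_le_mul h1 h1)).trans_lt (mul_mul_lt_two_pow (by omega))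
  have hle := input_length_le (t := t) (by omega : 4 ≤ q) hdq hrq.le
  refine ⟨linePointVerifier e (curveParam e hM) d t hr, ?_, ?_, ?_, fun T hT =>
    linePointVerifier_complete hT, fun T δ hT π => ?_⟩
  · have h1 := linePointVerifier_runsWithin (d := d) (t := t) e hsize hM hr (by omega) (by omega)
      (by omega) (by omega) (by omega) (by omega) (by omega) hle hcube
    have h2 : W * (n * (n * n)) ≤ n ^ (W + 12) := by
      have h3 : W ≤ n ^ W := Nat.lt_two_pow_self.le.trans (Nat.pow_le_pow_left (by omega) _)
      calc W * (n * (n * n)) ≤ n ^ W * (n * (n * n)) := Nat.mul_le_mul_right _ h3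
        _ = n ^ (W + 3) := by ring
        _ ≤ n ^ (W + 12) := Nat.pow_le_pow_right (by omega) (by omega)
    refine ⟨fun ρ => ?_, fun ρ T π => ?_⟩
    · obtain ⟨M, c, h3, h4, h5⟩ := h1.1 ρ
      exact ⟨M, c, h3, h4.trans h2, h5⟩
    · obtain ⟨M, c, h3, h4, h5⟩ := h1.2 ρ T π
      exact ⟨M, c, h3, h4.trans h2, h5⟩
  · have hlogm : 0 ≤ Real.logb 2 ((m + 1 : ℕ) : ℝ) :=
      Real.logb_nonneg (by norm_num) (by exact_mod_cast m.succ_pos)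
    have hlogs : 6 ≤ Real.logb 2 (s : ℝ) := by
      rw [Real.le_logb_iff_rpow_le (by norm_num) (by exact_mod_cast hs)]
      have : (100 : ℝ) ≤ s := by exact_mod_cast hs100
      norm_num
      linarith
    have hkm : (k : ℝ) ≤ 51 + Real.logb 2 ((m + 1 : ℕ) : ℝ) := by
      have h1 : (2 : ℝ) ^ k ≤ 2 ^ 51 * ((m + 1 : ℕ) : ℝ) := by exact_mod_cast hk51.le
      have h2 := Real.logb_le_logb_of_le (b := 2) (by norm_num) (by positivity) h1
      rw [Real.logb_mul (by positivity) (by positivity), Real.logb_pow, Real.logb_pow,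
        Real.logb_self_eq_one (by norm_num)] at h2
      norm_num at h2 ⊢
      linarith
    change ((s * (m + 1) + k + 1 : ℕ) : ℝ) ≤ _
    have hW : (0 : ℝ) ≤ W := Nat.cast_nonneg _
    push_cast at hlogm hkm ⊢
    nlinarith [mul_nonneg hW (add_nonneg (by linarith : (0 : ℝ) ≤ Real.logb 2 (s : ℝ)) hlogm)]
  · change (((2 ^ k + 2 ^ k) * q ^ m : ℕ) : ℝ) ≤ _
    have h1 : (2 ^ k + 2 ^ k) * q ^ m ≤ q ^ (m + 1) * ((m + 1) * s) ^ (W + 12) := by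
      refine (Nat.mul_le_mul_right _ hM2).trans ?_
      rw [← pow_succ']
      exact Nat.le_mul_of_pos_right _ (by positivity)
    exact_mod_cast h1
  · exact linePointVerifier_sound (curveParam_injective hM) e (hqdef ▸ hd') (by omega) hsize.le_pow hr hT π

end ParallelLDT

theorem mainTheorem9 :
    -- codeword testing: absolute constant `c`, one uniform pair of programs `Q`, `D`
    (∃ (c : ℕ) (Q D : ParallelLDT.Prog),
      ∀ (F : Type*) [Field F] [Fintype F] [CharP F 2] (e : F ≃ Fin (Fintype.card F))
        (m d t : ℕ), 0 < m →
        6 * (m : ℝ) * d ≤ Fintype.card F →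
        2 ^ 100 * (m : ℝ) * Real.logb 2 (Fintype.card F) ≤ Fintype.card F →
        ∃ V : Verifier F m d t,
          V.RunsWithin e Q D ((Fintype.card F + m + d + t) ^ c) ∧
          (V.coins : ℝ) ≤ m * Real.logb 2 (Fintype.card F) +
            c * (Real.logb 2 (Real.logb 2 (Fintype.card F)) + Real.logb 2 m) ∧
          (V.proofLen : ℝ) ≤
            (Fintype.card F : ℝ) ^ m * (m * Real.logb 2 (Fintype.card F)) ^ c ∧
          (∀ T ∈ parallelRM F m d t, ∃ π : V.Proof, ∀ ρ, V.Accepts T π ρ) ∧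
          (∀ (T : Table F m t) (δ : ℝ), IsFar δ T (parallelRM F m d t) →
            ∀ π : V.Proof, (1 / 2 ^ 40) * δ ≤ V.rejectProb T π)) ∧
    -- soundness of the augmented derandomized test along small-biased directions
    (∀ (F : Type*) [Field F] [Fintype F] (m d t : ℕ), 0 < m →
        6 * (m : ℝ) * d ≤ Fintype.card F →
        2 ^ 100 * (m : ℝ) * Real.logb 2 (Fintype.card F) ≤ Fintype.card F →
        ∀ lam : ℝ, lam ≤ 1 / (2 ^ 100 * (m : ℝ) * Real.logb 2 (Fintype.card F)) →
        ∀ S : Finset (Fin m → F), IsBiasedSet lam S →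
        ∀ (f : Table F m t) (g : LineOracle F m d t),
          (∀ δ : ℝ, 0 < δ → 1 - δ ≤ augLDTestAccept S f g →
            IsClose (2 ^ 40 * δ) f (parallelRM F m d t)) ∧
          (augLDTestAccept S f g = 1 → f ∈ parallelRM F m d t)) := by
  refine ⟨exists_codewordTest, fun F _ _ m d t hm hd hq lam hlam S hS f g => ⟨fun δ hδ hacc =>
    isClose_of_augLDTestAccept hm hd hq hlam hS hδ hacc, fun hacc => ?_⟩⟩
  -- Perfect acceptance meets the quantitative bound for every positive error, and distances are
  -- discrete.
  refine mem_parallelRM_of_isClose fun δ hδ => ?_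
  have h := isClose_of_augLDTestAccept (δ := δ / 2 ^ 40) hm hd hq hlam hS (by positivity)
    (by rw [hacc]; linarith [show 0 < δ / 2 ^ 40 by positivity])
  rwa [mul_div_cancel₀ _ (by positivity)] at h
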